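/- Let $n\ge 1$ and let $K$ be a centrally symmetric convex $(2n+4)$-gon. A diagonal of $K$ is central if it passes through the center of $K$. Every triangulation of $K$ that is invariant under the central inversion contains exactly one central diagonal and $n$ centrally symmetric pairs of non-central diagonals. A colored triangulation is such a triangulation together with an assignment of colors from a fixed $n$-set to its non-central diagonals such that two of them have the same color if and only if they are equal or form a centrally symmetric pair; the central diagonal carries the extra label $c^*$. Flips (replacing a diagonal by the other diagonal of the quadrilateral formed by its two adjacent triangles) are performed on the central diagonal, or simultaneously on the two diagonals of a centrally symmetric pair, and preserve labels. For a set $C$ of labels (colors, or $c^*$), write $t\sim_C t'$ if the colored triangulation $t'$ is obtained from $t$ by a sequence of flips of diagonals with labels in $C$. The colorful $(n+1)$-cyclohedron $\mathcal{Z}^c_n$ is the abstract $(n+1)$-polytope whose faces are the empty set and all equivalence classes of the relations $\sim_C$, ordered by inclusion; the classes for $|C|=j$ are its $j$-faces. The ordinary $(n+1)$-cyclohedron $\mathcal{Z}_n$ is the polytope whose non-empty faces are the centrally symmetric sets of pairwise non-crossing diagonals of $K$, ordered by reverse inclusion. Let $\Gamma(\mathcal{P})$ denote the group of order-automorphisms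 of the face poset of $\mathcal{P}$ (which includes the empty face), $S_n$ the symmetric group on $n$ letters, and $D_m$ the dihedral group of order $2m$. **Theorem.** 1. If $n>1$, then $\Gamma(\mathcal{Z}^c_n)\cong S_n\times D_{n+2}$. 2. $\Gamma(\mathcal{Z}^c_1)\cong D_6$. 3. If $n>1$, then $\Gamma(\mathcal{Z}_n)\cong D_{n+2}$. -/

import Mathlib

namespace Cyclohedron

/-- The vertices of the centrally symmetric convex `(2n+4)`-gon `K`, labelled in cyclic order. -/
abbrev Vertex (n : ℕ) : Type := ZMod (2 * n + 4)

/-- The central inversion of `K`, acting on line segments between vertices of `K`. -/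
def inversion (n : ℕ) (d : Sym2 (Vertex n)) : Sym2 (Vertex n) :=
  d.map fun v => v + ((n + 2 : ℕ) : Vertex n)

/-- The segment `d` is a boundary edge of `K`. -/
def IsSide (n : ℕ) (d : Sym2 (Vertex n)) : Prop :=
  ∃ a : Vertex n, d = s(a, a + 1)

/-- The segment `d` is a diagonal of `K`: it joins two distinct vertices and is not a boundary
edge. -/
def IsDiagonal (n : ℕ) (d : Sym2 (Vertex n)) : Prop :=
  ¬ d.IsDiag ∧ ¬ IsSide n d

/-- The diagonal `d` passes through the center of `K`: its ends are opposite vertices. -/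
def IsCentral (n : ℕ) (d : Sym2 (Vertex n)) : Prop :=
  ∃ a : Vertex n, d = s(a, a + ((n + 2 : ℕ) : Vertex n))

/-- The segments `d` and `e` cross in the interior of `K`: they have four distinct ends, and the
ends of `e` lie on different sides of `d`. -/
def Cross (n : ℕ) (d e : Sym2 (Vertex n)) : Prop :=
  ∃ a b x y : Vertex n, d = s(a, b) ∧ e = s(x, y) ∧ sbtw a x b ∧ sbtw b y a

/-- A dissection of `K`: a set of pairwise non-crossing diagonals. -/
def IsDissection (n : ℕ) (D : Set (Sym2 (Vertex n))) : Prop :=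
  (∀ d ∈ D, IsDiagonal n d) ∧ ∀ d ∈ D, ∀ e ∈ D, ¬ Cross n d e

/-- A triangulation of `K`, given by its set of diagonals: a dissection that no further diagonal
refines. -/
def IsTriangulation (n : ℕ) (T : Set (Sym2 (Vertex n))) : Prop :=
  Maximal (IsDissection n) T

/-- A set of diagonals that is invariant under the central inversion of `K`. -/
def IsCentrallySymmetric (n : ℕ) (D : Set (Sym2 (Vertex n))) : Prop :=
  ∀ d ∈ D, inversion n d ∈ D

/-- A colored centrally symmetric triangulation of `K`. The colors are the elements of `Fin n`;
`none` stands for "no color". Each non-central diagonal has a color, and two non-central diagonals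
have the same color exactly when they are equal or form a centrally symmetric pair. The central
diagonal has no color. (So that equal colored triangulations are equal as terms, `color` is set to
`none` outside the triangulation.) -/
@[ext]
structure ColoredTriangulation (n : ℕ) where
  /-- the underlying uncolored triangulation -/
  supp : Set (Sym2 (Vertex n))
  /-- the color of a diagonal -/
  color : Sym2 (Vertex n) → Option (Fin n)
  isTriangulation : IsTriangulation n supp
  isCentrallySymmetric : IsCentrallySymmetric n supp
  color_of_notMem : ∀ d, d ∉ supp → color d = none
  color_eq_none_iff : ∀ d ∈ supp, (color d = none ↔ IsCentral n d)
  color_eq_color_iff : ∀ d ∈ supp, ∀ e ∈ supp, ¬ IsCentral n d → ¬ IsCentral n e →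
    (color d = color e ↔ e = d ∨ e = inversion n d)

/-- In the triangulation `T`, the flip of the diagonal `d` is `d'`: the two triangles of `T` that
share the edge `d = {a, c}` form a quadrilateral `a, b, c, e`, and `d' = {b, e}` is the other
diagonal of this quadrilateral. -/
def IsDiagonalFlip (n : ℕ) (T : Set (Sym2 (Vertex n))) (d d' : Sym2 (Vertex n)) : Prop :=
  d ∈ T ∧ ∃ a b c e : Vertex n, sbtw a b c ∧ sbtw c e a ∧ d = s(a, c) ∧ d' = s(b, e) ∧
    ∀ f ∈ ({s(a, b), s(b, c), s(c, e), s(e, a)} : Set (Sym2 (Vertex n))), f ∈ T ∨ IsSide n f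

/-- `t'` arises from `t` by the flip with label `c`, where `c` is a color, or `none` (the "uncolor"
`c*`) for the flip of the central diagonal. A diagonal `d` of `t` with label `c` is flipped to
`d'`, simultaneously with its image under the central inversion (which is `d` itself if `d` is
central); the new diagonals get the label of the old ones, and all other diagonals stay, with their
colors. -/
def IsFlip (n : ℕ) (c : Option (Fin n)) (t t' : ColoredTriangulation n) : Prop :=
  ∃ d d' : Sym2 (Vertex n), IsDiagonalFlip n t.supp d d' ∧ t.color d = c ∧
    t'.supp = (t.supp \ {d, inversion n d}) ∪ {d', inversion n d'} ∧
    t'.color d' = c ∧ t'.color (inversion n d') = c ∧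
    ∀ f ∈ t.supp \ {d, inversion n d}, t'.color f = t.color f

/-- The equivalence relation `∼_C` for a set `C` of labels: `t` and `t'` are joined by a sequence
of flips with labels in `C`. -/
def FlipEquiv (n : ℕ) (C : Set (Option (Fin n))) :
    ColoredTriangulation n → ColoredTriangulation n → Prop :=
  Relation.EqvGen fun t t' => ∃ c ∈ C, IsFlip n c t t'

/-- The colorful `(n+1)`-cyclohedron as a partially ordered set. A face is identified with its set
of vertices: it is the empty set (the face of rank `-1`) or an equivalence class `(C, t)` of some
`∼_C`, of rank `|C|`, where `C` is a subset of the `(n+1)`-element set of labels. Faces are ordered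
by inclusion. -/
abbrev ColorfulCyclohedron (n : ℕ) : Type :=
  {F : Set (ColoredTriangulation n) //
    F = ∅ ∨ ∃ (C : Set (Option (Fin n))) (t : ColoredTriangulation n), F = {t' | FlipEquiv n C t t'}}

/-- A centrally symmetric dissection of `K`. -/
abbrev SymmetricDissection (n : ℕ) : Type :=
  {D : Set (Sym2 (Vertex n)) // IsDissection n D ∧ IsCentrallySymmetric n D}

/-- The face lattice of the ordinary `(n+1)`-cyclohedron: the non-empty faces are the centrally
symmetric dissections of `K` (the vertices of such a face are the centrally symmetric
triangulations that contain the given diagonals), ordered by reverse inclusion, together with the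
empty face. -/
abbrev OrdinaryCyclohedron (n : ℕ) : Type :=
  WithBot (SymmetricDissection n)ᵒᵈ

/-- The automorphism group `Γ(P)`: the order-preserving bijections of the set of faces (whose
inverses preserve the order as well), under composition. -/
abbrev AutGroup (P : Type) [PartialOrder P] : Type := P ≃o P

end Cyclohedron

/-! Each label acts on the colored triangulations as an involution, its flip, and the non-empty
faces are the classes generated by sets of labels. A face through a given vertex is determined by
its label set, so a poset automorphism induces an isomorphism of Boolean lattices at every vertex,
hence a bijection of labels. Adjacent vertices induce the same bijection and the flip graph is
connected, so every automorphism is a pair (φ, σ) with φ ∘ r_l = r_{σ l} ∘ φ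
(`exists_flipEquivariant`). By connectedness φ is determined by σ and by one value. It therefore
suffices to find a group of such pairs that realizes every possible combination of σ and φ(x₀) and
in which only the identity fixes the labels and x₀ (`nonempty_autGroup_mulEquiv`).

Orbits of diagonals under the inversion are intervals in ℤ of length 2, …, n + 2 modulo translation
by n + 2. Assigning to each interval the apex of the triangle below it shows that maximal
non-crossing sets have exactly n + 1 members (`Noncrossing.ncard_le`, `Full.ncard`). Every member
has one exchange, so a flip is the only change of a labelled triangulation at a single label
(`Labelling.flip_eq_iff`); hence relabellings and dihedral motions commute with flips automatically.
The base vertex x₀ is the fan of all arcs that start at 0. Flips lead every triangulation to it: the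
degree of an end of the central diagonal can be increased, the central flip rotates the fan, and
five flips in a pentagon transpose two consecutive colors (`Labelling.conn_fan`).

Let n > 1. The product of the central flip with any other flip has trivial sixth power
(`iterate_central`), whereas every color belongs to a pentagon, where the product of two flips has
order 5 (`Rooted.exists_iterate_ne`). Hence σ fixes c*. Once the color permutation is undone, φ
preserves which flips commute at which vertex, and the images of the fan under the dihedral group
are recognized by such data alone (`IsFanLike.exists_move`). So φ(x₀) is a dihedral image of the
fan, and the group is S_n × D_{n+2}.

For n = 1 the triangulations form a torsor under D₃ on which the two flips are right multiplications
by reflections; the symmetries of this hexagon can be written down and checked by evaluation.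

An automorphism of the ordinary cyclohedron comes from a map of orbits of diagonals, so it acts on
labelled triangulations and commutes with flips, except that the central diagonal might receive
another label m. Swapping m back gives an equivariant pair of the colorful kind, which forces m =
c*; the colors are then fixed and only D_{n+2} remains (`exists_arcAction`). -/

namespace Cyclohedron

open Relation

/-! ### Flip systems of involutions, their face posets, and automorphisms of these -/

section FlipPoset

variable {X L : Type}

/-- The equivalence class of `x` under the flips with labels in `C`. -/
def flipClass (R : L → X → X → Prop) (C : Set L) (x : X) : Set X :=
  {y | EqvGen (fun t t' => ∃ c ∈ C, R c t t') x y}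

/-- The poset of all flip classes together with the empty set. -/
abbrev FlipPoset (R : L → X → X → Prop) : Type :=
  {F : Set X // F = ∅ ∨ ∃ (C : Set L) (x : X), F = flipClass R C x}

variable {R : L → X → X → Prop} {r : L → X → X}

theorem mem_flipClass_self (C : Set L) (x : X) : x ∈ flipClass R C x := EqvGen.refl x

theorem flipClass_eq {C : Set L} {x y : X} (h : y ∈ flipClass R C x) :
    flipClass R C y = flipClass R C x := by
  ext z
  exact ⟨fun hz => h.trans _ _ _ hz, fun hz => (h.symm _ _).trans _ _ _ hz⟩

theorem flipClass_mono {C D : Set L} (h : C ⊆ D) (x : X) :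
    flipClass R C x ⊆ flipClass R D x := by
  intro y hy
  refine EqvGen.mono (p := fun t t' => ∃ c ∈ D, R c t t') ?_ x y hy
  rintro a b ⟨c, hc, hab⟩
  exact ⟨c, h hc, hab⟩

theorem flip_mem_flipClass (hR : ∀ c x y, R c x y ↔ y = r c x) {C : Set L} {c : L} (hc : c ∈ C)
    (x : X) : r c x ∈ flipClass R C x :=
  EqvGen.rel _ _ ⟨c, hc, (hR _ _ _).2 rfl⟩

/-- Since flips are involutions, a property that they preserve is also reflected by them, so it
passes along the symmetric closure in both directions. -/
theorem flipClass_induction (hR : ∀ c x y, R c x y ↔ y = r c x)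
    (hinv : ∀ c x, r c (r c x) = x) {C : Set L} {x : X}
    {P : X → Prop} (h0 : P x) (hs : ∀ y, P y → ∀ c ∈ C, P (r c y)) {y : X}
    (hy : y ∈ flipClass R C x) : P y := by
  have key : ∀ a b, EqvGen (fun t t' => ∃ c ∈ C, R c t t') a b → (P a ↔ P b) := by
    intro a b hab
    induction hab with
    | rel a b h =>
      obtain ⟨c, hc, h⟩ := h
      rw [hR] at h
      subst h
      refine ⟨fun h => hs _ h c hc, fun h => ?_⟩
      have := hs _ h c hc
      rwa [hinv] at this
    | refl => rfl
    | symm _ _ _ ih => exact ih.symm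
    | trans _ _ _ _ _ ih1 ih2 => exact ih1.trans ih2
  exact (key _ _ hy).1 h0

theorem flipClass_empty (hR : ∀ c x y, R c x y ↔ y = r c x) (hinv : ∀ c x, r c (r c x) = x)
    (x : X) : flipClass R ∅ x = {x} := by
  ext y
  refine ⟨fun h => ?_, fun h => ?_⟩
  · exact flipClass_induction hR hinv (P := fun y => y ∈ ({x} : Set X)) rfl (by simp) h
  · rw [Set.mem_singleton_iff] at h
    subst h
    exact mem_flipClass_self _ _

theorem flipClass_singleton (hR : ∀ c x y, R c x y ↔ y = r c x)
    (hinv : ∀ c x, r c (r c x) = x) {c : L} {x y : X} (h : y ∈ flipClass R {c} x) :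
    y = x ∨ y = r c x := by
  refine flipClass_induction hR hinv (P := fun y => y = x ∨ y = r c x) (Or.inl rfl) ?_ h
  rintro y (rfl | rfl) c' rfl
  · exact Or.inr rfl
  · exact Or.inl (hinv _ _)

/-- The label set of a class can be read off at any of its vertices: by `hind`, it consists of the
labels whose flip stays inside. -/
theorem subset_of_flipClass_subset (hR : ∀ c x y, R c x y ↔ y = r c x)
    (hind : ∀ C x l, r l x ∈ flipClass R C x → l ∈ C) {C D : Set L} {x y : X}
    (h : flipClass R C x ⊆ flipClass R D y) : C ⊆ D := by
  intro c hc
  have hx := h (mem_flipClass_self C x)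
  have := h (flip_mem_flipClass hR hc x)
  rw [← flipClass_eq hx] at this
  exact hind _ _ _ this

/-- A pair `(φ, σ)` of permutations of vertices and labels that is compatible with flips. -/
def FlipEquivariant (r : L → X → X) (φ : X → X) (σ : L → L) : Prop :=
  ∀ l x, φ (r l x) = r (σ l) (φ x)

theorem FlipEquivariant.mem_flipClass (hR : ∀ c x y, R c x y ↔ y = r c x)
    (hinv : ∀ c x, r c (r c x) = x) {φ : X → X} {σ : L → L} (h : FlipEquivariant r φ σ)
    {C : Set L} {x y : X} (hy : y ∈ flipClass R C x) : φ y ∈ flipClass R (σ '' C) (φ x) := by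
  refine flipClass_induction hR hinv (P := fun y => φ y ∈ flipClass R (σ '' C) (φ x))
    (mem_flipClass_self _ _) ?_ hy
  intro y hy c hc
  rw [h]
  exact hy.trans _ _ _ (flip_mem_flipClass hR (Set.mem_image_of_mem _ hc) _)

theorem FlipEquivariant.image_flipClass (hR : ∀ c x y, R c x y ↔ y = r c x)
    (hinv : ∀ c x, r c (r c x) = x) {φ : Equiv.Perm X} {σ : Equiv.Perm L}
    (h : FlipEquivariant r φ σ) (C : Set L) (x : X) :
    φ '' flipClass R C x = flipClass R (σ '' C) (φ x) := by
  have h' : FlipEquivariant r φ.symm σ.symm := by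
    intro l x
    rw [Equiv.symm_apply_eq, h]
    simp
  ext y
  constructor
  · rintro ⟨y, hy, rfl⟩
    exact h.mem_flipClass hR hinv hy
  · intro hy
    refine ⟨φ.symm y, ?_, by simp⟩
    have := h'.mem_flipClass hR hinv hy
    simpa [Set.image_image] using this

/-- Agreement propagates along flips, and the flip graph is connected. This rigidity reduces every
later question to the image of one vertex. -/
theorem FlipEquivariant.eq_of_eq (hR : ∀ c x y, R c x y ↔ y = r c x)
    (hinv : ∀ c x, r c (r c x) = x) (hconn : ∀ x y, y ∈ flipClass R Set.univ x)
    {φ ψ : X → X} {σ : L → L} (h : FlipEquivariant r φ σ) (h' : FlipEquivariant r ψ σ) {x : X}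
    (hx : φ x = ψ x) : φ = ψ := by
  funext y
  refine flipClass_induction hR hinv (P := fun y => φ y = ψ y) hx ?_ (hconn x y)
  intro y hy c _
  rw [h, h', hy]

/-- The face that consists of the single vertex `x`. -/
def vertexFace (hR : ∀ c x y, R c x y ↔ y = r c x) (hinv : ∀ c x, r c (r c x) = x) (x : X) :
    FlipPoset R :=
  ⟨{x}, Or.inr ⟨∅, x, (flipClass_empty hR hinv x).symm⟩⟩

theorem vertexFace_le (hR : ∀ c x y, R c x y ↔ y = r c x) (hinv : ∀ c x, r c (r c x) = x) {x : X}
    {F : FlipPoset R} : vertexFace hR hinv x ≤ F ↔ x ∈ F.1 :=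
  Set.singleton_subset_iff

theorem exists_eq_flipClass {F : FlipPoset R} {x : X} (hx : x ∈ F.1) :
    ∃ C, F.1 = flipClass R C x := by
  rcases F.2 with h | ⟨C, y, h⟩
  · rw [h] at hx
    exact hx.elim
  · rw [h] at hx
    exact ⟨C, h.trans (flipClass_eq hx).symm⟩

/-- Vertices are the minimal non-empty faces, and the empty face, being least, is preserved. A
vertex y of the image pulls back to a non-empty face inside {x}. -/
theorem exists_map_vertexFace (hR : ∀ c x y, R c x y ↔ y = r c x)
    (hinv : ∀ c x, r c (r c x) = x) (Φ : FlipPoset R ≃o FlipPoset R) (x : X) :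
    ∃ y, Φ (vertexFace hR hinv x) = vertexFace hR hinv y := by
  have hne : (Φ (vertexFace hR hinv x)).1.Nonempty := by
    by_contra h
    rw [Set.not_nonempty_iff_eq_empty] at h
    have h1 : Φ (vertexFace hR hinv x) ≤ Φ ⟨∅, Or.inl rfl⟩ := by
      change (Φ (vertexFace hR hinv x)).1 ⊆ _
      rw [h]
      exact Set.empty_subset _
    rw [Φ.le_iff_le, vertexFace_le] at h1
    exact h1
  obtain ⟨y, hy⟩ := hne
  refine ⟨y, le_antisymm ?_ ((vertexFace_le hR hinv).2 hy)⟩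
  have h1 : Φ.symm (vertexFace hR hinv y) ≤ vertexFace hR hinv x := by
    rw [← Φ.le_iff_le, Φ.apply_symm_apply]
    exact (vertexFace_le hR hinv).2 hy
  have h2 : (Φ.symm (vertexFace hR hinv y)).1.Nonempty := by
    by_contra h
    rw [Set.not_nonempty_iff_eq_empty] at h
    have h1 : Φ.symm (vertexFace hR hinv y) ≤ Φ.symm ⟨∅, Or.inl rfl⟩ := by
      change (Φ.symm (vertexFace hR hinv y)).1 ⊆ _
      rw [h]
      exact Set.empty_subset _
    rw [Φ.symm.le_iff_le, vertexFace_le] at h1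
    exact h1
  obtain ⟨z, hz⟩ := h2
  have hzx : z = x := h1 hz
  subst hzx
  rw [← vertexFace_le hR hinv, ← Φ.le_iff_le, Φ.apply_symm_apply] at hz
  exact hz

/-- Every automorphism of the poset of flip classes comes from permutations of the vertices and of
the labels. -/
theorem exists_flipEquivariant (hR : ∀ c x y, R c x y ↔ y = r c x)
    (hinv : ∀ c x, r c (r c x) = x)
    (hind : ∀ C x l, r l x ∈ flipClass R C x → l ∈ C)
    (hconn : ∀ x y, y ∈ flipClass R Set.univ x) [Nonempty X]
    (Φ : FlipPoset R ≃o FlipPoset R) :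
    ∃ (φ : Equiv.Perm X) (σ : Equiv.Perm L), FlipEquivariant r φ σ ∧
      ∀ F, (Φ F).1 = φ '' F.1 := by
  choose f hf using exists_map_vertexFace hR hinv Φ
  choose g hg using exists_map_vertexFace hR hinv Φ.symm
  have vinj : ∀ x y, vertexFace hR hinv x = vertexFace hR hinv y → x = y := by
    intro x y h
    have : ({x} : Set X) = {y} := congrArg Subtype.val h
    simpa using this
  let φ : Equiv.Perm X := ⟨f, g, fun x => vinj _ _ (by rw [← hg, ← hf, Φ.symm_apply_apply]),
    fun x => vinj _ _ (by rw [← hf, ← hg, Φ.apply_symm_apply])⟩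
  have hφ : ∀ x, Φ (vertexFace hR hinv x) = vertexFace hR hinv (φ x) := hf
  have hmem : ∀ F x, φ x ∈ (Φ F).1 ↔ x ∈ F.1 := by
    intro F x
    rw [← vertexFace_le hR hinv, ← hφ, Φ.le_iff_le, vertexFace_le]
  have himg : ∀ F, (Φ F).1 = φ '' F.1 := by
    intro F
    ext y
    rw [Equiv.image_eq_preimage_symm, Set.mem_preimage, ← hmem F, Equiv.apply_symm_apply]
  let cl : Set L → X → FlipPoset R := fun C x => ⟨flipClass R C x, Or.inr ⟨C, x, rfl⟩⟩
  -- The faces through x form a copy of the Boolean lattice of label sets; `e x` is the isomorphism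
  -- that Φ induces from the copy at x to the copy at φ x.
  have hcl : ∀ x C, ∃ D, (Φ (cl C x)).1 = flipClass R D (φ x) := fun x C =>
    exists_eq_flipClass ((hmem _ _).2 (mem_flipClass_self C x))
  choose e he using hcl
  have he' : ∀ x C, Φ (cl C x) = cl (e x C) (φ x) := fun x C => Subtype.ext (he x C)
  have cl_le : ∀ C D x, cl C x ≤ cl D x ↔ C ⊆ D := fun C D x =>
    ⟨fun h => subset_of_flipClass_subset hR hind h, fun h => flipClass_mono h x⟩
  have ele : ∀ x C D, e x C ⊆ e x D ↔ C ⊆ D := by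
    intro x C D
    rw [← cl_le _ _ (φ x), ← he', ← he', Φ.le_iff_le, cl_le]
  have esurj : ∀ x D, ∃ C, e x C = D := by
    intro x D
    have hx : x ∈ (Φ.symm (cl D (φ x))).1 := by
      rw [← hmem, Φ.apply_symm_apply]
      exact mem_flipClass_self _ _
    obtain ⟨C, hC⟩ := exists_eq_flipClass hx
    refine ⟨C, ?_⟩
    have h1 : Φ.symm (cl D (φ x)) = cl C x := Subtype.ext hC
    have h2 : cl D (φ x) = cl (e x C) (φ x) := by rw [← he', ← h1, Φ.apply_symm_apply]
    exact Set.Subset.antisymm ((cl_le _ _ _).1 h2.ge) ((cl_le _ _ _).1 h2.le)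
  let E : X → (Set L ≃o Set L) := fun x =>
    OrderIso.ofSurjective (OrderEmbedding.ofMapLEIff (e x) (ele x)) (esurj x)
  have hE : ∀ x C, E x C = e x C := fun _ _ => rfl
  -- Atoms of a Boolean lattice are singletons, so `e x` comes from a bijection `s x` of labels.
  have hs : ∀ x l, ∃ l', e x {l} = {l'} := by
    intro x l
    rw [← hE, ← Set.isAtom_iff, OrderIso.isAtom_iff]
    exact Set.isAtom_singleton l
  choose s hs using hs
  have hsmem : ∀ x C l, s x l ∈ e x C ↔ l ∈ C := by
    intro x C l
    rw [← Set.singleton_subset_iff, ← hs, ele, Set.singleton_subset_iff]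
  have hssurj : ∀ x, Function.Surjective (s x) := by
    intro x l'
    obtain ⟨C, hC⟩ := esurj x {l'}
    have : IsAtom C := by
      rw [← (E x).isAtom_iff, hE, hC]
      exact Set.isAtom_singleton l'
    obtain ⟨l, rfl⟩ := Set.isAtom_iff.1 this
    exact ⟨l, by simpa [hs] using hC⟩
  have hsinj : ∀ x, Function.Injective (s x) := by
    intro x l l' h
    have h1 : e x {l} = e x {l'} := by rw [hs, hs, h]
    exact Set.singleton_injective ((E x).injective h1)
  have hne : ∀ l x, r l x ≠ x := by
    intro l x h
    exact hind ∅ x l (by rw [h]; exact mem_flipClass_self _ _)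
  have hflip : ∀ x l, φ (r l x) = r (s x l) (φ x) := by
    intro x l
    have h1 : φ (r l x) ∈ (Φ (cl {l} x)).1 := (hmem _ _).2 (flip_mem_flipClass hR (Set.mem_singleton l) x)
    rw [he, hs] at h1
    rcases flipClass_singleton hR hinv h1 with h1 | h1
    · exact (hne _ _ (φ.injective h1)).elim
    · exact h1
  -- For l ∈ C the vertices x and r l x span the same face, so their local isomorphisms agree on C.
  have econst : ∀ x l C, l ∈ C → e (r l x) C = e x C := by
    intro x l C hl
    have h1 : cl C (r l x) = cl C x := Subtype.ext (flipClass_eq (flip_mem_flipClass hR hl x))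
    have h2 : cl (e (r l x) C) (φ (r l x)) = cl (e x C) (φ x) := by rw [← he', ← he', h1]
    exact Set.Subset.antisymm (subset_of_flipClass_subset hR hind h2.le)
      (subset_of_flipClass_subset hR hind h2.ge)
  have sconst : ∀ x l, s (r l x) = s x := by
    intro x l
    have h0 : s (r l x) l = s x l := by
      apply Set.singleton_injective
      rw [← hs, ← hs, econst _ _ _ (Set.mem_singleton l)]
    funext l'
    by_cases hl : l' = l
    · rw [hl, h0]
    obtain ⟨k, hk⟩ := hssurj x (s (r l x) l')
    -- The set {l, l'} contains l, so `econst` applies to it: the image of l' at r l x is `s x l` or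
    -- `s x l'`, and injectivity excludes the first.
    have h1 : s (r l x) l' ∈ e x {l, l'} := by
      rw [← econst x l _ (by simp), hsmem]
      simp
    rw [← hk, hsmem] at h1
    rcases h1 with h1 | h1
    · rw [h1, ← h0] at hk
      exact (hl (hsinj _ hk).symm).elim
    · rw [Set.mem_singleton_iff] at h1
      rw [← hk, h1]
  obtain ⟨x0⟩ := ‹Nonempty X›
  have sall : ∀ x, s x = s x0 := by
    intro x
    refine flipClass_induction hR hinv (P := fun x => s x = s x0) rfl ?_ (hconn x0 x)
    intro y hy c _
    rw [sconst, hy]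
  refine ⟨φ, Equiv.ofBijective (s x0) ⟨hsinj x0, hssurj x0⟩, ?_, himg⟩
  intro l x
  rw [hflip, sall]
  rfl

/-- A group that acts freely, compatibly with flips, and that realizes every compatible pair of
permutations at one vertex is the automorphism group of the poset of flip classes. -/
theorem nonempty_autGroup_mulEquiv (hR : ∀ c x y, R c x y ↔ y = r c x)
    (hinv : ∀ c x, r c (r c x) = x)
    (hind : ∀ C x l, r l x ∈ flipClass R C x → l ∈ C)
    (hconn : ∀ x y, y ∈ flipClass R Set.univ x)
    {H : Type} [Group H] (ρ : H →* Equiv.Perm X) (s : H →* Equiv.Perm L)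
    (heq : ∀ g, FlipEquivariant r (ρ g) (s g)) (x0 : X)
    (hfree : ∀ g, s g = 1 → ρ g x0 = x0 → g = 1)
    (hsurj : ∀ (φ : Equiv.Perm X) (σ : Equiv.Perm L), FlipEquivariant r φ σ →
      ∃ g, s g = σ ∧ ρ g x0 = φ x0) :
    Nonempty (AutGroup (FlipPoset R) ≃* H) := by
  have hface : ∀ g, ∀ F : FlipPoset R, ρ g '' F.1 = ∅ ∨
      ∃ (C : Set L) (x : X), ρ g '' F.1 = flipClass R C x := by
    rintro g ⟨F, rfl | ⟨C, x, rfl⟩⟩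
    · exact Or.inl (Set.image_empty _)
    · exact Or.inr ⟨_, _, (heq g).image_flipClass hR hinv C x⟩
  let Θ : H → AutGroup (FlipPoset R) := fun g =>
    { toFun := fun F => ⟨ρ g '' F.1, hface g F⟩
      invFun := fun F => ⟨ρ g⁻¹ '' F.1, hface g⁻¹ F⟩
      left_inv := fun F => Subtype.ext (by simp [Set.image_image])
      right_inv := fun F => Subtype.ext (by simp [Set.image_image])
      map_rel_iff' := by
        intro F F'
        exact Set.image_subset_image_iff (ρ g).injective }
  have hΘ : ∀ g F, (Θ g F).1 = ρ g '' F.1 := fun _ _ => rfl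
  let Θ' : H →* AutGroup (FlipPoset R) := MonoidHom.mk' Θ (by
    intro a b
    apply OrderIso.ext
    funext F
    apply Subtype.ext
    rw [RelIso.mul_apply, hΘ, hΘ, hΘ, map_mul, Set.image_image]
    rfl)
  refine ⟨(MulEquiv.ofBijective Θ' ⟨?_, ?_⟩).symm⟩
  · rw [injective_iff_map_eq_one]
    intro g hg
    have hρ : ∀ x, ρ g x = x := by
      intro x
      have h1 : Θ g (vertexFace hR hinv x) = vertexFace hR hinv x := by
        change Θ' g _ = _
        rw [hg]
        rfl
      have h2 := congrArg Subtype.val h1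
      rw [hΘ] at h2
      simpa [vertexFace] using h2
    refine hfree g (Equiv.ext fun l => ?_) (hρ x0)
    have h1 := heq g l x0
    rw [hρ, hρ] at h1
    -- If g fixes all vertices, the flips l and s g l agree at x0, and `hind` then identifies the
    -- two labels.
    have h2 : r (s g l) x0 ∈ flipClass R {l} x0 := h1 ▸ flip_mem_flipClass hR (Set.mem_singleton l) x0
    exact hind {l} _ _ h2
  · intro Φ
    have : Nonempty X := ⟨x0⟩
    obtain ⟨φ, σ, hφ, hΦ⟩ := exists_flipEquivariant hR hinv hind hconn Φ
    obtain ⟨g, rfl, hg⟩ := hsurj φ σ hφ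
    refine ⟨g, ?_⟩
    have h1 : (ρ g : X → X) = φ := (heq g).eq_of_eq hR hinv hconn hφ hg
    apply OrderIso.ext
    funext F
    apply Subtype.ext
    rw [hΦ]
    change ρ g '' F.1 = _
    rw [h1]

end FlipPoset

end Cyclohedron

/-! ### Orbits of diagonals as intervals in ℤ, and the size of maximal non-crossing sets -/

namespace Cyclohedron

/-- An orbit of segments of `K` under the central inversion: the segment from `i` to `j`, where
`i < j ≤ i + (n + 2)`, is recorded by the class of `i` modulo `n + 2` and the length `j - i`. -/
abbrev Arc (n : ℕ) : Type := ZMod (n + 2) × ℤ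

/-- The orbit of the segment from `i` to `j`. -/
def arc (n : ℕ) (i j : ℤ) : Arc n := ((i : ZMod (n + 2)), j - i)

variable {n : ℕ}

theorem arc_eq_arc_iff {i j p q : ℤ} :
    arc n i j = arc n p q ↔ ((n : ℤ) + 2) ∣ p - i ∧ q - p = j - i := by
  have h := ZMod.intCast_eq_intCast_iff_dvd_sub i p (n + 2)
  push_cast at h
  simp only [arc, Prod.mk.injEq]
  rw [h, eq_comm (a := j - i)]

theorem exists_arc (α : Arc n) : ∃ i, arc n i (i + α.2) = α := by
  obtain ⟨i, hi⟩ := ZMod.intCast_surjective α.1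
  exact ⟨i, Prod.ext hi (by simp [arc])⟩

theorem arc_shift {k : ℤ} (hk : ((n : ℤ) + 2) ∣ k) (i j : ℤ) :
    arc n (i + k) (j + k) = arc n i j := by
  rw [arc_eq_arc_iff]
  refine ⟨?_, by ring⟩
  have : i - (i + k) = -k := by ring
  rw [this]
  exact hk.neg_right

theorem arc_snd (i j : ℤ) : (arc n i j).2 = j - i := rfl

theorem arc_fst (i j : ℤ) : (arc n i j).1 = (i : ZMod (n + 2)) := rfl

theorem eq_zero_of_dvd_of_lt {k : ℤ} (hk : ((n : ℤ) + 2) ∣ k) (h1 : -((n : ℤ) + 2) < k)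
    (h2 : k < (n : ℤ) + 2) : k = 0 :=
  Int.eq_zero_of_abs_lt_dvd hk (abs_lt.2 ⟨h1, h2⟩)

theorem intCast_zmod_eq_iff {i p : ℤ} :
    (i : ZMod (n + 2)) = (p : ZMod (n + 2)) ↔ ((n : ℤ) + 2) ∣ p - i := by
  have h := ZMod.intCast_eq_intCast_iff_dvd_sub i p (n + 2)
  push_cast at h
  exact h

theorem arc_ne_of_start {i j p q : ℤ} (h0 : i ≠ p) (h1 : p - i < (n : ℤ) + 2)
    (h2 : i - p < (n : ℤ) + 2) : arc n i j ≠ arc n p q := by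
  intro h
  have := eq_zero_of_dvd_of_lt (arc_eq_arc_iff.1 h).1 (by omega) (by omega)
  omega

theorem arc_ne_of_length {i j p q : ℤ} (h0 : j - i ≠ q - p) : arc n i j ≠ arc n p q := by
  intro h
  have := (arc_eq_arc_iff.1 h).2
  omega

/-- The sides of `K` and the segments in the orbits in `S`, on the level of lifts to `ℤ`. -/
def Edge (S : Set (Arc n)) (i j : ℤ) : Prop := j = i + 1 ∨ arc n i j ∈ S

/-- A set of pairwise non-crossing orbits of diagonals. -/
structure Noncrossing (S : Set (Arc n)) : Prop where
  len : ∀ α ∈ S, 2 ≤ α.2 ∧ α.2 ≤ (n : ℤ) + 2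
  nc : ∀ i j p q : ℤ, arc n i j ∈ S → arc n p q ∈ S → ¬ (i < p ∧ p < j ∧ j < q)

theorem Edge.mono {S T : Set (Arc n)} (h : S ⊆ T) {i j : ℤ} (hE : Edge S i j) : Edge T i j :=
  hE.imp id fun h' => h h'

theorem Edge.shift {S : Set (Arc n)} {i j k : ℤ} (h : Edge S i j) (hk : ((n : ℤ) + 2) ∣ k) :
    Edge S (i + k) (j + k) := by
  rcases h with h | h
  · left
    omega
  · right
    rwa [arc_shift hk]

theorem Edge.side (S : Set (Arc n)) (i : ℤ) : Edge S i (i + 1) := Or.inl rfl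

theorem Edge.mem {S : Set (Arc n)} {i j : ℤ} (h : Edge S i j) (hij : i + 2 ≤ j) : arc n i j ∈ S := by
  rcases h with h | h
  · omega
  · exact h

namespace Noncrossing

variable {S : Set (Arc n)}

theorem mono {T : Set (Arc n)} (hS : Noncrossing S) (h : T ⊆ S) : Noncrossing T :=
  ⟨fun α hα => hS.len α (h hα), fun i j p q h1 h2 => hS.nc i j p q (h h1) (h h2)⟩

theorem lt (hS : Noncrossing S) {i j : ℤ} (h : Edge S i j) : i < j := by
  rcases h with h | h
  · omega
  · have := hS.len _ h
    rw [arc_snd] at this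
    omega

theorem le (hS : Noncrossing S) {i j : ℤ} (h : Edge S i j) : j ≤ i + ((n : ℤ) + 2) := by
  rcases h with h | h
  · omega
  · have := hS.len _ h
    rw [arc_snd] at this
    omega

theorem edge (hS : Noncrossing S) {i j p q : ℤ} (h : Edge S i j) (h' : Edge S p q) :
    ¬ (i < p ∧ p < j ∧ j < q) := by
  rcases h with h | h
  · omega
  rcases h' with h' | h'
  · omega
  exact hS.nc i j p q h h'

/-- An interval of length at most n + 2 never crosses its own translates by multiples of n + 2, and
every other crossing can be translated so that it involves the given lift (i, j). -/
theorem insert_arc (hS : Noncrossing S) {i j : ℤ} (h1 : i + 2 ≤ j) (h2 : j ≤ i + ((n : ℤ) + 2))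
    (h : ∀ p q, arc n p q ∈ S → ¬ (p < i ∧ i < q ∧ q < j) ∧ ¬ (i < p ∧ p < j ∧ j < q)) :
    Noncrossing (insert (arc n i j) S) := by
  constructor
  · rintro α (rfl | hα)
    · rw [arc_snd]
      omega
    · exact hS.len α hα
  · rintro i' j' p q (h3 | h3) (h4 | h4) h5
    · have h6 := arc_eq_arc_iff.1 (h3.trans h4.symm)
      have h7 := arc_eq_arc_iff.1 h3
      have := eq_zero_of_dvd_of_lt h6.1 (by omega) (by omega)
      omega
    · have h6 := arc_eq_arc_iff.1 h3
      rw [← arc_shift h6.1] at h4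
      have := h _ _ h4
      omega
    · have h6 := arc_eq_arc_iff.1 h4
      rw [← arc_shift h6.1] at h3
      have := h _ _ h3
      omega
    · exact hS.nc _ _ _ _ h3 h4 h5

/-- Take the longest proper edge (i, x). An edge over x inside [i, j] must start at i, as it would
cross (i, x) otherwise, and by the choice of x it must end at j. -/
theorem exists_apex (hS : Noncrossing S) {i j : ℤ} (h : Edge S i j) (hij : i + 2 ≤ j) :
    ∃ x, i < x ∧ x < j ∧ Edge S i x ∧
      ∀ p q, Edge S p q → p < x → x < q → i ≤ p → q ≤ j → p = i ∧ q = j := by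
  obtain ⟨x, ⟨hx, hxj⟩, hmax⟩ := Int.exists_greatest_of_bdd (P := fun x => Edge S i x ∧ x < j)
    ⟨j, fun z hz => hz.2.le⟩ ⟨i + 1, Edge.side S i, by omega⟩
  refine ⟨x, hS.lt hx, hxj, hx, ?_⟩
  intro p q hpq hpx hxq hip hqj
  have h1 := hS.edge hx hpq
  have h2 : p = i := by omega
  subst h2
  refine ⟨rfl, ?_⟩
  by_contra h3
  have := hmax q ⟨hpq, by omega⟩
  omega

/-- The end of a longest edge works: an edge over it would either cross that edge or be longer. -/
theorem exists_uncovered (hS : Noncrossing S) : ∃ a, ∀ p q, Edge S p q → ¬ (p < a ∧ a < q) := by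
  obtain ⟨k, ⟨i, hi⟩, hmax⟩ := Int.exists_greatest_of_bdd (P := fun k => ∃ i, Edge S i (i + k))
    ⟨(n : ℤ) + 2, fun z ⟨i, hi⟩ => by have := hS.le hi; omega⟩ ⟨1, 0, Edge.side S 0⟩
  refine ⟨i + k, fun p q hpq h => ?_⟩
  have h1 := hS.edge hi hpq
  have h2 := hmax (q - p) ⟨p, by simpa using hpq⟩
  have h3 := hS.lt hi
  omega

theorem finite (hS : Noncrossing S) : S.Finite := by
  refine Set.Finite.subset ((Set.finite_univ (α := ZMod (n + 2))).prod
    (Set.finite_Icc 2 ((n : ℤ) + 2))) ?_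
  intro α hα
  exact ⟨trivial, hS.len α hα⟩

theorem ncard_compl_singleton (a : ZMod (n + 2)) : ({a}ᶜ : Set (ZMod (n + 2))).ncard = n + 1 := by
  rw [Set.ncard_compl, Set.ncard_singleton, Nat.card_zmod]
  rfl

/-- Send each orbit to its apex modulo n + 2. The uncovered residue is never hit. If two orbits have
the same apex, suitable lifts lie over a common point and are nested, so the minimality of the outer
one over its apex makes them equal. -/
theorem ncard_le (hS : Noncrossing S) : S.ncard ≤ n + 1 := by
  obtain ⟨a, ha⟩ := hS.exists_uncovered
  have key : ∀ α ∈ S, ∃ x i j : ℤ, arc n i j = α ∧ i < x ∧ x < j ∧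
      ∀ p q, Edge S p q → p < x → x < q → i ≤ p → q ≤ j → p = i ∧ q = j := by
    intro α hα
    obtain ⟨i, hi⟩ := exists_arc α
    have h2 := hS.len α hα
    obtain ⟨x, h3, h4, -, h5⟩ := hS.exists_apex (i := i) (j := i + α.2)
      (Or.inr (hi.symm ▸ hα)) (by omega)
    exact ⟨x, i, _, hi, h3, h4, h5⟩
  choose! x hx using key
  rw [← ncard_compl_singleton ((a : ℤ) : ZMod (n + 2))]
  refine Set.ncard_le_ncard_of_injOn (fun α => ((x α : ℤ) : ZMod (n + 2))) ?_ ?_ (Set.toFinite _)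
  · intro α hα h
    obtain ⟨i, j, h1, h2, h3, -⟩ := hx α hα
    simp only [Set.mem_singleton_iff] at h
    rw [intCast_zmod_eq_iff] at h
    have h4 : Edge S i j := Or.inr (h1.symm ▸ hα)
    have := ha _ _ (h4.shift h)
    omega
  · intro α hα β hβ h
    obtain ⟨i, j, rfl, h2, h3, h4⟩ := hx α hα
    obtain ⟨p, q, rfl, h6, h7, h8⟩ := hx β hβ
    simp only at h
    set xα := x (arc n i j)
    set xβ := x (arc n p q)
    rw [intCast_zmod_eq_iff] at h
    obtain ⟨k, hk⟩ : ∃ k, k = xβ - xα := ⟨_, rfl⟩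
    rw [← hk] at h
    have hE : Edge S i j := Or.inr hα
    have hF : Edge S p q := Or.inr hβ
    have hE' := hE.shift h
    have hF' := hF.shift (h.neg_right)
    rw [← arc_shift h i j]
    have h9 := hS.edge hE' hF
    have h10 := hS.edge hF hE'
    have h11 := h8 _ _ hE' (by omega) (by omega)
    have h12 := h4 _ _ hF' (by omega) (by omega)
    have h13 : i + k = p ∧ j + k = q := by omega
    rw [h13.1, h13.2]

end Noncrossing

/-- A maximal set of pairwise non-crossing orbits of diagonals. -/
structure Full (S : Set (Arc n)) : Prop extends Noncrossing S where
  full : ∀ i j : ℤ, i + 2 ≤ j → j ≤ i + ((n : ℤ) + 2) →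
    (∀ p q, arc n p q ∈ S → ¬ (p < i ∧ i < q ∧ q < j) ∧ ¬ (i < p ∧ p < j ∧ j < q)) →
    arc n i j ∈ S

theorem Noncrossing.full_of_ncard {S : Set (Arc n)} (hS : Noncrossing S)
    (h : S.ncard = n + 1) : Full S := by
  refine ⟨hS, fun i j h1 h2 h3 => ?_⟩
  by_contra h4
  have h5 := (hS.insert_arc h1 h2 h3).ncard_le
  rw [Set.ncard_insert_of_notMem h4 hS.finite] at h5
  omega

namespace Full

variable {S : Set (Arc n)}

theorem edge_of_forall (hS : Full S) {i j : ℤ} (h1 : i < j) (h2 : j ≤ i + ((n : ℤ) + 2))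
    (h : ∀ p q, Edge S p q → ¬ (p < i ∧ i < q ∧ q < j) ∧ ¬ (i < p ∧ p < j ∧ j < q)) :
    Edge S i j := by
  by_cases h3 : j = i + 1
  · exact Or.inl h3
  · exact Or.inr (hS.full i j (by omega) h2 fun p q hpq => h p q (Or.inr hpq))

/-- The segment (x, j) can be added, hence is an edge: whatever crosses it passes over j and crosses
(i, j), or passes over x within [i, j], where only (i, j) does. -/
theorem exists_apex (hS : Full S) {i j : ℤ} (h : Edge S i j) (hij : i + 2 ≤ j) :
    ∃ x, i < x ∧ x < j ∧ Edge S i x ∧ Edge S x j := by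
  obtain ⟨x, h1, h2, h3, h4⟩ := hS.toNoncrossing.exists_apex h hij
  have h5 := hS.le h
  refine ⟨x, h1, h2, h3, hS.edge_of_forall h2 (by omega) fun p q hpq => ?_⟩
  have h6 := h4 p q hpq
  have h7 := hS.edge h hpq
  have h8 := hS.edge hpq h
  omega

theorem apex_unique (hS : Noncrossing S) {i j x y : ℤ} (h1 : Edge S i x) (h2 : Edge S x j)
    (h3 : Edge S i y) (h4 : Edge S y j) : x = y := by
  have h5 := hS.edge h1 h4
  have h6 := hS.edge h3 h2
  have h7 := hS.lt h1
  have h8 := hS.lt h2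
  have h9 := hS.lt h3
  have h10 := hS.lt h4
  omega

theorem not_covered (hS : Noncrossing S) {a p q : ℤ} (ha : Edge S a (a + ((n : ℤ) + 2)))
    (h : Edge S p q) : ¬ (p < a ∧ a < q) := by
  have h1 := hS.edge h ha
  have h2 := hS.le h
  omega

/-- A segment that crosses the central one at an uncovered a would cover a or its translate a + (n +
2). -/
theorem exists_central (hS : Full S) : ∃ a, Edge S a (a + ((n : ℤ) + 2)) := by
  obtain ⟨a, ha⟩ := hS.exists_uncovered
  refine ⟨a, hS.edge_of_forall (by omega) le_rfl fun p q hpq => ?_⟩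
  have h1 := ha p q hpq
  have h2 := ha _ _ (hpq.shift (k := -((n : ℤ) + 2)) (dvd_refl _).neg_right)
  omega

theorem exists_central_le (hS : Full S) (i : ℤ) :
    ∃ a, Edge S a (a + ((n : ℤ) + 2)) ∧ a ≤ i ∧ i < a + ((n : ℤ) + 2) := by
  obtain ⟨a, ha⟩ := hS.exists_central
  have h := ha.shift (k := ((n : ℤ) + 2) * ((i - a) / ((n : ℤ) + 2))) (dvd_mul_right _ _)
  have h1 := Int.mul_ediv_self_le (x := i - a) (k := (n : ℤ) + 2) (by omega)
  have h2 := Int.lt_mul_ediv_self_add (x := i - a) (k := (n : ℤ) + 2) (by omega)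
  set k := ((n : ℤ) + 2) * ((i - a) / ((n : ℤ) + 2))
  refine ⟨a + k, ?_, by omega, by omega⟩
  convert h using 1
  ring

/-- In the shortest edge that properly contains (i, j) the apex can only be i or j; a lift of the
central diagonal shows that such an edge exists. -/
theorem exists_outer_apex (hS : Full S) {i j : ℤ} (h : Edge S i j)
    (hij : j < i + ((n : ℤ) + 2)) :
    ∃ x, (j < x ∧ x ≤ i + ((n : ℤ) + 2) ∧ Edge S j x ∧ Edge S i x) ∨
      (x < i ∧ j ≤ x + ((n : ℤ) + 2) ∧ Edge S x i ∧ Edge S x j) := by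
  obtain ⟨a, ha, ha1, ha2⟩ := hS.exists_central_le i
  have hlt := hS.lt h
  have h0 := hS.edge ha h
  obtain ⟨k, ⟨p, hp, hpi, hjp, hne⟩, hmin⟩ := Int.exists_least_of_bdd
    (P := fun k => ∃ p, Edge S p (p + k) ∧ p ≤ i ∧ j ≤ p + k ∧ j - i ≠ k)
    ⟨0, fun z ⟨p, hp, _⟩ => by have := hS.lt hp; omega⟩
    ⟨(n : ℤ) + 2, a, ha, ha1, by omega, by omega⟩
  obtain ⟨x, hpx, hxq, h1, h2⟩ := hS.exists_apex hp (by omega)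
  have hle := hS.le hp
  have e1 := hS.edge h1 h
  have e2 := hS.edge h h2
  have m1 := fun h' h'' h''' => hmin (x - p) ⟨p, by simpa using h1, h', h'', h'''⟩
  have m2 := fun h' h'' h''' => hmin (p + k - x) ⟨x, by simpa using h2, h', h'', h'''⟩
  rcases lt_or_ge i x with hx | hx
  · have hx' : x = j := by omega
    subst hx'
    have : p = i := by omega
    subst this
    exact ⟨p + k, Or.inl ⟨hxq, by omega, h2, hp⟩⟩
  · have hx' : x = i := by omega
    subst hx'
    have : p + k = j := by omega
    exact ⟨p, Or.inr ⟨hpx, by omega, h1, this ▸ hp⟩⟩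

/-- The central diagonal is unique up to the central inversion. -/
theorem central_unique (hS : Noncrossing S) {a b : ℤ} (ha : Edge S a (a + ((n : ℤ) + 2)))
    (hb : Edge S b (b + ((n : ℤ) + 2))) : ((n : ℤ) + 2) ∣ a - b := by
  obtain ⟨k, hk⟩ : ∃ k, k = ((n : ℤ) + 2) * ((a - b) / ((n : ℤ) + 2)) := ⟨_, rfl⟩
  have h1 := Int.mul_ediv_self_le (x := a - b) (k := (n : ℤ) + 2) (by omega)
  have h2 := Int.lt_mul_ediv_self_add (x := a - b) (k := (n : ℤ) + 2) (by omega)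
  rw [← hk] at h1 h2
  have hd : ((n : ℤ) + 2) ∣ k := hk ▸ dvd_mul_right _ _
  have h4 := not_covered hS ha (hb.shift hd)
  have h5 : a - b = k := by omega
  rwa [h5]

/-- Converse count: each residue other than the end of the central diagonal is the apex of the
shortest edge over it, and apexes are unique. -/
theorem ncard (hS : Full S) : S.ncard = n + 1 := by
  refine le_antisymm hS.ncard_le ?_
  obtain ⟨a, ha⟩ := hS.exists_central
  have key : ∀ c ∈ ({(a : ZMod (n + 2))}ᶜ : Set (ZMod (n + 2))), ∃ α ∈ S, ∃ i j x : ℤ,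
      arc n i j = α ∧ (x : ZMod (n + 2)) = c ∧ Edge S i x ∧ Edge S x j := by
    intro c hc
    obtain ⟨x, rfl⟩ := ZMod.intCast_surjective c
    obtain ⟨b, hb, hb1, hb2⟩ := hS.exists_central_le x
    have hbx : b ≠ x := by
      rintro rfl
      exact hc (intCast_zmod_eq_iff.2 (central_unique hS.toNoncrossing ha hb))
    obtain ⟨k, ⟨p, hp, hpi, hjp⟩, hmin⟩ := Int.exists_least_of_bdd
      (P := fun k => ∃ p, Edge S p (p + k) ∧ p < x ∧ x < p + k)
      ⟨0, fun z ⟨p, hp, _⟩ => by have := hS.lt hp; omega⟩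
      ⟨(n : ℤ) + 2, b, hb, by omega, by omega⟩
    obtain ⟨y, hpy, hyq, h1, h2⟩ := hS.exists_apex hp (by omega)
    have m1 := fun h' h''  => hmin (y - p) ⟨p, by simpa using h1, h', h''⟩
    have m2 := fun h' h''  => hmin (p + k - y) ⟨y, by simpa using h2, h', h''⟩
    have : y = x := by omega
    subst this
    exact ⟨_, hp.mem (by omega), p, p + k, y, rfl, rfl, h1, h2⟩
  choose! g hg hg' using key
  rw [← Noncrossing.ncard_compl_singleton (a : ZMod (n + 2))]
  refine Set.ncard_le_ncard_of_injOn g hg ?_ hS.finite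
  intro c hc d hd hcd
  obtain ⟨i, j, x, h1, rfl, h3, h4⟩ := hg' c hc
  obtain ⟨p, q, y, h5, rfl, h7, h8⟩ := hg' d hd
  have h9 := arc_eq_arc_iff.1 (h1.trans (hcd.trans h5.symm))
  have h10 := h3.shift h9.1
  have h11 := h4.shift h9.1
  have h12 : i + (p - i) = p := by omega
  have h13 : j + (p - i) = q := by omega
  rw [h12] at h10
  rw [h13] at h11
  have h14 := apex_unique hS.toNoncrossing h10 h11 h7 h8
  rw [intCast_zmod_eq_iff, ← h14]
  simpa using h9.1

end Full

end Cyclohedron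

/-! ### Quadrilaterals, labelled triangulations and their flips -/

namespace Cyclohedron

variable {n : ℕ}

/-- The four sides of the quadrilateral `w < x < y < z` are edges of `S`. -/
structure Quad (S : Set (Arc n)) (w x y z : ℤ) : Prop where
  wx : w < x
  xy : x < y
  yz : y < z
  le : z ≤ w + ((n : ℤ) + 2)
  ewx : Edge S w x
  exy : Edge S x y
  eyz : Edge S y z
  ewz : Edge S w z

/-- The four sides of the centrally symmetric quadrilateral with vertices `a`, `x` and their
antipodes are edges of `S`. -/
structure CentralQuad (S : Set (Arc n)) (a x : ℤ) : Prop where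
  lt : a < x
  lt' : x < a + ((n : ℤ) + 2)
  e1 : Edge S a x
  e2 : Edge S x (a + ((n : ℤ) + 2))

/-- `α` and `β` are the two diagonals of a quadrilateral with sides in `S`. -/
inductive Exchange (S : Set (Arc n)) : Arc n → Arc n → Prop
  | left {w x y z : ℤ} (h : Quad S w x y z) : Exchange S (arc n w y) (arc n x z)
  | right {w x y z : ℤ} (h : Quad S w x y z) : Exchange S (arc n x z) (arc n w y)
  | central {a x : ℤ} (h : CentralQuad S a x) :
      Exchange S (arc n a (a + ((n : ℤ) + 2))) (arc n x (x + ((n : ℤ) + 2)))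

theorem Quad.mono {S T : Set (Arc n)} {w x y z : ℤ} (h : Quad S w x y z)
    (h1 : Edge T w x) (h2 : Edge T x y) (h3 : Edge T y z) (h4 : Edge T w z) : Quad T w x y z :=
  ⟨h.wx, h.xy, h.yz, h.le, h1, h2, h3, h4⟩

theorem Edge.diff {S : Set (Arc n)} {i j : ℤ} (h : Edge S i j) {α : Arc n} (hα : arc n i j ≠ α) :
    Edge (S \ {α}) i j := by
  rcases h with h | h
  · exact Or.inl h
  · exact Or.inr ⟨h, hα⟩

namespace Exchange

variable {S : Set (Arc n)} {α β : Arc n}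

theorem mono {T : Set (Arc n)} (h : Exchange S α β) (hST : S ⊆ T) : Exchange T α β := by
  cases h with
  | left h => exact .left (h.mono (h.ewx.mono hST) (h.exy.mono hST) (h.eyz.mono hST)
      (h.ewz.mono hST))
  | right h => exact .right (h.mono (h.ewx.mono hST) (h.exy.mono hST) (h.eyz.mono hST)
      (h.ewz.mono hST))
  | central h => exact .central ⟨h.lt, h.lt', h.e1.mono hST, h.e2.mono hST⟩

theorem symm (h : Exchange S α β) : Exchange S β α := by
  cases h with
  | left h => exact .right h
  | right h => exact .left h
  | @central a x h =>
    have h1 := h.lt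
    have h2 := h.lt'
    rw [← arc_shift (dvd_refl _) a]
    exact .central ⟨h2, by omega, h.e2, h.e1.shift (dvd_refl _)⟩

/-- No side is in the orbit of the diagonal, as its length or its start modulo n + 2 differs. Hence
the quadrilateral survives the removal of α. -/
theorem diff (h : Exchange S α β) : Exchange (S \ {α}) α β := by
  cases h with
  | left h =>
    obtain ⟨h1, h2, h3, h4, h5, h6, h7, h8⟩ := h
    exact .left ⟨h1, h2, h3, h4, h5.diff (arc_ne_of_length (by omega)),
      h6.diff (arc_ne_of_length (by omega)), h7.diff (arc_ne_of_start (by omega) (by omega)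
      (by omega)), h8.diff (arc_ne_of_length (by omega))⟩
  | right h =>
    obtain ⟨h1, h2, h3, h4, h5, h6, h7, h8⟩ := h
    exact .right ⟨h1, h2, h3, h4, h5.diff (arc_ne_of_start (by omega) (by omega) (by omega)),
      h6.diff (arc_ne_of_length (by omega)), h7.diff (arc_ne_of_length (by omega)),
      h8.diff (arc_ne_of_length (by omega))⟩
  | central h =>
    obtain ⟨h1, h2, h3, h4⟩ := h
    exact .central ⟨h1, h2, h3.diff (arc_ne_of_length (by omega)),
      h4.diff (arc_ne_of_length (by omega))⟩

theorem ne (h : Exchange S α β) : α ≠ β := by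
  cases h with
  | left h =>
    obtain ⟨h1, h2, h3, h4, h5, h6, h7, h8⟩ := h
    exact arc_ne_of_start (by omega) (by omega) (by omega)
  | right h =>
    obtain ⟨h1, h2, h3, h4, h5, h6, h7, h8⟩ := h
    exact arc_ne_of_start (by omega) (by omega) (by omega)
  | central h =>
    obtain ⟨h1, h2, h3, h4⟩ := h
    exact arc_ne_of_start (by omega) (by omega) (by omega)

theorem central_iff (h : Exchange S α β) : α.2 = (n : ℤ) + 2 ↔ β.2 = (n : ℤ) + 2 := by
  cases h with
  | left h =>
    obtain ⟨h1, h2, h3, h4, h5, h6, h7, h8⟩ := h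
    simp only [arc_snd]
    omega
  | right h =>
    obtain ⟨h1, h2, h3, h4, h5, h6, h7, h8⟩ := h
    simp only [arc_snd]
    omega
  | central h => simp only [arc_snd]; omega

/-- The only segment that crosses one diagonal of a quadrilateral, but not its sides, is the other
diagonal. -/
theorem exists_lift (h : Exchange S α β) (hS : Noncrossing S) :
    ∃ i j, α = arc n i j ∧ i + 2 ≤ j ∧ j ≤ i + ((n : ℤ) + 2) ∧ ∀ p q, arc n p q ∈ S →
      (p < i ∧ i < q ∧ q < j) ∨ (i < p ∧ p < j ∧ j < q) → arc n p q = β := by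
  cases h with
  | @left w x y z h =>
    obtain ⟨h1, h2, h3, h4, h5, h6, h7, h8⟩ := h
    refine ⟨w, y, rfl, by omega, by omega, fun p q hpq hc => ?_⟩
    have hpq : Edge S p q := Or.inr hpq
    have a1 := hS.edge hpq h5
    have a2 := hS.edge hpq h6
    have a3 := hS.edge hpq h7
    have a4 := hS.edge hpq h8
    have b1 := hS.edge h5 hpq
    have b2 := hS.edge h6 hpq
    have b3 := hS.edge h7 hpq
    have b4 := hS.edge h8 hpq
    have : p = x ∧ q = z := by omega
    rw [this.1, this.2]
  | @right w x y z h =>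
    obtain ⟨h1, h2, h3, h4, h5, h6, h7, h8⟩ := h
    refine ⟨x, z, rfl, by omega, by omega, fun p q hpq hc => ?_⟩
    have hpq : Edge S p q := Or.inr hpq
    have a1 := hS.edge hpq h5
    have a2 := hS.edge hpq h6
    have a3 := hS.edge hpq h7
    have a4 := hS.edge hpq h8
    have b1 := hS.edge h5 hpq
    have b2 := hS.edge h6 hpq
    have b3 := hS.edge h7 hpq
    have b4 := hS.edge h8 hpq
    have : p = w ∧ q = y := by omega
    rw [this.1, this.2]
  | @central a x h =>
    obtain ⟨h1, h2, h3, h4⟩ := h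
    refine ⟨a, _, rfl, by omega, by omega, fun p q hpq hc => ?_⟩
    have hpq : Edge S p q := Or.inr hpq
    -- The four sides of a centrally symmetric quadrilateral form two orbits, so translates supply
    -- the remaining sides.
    have h5 := h3.shift (dvd_refl ((n : ℤ) + 2))
    have h6 := h4.shift (dvd_refl ((n : ℤ) + 2)).neg_right
    have h7 := hS.le hpq
    have : (p = x ∧ q = x + ((n : ℤ) + 2)) ∨ (p = x + -((n : ℤ) + 2) ∧
        q = x + ((n : ℤ) + 2) + -((n : ℤ) + 2)) := by
      rcases hc with hc | hc
      · have a1 := hS.edge hpq h3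
        have a2 := hS.edge hpq h4
        have a3 := hS.edge h6 hpq
        omega
      · have a1 := hS.edge h3 hpq
        have a2 := hS.edge h4 hpq
        have a3 := hS.edge hpq h5
        omega
    rcases this with h | h
    · rw [h.1, h.2]
    · rw [h.1, h.2, arc_shift (dvd_refl _).neg_right]

/-- By `exists_lift` for the reversed exchange, only α could cross β, and α has been removed. -/
theorem noncrossing (h : Exchange S α β) (hS : Noncrossing S) :
    Noncrossing (insert β (S \ {α})) := by
  have hS' := hS.mono (Set.sdiff_subset (s := S) (t := {α}))
  obtain ⟨i, j, rfl, h1, h2, h3⟩ := h.diff.symm.exists_lift hS'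
  refine hS'.insert_arc h1 h2 fun p q hpq => ?_
  have := mt (h3 p q hpq) hpq.2
  omega

end Exchange

/-- The inner and the outer triangle form the quadrilateral. For a central diagonal the outer
triangle is the inverted inner one, so the inner apex is enough. -/
theorem Full.exists_exchange {S : Set (Arc n)} (hS : Full S) {α : Arc n} (hα : α ∈ S) :
    ∃ β, Exchange S α β := by
  obtain ⟨i, hi⟩ := exists_arc α
  have hlen := hS.len α hα
  have hE : Edge S i (i + α.2) := Or.inr (hi.symm ▸ hα)
  obtain ⟨x, h1, h2, h3, h4⟩ := hS.exists_apex hE (by omega)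
  rw [← hi]
  rcases hlen.2.lt_or_eq with h5 | h5
  · obtain ⟨y, ⟨h6, h7, h8, h9⟩ | ⟨h6, h7, h8, h9⟩⟩ := hS.exists_outer_apex hE (by omega)
    · exact ⟨_, .left ⟨h1, h2, h6, h7, h3, h4, h8, h9⟩⟩
    · exact ⟨_, .right ⟨h6, h1, h2, h7, h8, h3, h4, h9⟩⟩
  · rw [h5] at h2 h4 ⊢
    exact ⟨_, .central ⟨h1, h2, h3, h4⟩⟩

/-- A labelling of the orbits of diagonals of a centrally symmetric triangulation. -/
structure IsLabelling (f : Option (Fin n) → Arc n) : Prop where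
  noncrossing : Noncrossing (Set.range f)
  injective : Function.Injective f

theorem IsLabelling.full {f : Option (Fin n) → Arc n} (hf : IsLabelling f) :
    Full (Set.range f) := by
  refine hf.noncrossing.full_of_ncard ?_
  rw [← Set.image_univ, Set.ncard_image_of_injective _ hf.injective, Set.ncard_univ]
  simp

/-- The labelled centrally symmetric triangulations. -/
abbrev Labelling (n : ℕ) : Type := {f : Option (Fin n) → Arc n // IsLabelling f}

namespace Labelling

instance : CoeFun (Labelling n) fun _ => Option (Fin n) → Arc n := ⟨Subtype.val⟩

theorem update_isLabelling (f : Labelling n) {l : Option (Fin n)} {β : Arc n}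
    (h : Exchange (Set.range f) (f l) β) : IsLabelling (Function.update f.1 l β) := by
  have hnc := h.noncrossing f.2.noncrossing
  have hβ : ∀ k, k ≠ l → f k ≠ β := by
    intro k hk hkβ
    -- The two diagonals of the quadrilateral cross, so β cannot occur in f under another label.
    have hcross : ∀ p q, arc n p q = β → ¬ ∃ i j, arc n i j = f l ∧
        ((p < i ∧ i < q ∧ q < j) ∨ (i < p ∧ p < j ∧ j < q)) := by
      rintro p q hpq ⟨i, j, hij, h⟩
      have e1 : Edge (Set.range f) p q := Or.inr ⟨k, hkβ.trans hpq.symm⟩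
      have e2 : Edge (Set.range f) i j := Or.inr ⟨l, hij.symm⟩
      have := f.2.noncrossing.edge e1 e2
      have := f.2.noncrossing.edge e2 e1
      omega
    generalize f l = α at *
    cases h with
    | @left w x y z h =>
      obtain ⟨h1, h2, h3, h4, -, -, -, -⟩ := h
      exact hcross x z rfl ⟨w, y, rfl, by omega⟩
    | @right w x y z h =>
      obtain ⟨h1, h2, h3, h4, -, -, -, -⟩ := h
      exact hcross w y rfl ⟨x, z, rfl, by omega⟩
    | @central a x h =>
      obtain ⟨h1, h2, -, -⟩ := h
      exact hcross x _ rfl ⟨a, _, rfl, by omega⟩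
  constructor
  · refine hnc.mono ?_
    rintro _ ⟨k, rfl⟩
    by_cases hk : k = l
    · subst hk
      simp
    · rw [Function.update_of_ne hk]
      exact Or.inr ⟨⟨k, rfl⟩, fun h' => hk (f.2.injective h')⟩
  · intro a b hab
    by_cases ha : a = l <;> by_cases hb : b = l
    · rw [ha, hb]
    · subst ha
      rw [Function.update_self, Function.update_of_ne hb] at hab
      exact (hβ b hb hab.symm).elim
    · subst hb
      rw [Function.update_self, Function.update_of_ne ha] at hab
      exact (hβ a ha hab).elim
    · rw [Function.update_of_ne ha, Function.update_of_ne hb] at hab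
      exact f.2.injective hab

theorem exists_exchange (f : Labelling n) (l : Option (Fin n)) :
    ∃ β, Exchange (Set.range f) (f l) β :=
  f.2.full.exists_exchange ⟨l, rfl⟩

/-- The flip of the orbit with label `l`. -/
noncomputable def flip (l : Option (Fin n)) (f : Labelling n) : Labelling n :=
  ⟨_, f.update_isLabelling (f.exists_exchange l).choose_spec⟩

theorem flip_apply_of_ne (f : Labelling n) {l k : Option (Fin n)} (h : k ≠ l) :
    f.flip l k = f k :=
  Function.update_of_ne h _ _

theorem exchange_flip (f : Labelling n) (l : Option (Fin n)) :
    Exchange (Set.range f) (f l) (f.flip l l) := by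
  have h : f.flip l l = (f.exists_exchange l).choose := Function.update_self _ _ _
  rw [h]
  exact (f.exists_exchange l).choose_spec

theorem flip_ne (f : Labelling n) (l : Option (Fin n)) : f.flip l l ≠ f l :=
  (f.exchange_flip l).ne.symm

/-- Only β can cross f l without crossing the sides. If g l were different from β, then f l would
cross nothing in g and belong to g by maximality, which is impossible under any label. -/
theorem eq_of_exchange (f g : Labelling n) {l : Option (Fin n)} (h : ∀ k, k ≠ l → g k = f k)
    (hl : g l ≠ f l) {β : Arc n} (hβ : Exchange (Set.range f) (f l) β) : g l = β := by
  have hsub : Set.range f \ {f l} ⊆ Set.range g := by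
    rintro _ ⟨⟨k, rfl⟩, hk⟩
    exact ⟨k, h k fun h' => hk (by rw [h']; rfl)⟩
  obtain ⟨i, j, h1, h2, h3, h4⟩ := (hβ.diff.mono hsub).exists_lift g.2.noncrossing
  by_contra hne
  have h5 : arc n i j ∈ Set.range g := by
    refine g.2.full.full i j h2 h3 fun p q hpq => ?_
    obtain ⟨k, hk⟩ := hpq
    by_cases hkl : k = l
    · subst hkl
      have := mt (h4 p q ⟨k, hk⟩) fun h' => hne (hk.trans h')
      omega
    · rw [h k hkl] at hk
      have e1 : Edge (Set.range f) p q := Or.inr ⟨k, hk⟩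
      have e2 : Edge (Set.range f) i j := Or.inr ⟨l, h1⟩
      have := f.2.noncrossing.edge e1 e2
      have := f.2.noncrossing.edge e2 e1
      omega
  obtain ⟨k, hk⟩ := h5
  rw [← h1] at hk
  by_cases hkl : k = l
  · rw [hkl] at hk
    exact hl hk
  · rw [h k hkl] at hk
    exact hkl (f.2.injective hk)

/-- Geometry disappears from the description of flips. Involutivity and compatibility with
relabellings, dihedral motions and maps of orbits become formal. -/
theorem flip_eq_iff (f g : Labelling n) (l : Option (Fin n)) :
    g = f.flip l ↔ (∀ k, k ≠ l → g k = f k) ∧ g l ≠ f l := by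
  constructor
  · rintro rfl
    exact ⟨fun k hk => f.flip_apply_of_ne hk, f.flip_ne l⟩
  · rintro ⟨h1, h2⟩
    apply Subtype.ext
    funext k
    by_cases hk : k = l
    · subst hk
      exact eq_of_exchange f g h1 h2 (f.exchange_flip k)
    · rw [h1 k hk, f.flip_apply_of_ne hk]

theorem flip_flip (f : Labelling n) (l : Option (Fin n)) : (f.flip l).flip l = f := by
  symm
  rw [flip_eq_iff]
  exact ⟨fun k hk => (f.flip_apply_of_ne hk).symm, (f.flip_ne l).symm⟩

theorem flip_apply_self (f : Labelling n) {l : Option (Fin n)} {β : Arc n}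
    (h : Exchange (Set.range f) (f l) β) : f.flip l l = β :=
  eq_of_exchange f _ (fun _ hk => f.flip_apply_of_ne hk) (f.flip_ne l) h

theorem edge_flip_of_ne (f : Labelling n) {l : Option (Fin n)} {i j : ℤ}
    (h : Edge (Set.range f) i j) (hl : arc n i j ≠ f l) : Edge (Set.range (f.flip l)) i j := by
  rcases h with h | ⟨k, hk⟩
  · exact Or.inl h
  · refine Or.inr ⟨k, ?_⟩
    rw [f.flip_apply_of_ne, hk]
    rintro rfl
    exact hl hk.symm

theorem edge_of_apply_eq (f : Labelling n) {l : Option (Fin n)} {i j : ℤ}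
    (h : f l = arc n i j) : Edge (Set.range f) i j :=
  Or.inr ⟨l, h⟩

theorem range_diff_subset_range_flip (f : Labelling n) (l : Option (Fin n)) :
    Set.range f \ {f l} ⊆ Set.range (f.flip l) := by
  rintro _ ⟨⟨k, rfl⟩, hk⟩
  exact ⟨k, f.flip_apply_of_ne fun h' => hk (by rw [h']; rfl)⟩

theorem central_flip_iff (f : Labelling n) (l k : Option (Fin n)) :
    (f.flip l k).2 = (n : ℤ) + 2 ↔ (f k).2 = (n : ℤ) + 2 := by
  by_cases hk : k = l
  · subst hk
    exact (f.exchange_flip k).central_iff.symm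
  · rw [f.flip_apply_of_ne hk]

/-- If d is no side of the quadrilateral around c, this quadrilateral is the same before and after
the flip of d. -/
theorem flip_comm_of_exchange (f : Labelling n) {c d : Option (Fin n)} (hcd : c ≠ d) {β : Arc n}
    (h : Exchange (Set.range f \ {f d}) (f c) β) :
    (f.flip d).flip c = (f.flip c).flip d := by
  have h1 : Exchange (Set.range (f.flip d)) (f.flip d c) β := by
    rw [f.flip_apply_of_ne hcd]
    exact h.mono (f.range_diff_subset_range_flip d)
  have h2 := flip_apply_self _ h1
  have h3 := f.flip_apply_self (h.mono Set.sdiff_subset)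
  rw [flip_eq_iff]
  refine ⟨fun k hk => ?_, ?_⟩
  · by_cases hkc : k = c
    · rw [hkc, h2, h3]
    · rw [flip_apply_of_ne _ hkc, flip_apply_of_ne _ hkc, flip_apply_of_ne _ hk]
  · rw [flip_apply_of_ne _ hcd.symm, flip_apply_of_ne _ hcd.symm]
    exact f.flip_ne d

theorem exists_central (f : Labelling n) : ∃ l, (f l).2 = (n : ℤ) + 2 := by
  obtain ⟨a, ha⟩ := f.2.full.exists_central
  obtain ⟨l, hl⟩ := ha.mem (by omega)
  refine ⟨l, ?_⟩
  rw [hl, arc_snd]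
  ring

theorem central_unique (f : Labelling n) {l k : Option (Fin n)} (hl : (f l).2 = (n : ℤ) + 2)
    (hk : (f k).2 = (n : ℤ) + 2) : l = k := by
  obtain ⟨i, hi⟩ := exists_arc (f l)
  obtain ⟨j, hj⟩ := exists_arc (f k)
  rw [hl] at hi
  rw [hk] at hj
  have := Full.central_unique f.2.noncrossing (f.edge_of_apply_eq hj.symm)
    (f.edge_of_apply_eq hi.symm)
  apply f.2.injective
  rw [← hi, ← hj, arc_eq_arc_iff]
  exact ⟨this, by ring⟩

end Labelling

end Cyclohedron

/-! ### Relations between two flips: pentagons and centrally symmetric hexagons -/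

namespace Cyclohedron

variable {n : ℕ}

namespace Labelling

/-- A side of `K`, or a segment whose label is neither `c` nor `d`. -/
def OtherEdge (f : Labelling n) (c d : Option (Fin n)) (i j : ℤ) : Prop :=
  j = i + 1 ∨ ∃ k, k ≠ c ∧ k ≠ d ∧ f k = arc n i j

namespace OtherEdge

variable {f : Labelling n} {c d : Option (Fin n)} {i j : ℤ}

theorem edge (h : OtherEdge f c d i j) : Edge (Set.range f) i j :=
  h.imp id fun ⟨k, _, _, hk⟩ => ⟨k, hk⟩

theorem swap (h : OtherEdge f c d i j) : OtherEdge f d c i j :=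
  h.imp id fun ⟨k, h1, h2, hk⟩ => ⟨k, h2, h1, hk⟩

theorem flip_left (h : OtherEdge f c d i j) : OtherEdge (f.flip c) c d i j :=
  h.imp id fun ⟨k, h1, h2, hk⟩ => ⟨k, h1, h2, (f.flip_apply_of_ne h1).trans hk⟩

theorem flip_right (h : OtherEdge f c d i j) : OtherEdge (f.flip d) c d i j :=
  h.swap.flip_left.swap

theorem shift (h : OtherEdge f c d i j) {k : ℤ} (hk : ((n : ℤ) + 2) ∣ k) :
    OtherEdge f c d (i + k) (j + k) := by
  rcases h with h | h
  · left
    omega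
  · right
    rwa [arc_shift hk]

theorem of_edge (h : Edge (Set.range f) i j) (hc : arc n i j ≠ f c) (hd : arc n i j ≠ f d) :
    OtherEdge f c d i j := by
  rcases h with h | ⟨k, hk⟩
  · exact Or.inl h
  · refine Or.inr ⟨k, ?_, ?_, hk⟩
    · rintro rfl
      exact hc hk.symm
    · rintro rfl
      exact hd hk.symm

end OtherEdge

/-- Permute the labels. -/
def relabel (π : Equiv.Perm (Option (Fin n))) (f : Labelling n) : Labelling n :=
  ⟨fun l => f (π.symm l), by
    constructor
    · refine f.2.noncrossing.mono ?_
      rintro _ ⟨l, rfl⟩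
      exact ⟨_, rfl⟩
    · exact f.2.injective.comp π.symm.injective⟩

theorem relabel_apply (π : Equiv.Perm (Option (Fin n))) (f : Labelling n) (l : Option (Fin n)) :
    relabel π f l = f (π.symm l) := rfl

theorem flip_relabel (π : Equiv.Perm (Option (Fin n))) (f : Labelling n) (l : Option (Fin n)) :
    (relabel π f).flip (π l) = relabel π (f.flip l) := by
  symm
  rw [flip_eq_iff]
  constructor
  · intro k hk
    rw [relabel_apply, relabel_apply, flip_apply_of_ne]
    rintro rfl
    simp at hk
  · rw [relabel_apply, relabel_apply, Equiv.symm_apply_apply]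
    exact f.flip_ne l

theorem relabel_relabel (π τ : Equiv.Perm (Option (Fin n))) (f : Labelling n) :
    relabel π (relabel τ f) = relabel (π * τ) f := rfl

theorem relabel_one (f : Labelling n) : relabel 1 f = f := rfl

/-- Five alternating flips inside a pentagon exchange the labels of its two diagonals. -/
theorem flip_pentagon (f : Labelling n) {c d : Option (Fin n)} (hcd : c ≠ d) {v w x y z : ℤ}
    (hvw : v < w) (hwx : w < x) (hxy : x < y) (hyz : y < z) (hz : z ≤ v + ((n : ℤ) + 2))
    (e1 : OtherEdge f c d v w) (e2 : OtherEdge f c d w x) (e3 : OtherEdge f c d x y)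
    (e4 : OtherEdge f c d y z) (e5 : OtherEdge f c d v z)
    (hc : f c = arc n v x) (hd : f d = arc n v y) :
    ((((f.flip c).flip d).flip c).flip d).flip c = relabel (Equiv.swap c d) f := by
  -- The pair (c, d) runs through (vx, vy), (wy, vy), (wy, wz), (xz, wz), (xz, vx), (vy, vx).
  obtain ⟨f1, hf1⟩ : ∃ f1, f1 = f.flip c := ⟨_, rfl⟩
  have c1 : f1 c = arc n w y := by
    rw [hf1]
    refine f.flip_apply_self ?_
    rw [hc]
    exact .left ⟨hvw, hwx, hxy, by omega, e1.edge, e2.edge, e3.edge, f.edge_of_apply_eq hd⟩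
  have d1 : f1 d = arc n v y := by rw [hf1, f.flip_apply_of_ne hcd.symm, hd]
  have a1 : OtherEdge f1 c d v w := hf1 ▸ e1.flip_left
  have a2 : OtherEdge f1 c d w x := hf1 ▸ e2.flip_left
  have a3 : OtherEdge f1 c d x y := hf1 ▸ e3.flip_left
  have a4 : OtherEdge f1 c d y z := hf1 ▸ e4.flip_left
  have a5 : OtherEdge f1 c d v z := hf1 ▸ e5.flip_left
  obtain ⟨f2, hf2⟩ : ∃ f2, f2 = f1.flip d := ⟨_, rfl⟩
  have d2 : f2 d = arc n w z := by
    rw [hf2]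
    refine f1.flip_apply_self ?_
    rw [d1]
    exact .left ⟨hvw, by omega, hyz, hz, a1.edge, f1.edge_of_apply_eq c1, a4.edge, a5.edge⟩
  have c2 : f2 c = arc n w y := by rw [hf2, f1.flip_apply_of_ne hcd, c1]
  have b1 : OtherEdge f2 c d v w := hf2 ▸ a1.flip_right
  have b2 : OtherEdge f2 c d w x := hf2 ▸ a2.flip_right
  have b3 : OtherEdge f2 c d x y := hf2 ▸ a3.flip_right
  have b4 : OtherEdge f2 c d y z := hf2 ▸ a4.flip_right
  have b5 : OtherEdge f2 c d v z := hf2 ▸ a5.flip_right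
  obtain ⟨f3, hf3⟩ : ∃ f3, f3 = f2.flip c := ⟨_, rfl⟩
  have c3 : f3 c = arc n x z := by
    rw [hf3]
    refine f2.flip_apply_self ?_
    rw [c2]
    exact .left ⟨hwx, hxy, hyz, by omega, b2.edge, b3.edge, b4.edge, f2.edge_of_apply_eq d2⟩
  have d3 : f3 d = arc n w z := by rw [hf3, f2.flip_apply_of_ne hcd.symm, d2]
  have g1 : OtherEdge f3 c d v w := hf3 ▸ b1.flip_left
  have g2 : OtherEdge f3 c d w x := hf3 ▸ b2.flip_left
  have g3 : OtherEdge f3 c d x y := hf3 ▸ b3.flip_left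
  have g4 : OtherEdge f3 c d y z := hf3 ▸ b4.flip_left
  have g5 : OtherEdge f3 c d v z := hf3 ▸ b5.flip_left
  obtain ⟨f4, hf4⟩ : ∃ f4, f4 = f3.flip d := ⟨_, rfl⟩
  have d4 : f4 d = arc n v x := by
    rw [hf4]
    refine f3.flip_apply_self ?_
    rw [d3]
    exact .right ⟨hvw, hwx, by omega, hz, g1.edge, g2.edge, f3.edge_of_apply_eq c3, g5.edge⟩
  have c4 : f4 c = arc n x z := by rw [hf4, f3.flip_apply_of_ne hcd, c3]
  have c5 : f4.flip c c = arc n v y := by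
    refine f4.flip_apply_self ?_
    rw [c4]
    refine .right ⟨by omega, hxy, hyz, hz, f4.edge_of_apply_eq d4, ?_, ?_, ?_⟩
    · exact (hf4 ▸ g3.flip_right : OtherEdge f4 c d x y).edge
    · exact (hf4 ▸ g4.flip_right : OtherEdge f4 c d y z).edge
    · exact (hf4 ▸ g5.flip_right : OtherEdge f4 c d v z).edge
  rw [← hf1, ← hf2, ← hf3, ← hf4]
  apply Subtype.ext
  funext k
  change f4.flip c k = f ((Equiv.swap c d).symm k)
  rw [Equiv.symm_swap]
  by_cases hkc : k = c
  · rw [hkc, c5, Equiv.swap_apply_left, hd]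
  by_cases hkd : k = d
  · rw [hkd, flip_apply_of_ne _ hcd.symm, d4, Equiv.swap_apply_right, hc]
  · rw [Equiv.swap_apply_of_ne_of_ne hkc hkd, flip_apply_of_ne _ hkc, hf4,
      flip_apply_of_ne _ hkd, hf3, flip_apply_of_ne _ hkc, hf2, flip_apply_of_ne _ hkd, hf1,
      flip_apply_of_ne _ hkc]

/-- The labels `m` of the central diagonal and `c` of an adjacent diagonal in the centrally
symmetric hexagon with vertices `p`, `q`, `r` and their antipodes. -/
structure Hexagon (m c : Option (Fin n)) (p q r : ℤ) (f : Labelling n) : Prop where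
  ne : c ≠ m
  pq : p < q
  qr : q < r
  rp : r < p + ((n : ℤ) + 2)
  e1 : OtherEdge f m c p q
  e2 : OtherEdge f m c q r
  e3 : OtherEdge f m c r (p + ((n : ℤ) + 2))
  hm : f m = arc n p (p + ((n : ℤ) + 2))
  hc : f c = arc n p r

/-- Two flips rotate the hexagon by a third of a turn. Three such steps translate (p, q, r) by 2(n +
2), which is invisible on orbits. -/
theorem Hexagon.step {m c : Option (Fin n)} {p q r : ℤ} {f : Labelling n}
    (h : Hexagon m c p q r f) :
    Hexagon m c r (p + ((n : ℤ) + 2)) (q + ((n : ℤ) + 2)) ((f.flip m).flip c) := by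
  obtain ⟨ne, pq, qr, rp, e1, e2, e3, hm, hc⟩ := h
  have m1 : f.flip m m = arc n r (r + ((n : ℤ) + 2)) := by
    refine f.flip_apply_self ?_
    rw [hm]
    exact .central ⟨by omega, rp, f.edge_of_apply_eq hc, e3.edge⟩
  have c1 : f.flip m c = arc n (p + ((n : ℤ) + 2)) (r + ((n : ℤ) + 2)) := by
    rw [f.flip_apply_of_ne ne, hc, arc_shift (dvd_refl _)]
  refine ⟨ne, rp, by omega, by omega, e3.flip_left.flip_right,
    (e1.shift (dvd_refl _)).flip_left.flip_right, (e2.shift (dvd_refl _)).flip_left.flip_right,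
    ?_, ?_⟩
  · rw [flip_apply_of_ne _ ne.symm, m1]
  · refine flip_apply_self _ ?_
    rw [c1]
    exact .right ⟨by omega, by omega, by omega, le_rfl, e3.flip_left.edge,
      (e1.shift (dvd_refl _)).flip_left.edge, (e2.shift (dvd_refl _)).flip_left.edge,
      edge_of_apply_eq _ m1⟩

theorem Hexagon.iterate {m c : Option (Fin n)} {p q r : ℤ} {f : Labelling n}
    (h : Hexagon m c p q r f) : (fun g : Labelling n => (g.flip m).flip c)^[3] f = f := by
  have h3 := h.step.step.step
  change (((((f.flip m).flip c).flip m).flip c).flip m).flip c = f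
  apply Subtype.ext
  funext k
  by_cases hkm : k = m
  · subst hkm
    rw [h3.hm, h.hm, arc_eq_arc_iff]
    exact ⟨⟨-2, by ring⟩, by ring⟩
  by_cases hkc : k = c
  · subst hkc
    rw [h3.hc, h.hc, arc_eq_arc_iff]
    exact ⟨⟨-2, by ring⟩, by ring⟩
  · simp only [flip_apply_of_ne _ hkm, flip_apply_of_ne _ hkc]

/-- The central flip together with any other flip generates at most a hexagon. -/
theorem iterate_central (f : Labelling n) {m : Option (Fin n)} (hm : (f m).2 = (n : ℤ) + 2)
    (c : Option (Fin n)) : (fun g : Labelling n => (g.flip c).flip m)^[6] f = f := by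
  have inv : Function.LeftInverse (fun g : Labelling n => (g.flip c).flip m)
      (fun g : Labelling n => (g.flip m).flip c) := by
    intro g
    change (((g.flip m).flip c).flip c).flip m = g
    rw [flip_flip, flip_flip]
  -- Commuting flips give a trivial square and a hexagon gives a trivial cube; the exponent 6 covers
  -- both.
  have six : (fun g : Labelling n => (g.flip c).flip m)^[3] f = f →
      (fun g : Labelling n => (g.flip c).flip m)^[6] f = f := by
    intro h
    rw [show 6 = 3 + 3 from rfl, Function.iterate_add_apply, h, h]
  by_cases hcm : c = m
  · subst hcm
    apply six
    change (((((f.flip c).flip c).flip c).flip c).flip c).flip c = f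
    simp only [flip_flip]
  by_cases hcomm : (f.flip c).flip m = (f.flip m).flip c
  · have h2 : (fun g : Labelling n => (g.flip c).flip m)^[2] f = f := by
      change (((f.flip c).flip m).flip c).flip m = f
      rw [hcomm, flip_flip, flip_flip]
    rw [show 6 = 2 + (2 + 2) from rfl, Function.iterate_add_apply, Function.iterate_add_apply,
      h2, h2, h2]
  have hne := fun β h => hcomm (f.flip_comm_of_exchange (Ne.symm hcm) (β := β) h)
  obtain ⟨a, ha⟩ := exists_arc (f m)
  rw [hm] at ha
  obtain ⟨x, h1, h2, h3, h4⟩ := f.2.full.exists_apex (f.edge_of_apply_eq ha.symm) (by omega)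
  have hclen := f.2.noncrossing.len (f c) ⟨c, rfl⟩
  by_cases hx1 : arc n a x = f c
  · have hxa : a + 2 ≤ x := by
      rw [← hx1, arc_snd] at hclen
      omega
    obtain ⟨v, h5, h6, h7, h8⟩ := f.2.full.exists_apex h3 hxa
    have hhex : Hexagon m c a v x f := by
      refine ⟨hcm, h5, h6, h2, .of_edge h7 ?_ ?_, .of_edge h8 ?_ ?_, .of_edge h4 ?_ ?_,
        ha.symm, hx1.symm⟩
      · rw [← ha]
        exact arc_ne_of_length (by omega)
      · rw [← hx1]
        exact arc_ne_of_length (by omega)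
      · rw [← ha]
        exact arc_ne_of_length (by omega)
      · rw [← hx1]
        exact arc_ne_of_length (by omega)
      · rw [← ha]
        exact arc_ne_of_length (by omega)
      · rw [← hx1]
        exact arc_ne_of_start (by omega) (by omega) (by omega)
    apply six
    conv_lhs => rw [← hhex.iterate]
    exact inv.iterate 3 f
  by_cases hx2 : arc n x (a + ((n : ℤ) + 2)) = f c
  · have hxa : x + 2 ≤ a + ((n : ℤ) + 2) := by
      rw [← hx2, arc_snd] at hclen
      omega
    obtain ⟨v, h5, h6, h7, h8⟩ := f.2.full.exists_apex h4 hxa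
    -- Here c borders the other side of the central triangle; after the central flip it is in the
    -- position that `Hexagon` requires.
    have hhex : Hexagon m c x v (a + ((n : ℤ) + 2)) (f.flip m) := by
      refine ⟨hcm, h5, h6, by omega, OtherEdge.flip_left (.of_edge h7 ?_ ?_),
        OtherEdge.flip_left (.of_edge h8 ?_ ?_),
        OtherEdge.flip_left (.of_edge (h3.shift (dvd_refl _)) ?_ ?_),
        f.flip_apply_self (ha ▸ .central ⟨h1, h2, h3, h4⟩), ?_⟩
      · rw [← ha]
        exact arc_ne_of_length (by omega)
      · rw [← hx2]
        exact arc_ne_of_length (by omega)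
      · rw [← ha]
        exact arc_ne_of_length (by omega)
      · rw [← hx2]
        exact arc_ne_of_length (by omega)
      · rw [← ha]
        exact arc_ne_of_length (by omega)
      · rw [← hx2]
        exact arc_ne_of_start (by omega) (by omega) (by omega)
      · rw [f.flip_apply_of_ne hcm, hx2]
    apply six
    have h9 := congrArg (fun g => g.flip m) hhex.iterate
    simpa only [Function.iterate_succ, Function.iterate_zero, Function.comp, id,
      flip_flip] using h9
  · exfalso
    -- If c is not a side of the central quadrilateral, the two flips commute, a case already
    -- settled.
    refine hne (arc n x (x + ((n : ℤ) + 2))) ?_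
    rw [← ha]
    exact .central ⟨h1, h2, h3.diff hx1, h4.diff hx2⟩

/-- Two diagonals of a triangulated pentagon do not commute. -/
theorem flip_not_comm (f : Labelling n) {c d : Option (Fin n)} (hcd : c ≠ d) {w v x y z : ℤ}
    (hwv : w < v) (hvx : v < x) (hxy : x < y) (hyz : y < z) (hz : z ≤ w + ((n : ℤ) + 2))
    (e1 : Edge (Set.range f) w v) (e2 : Edge (Set.range f) v x) (e3 : Edge (Set.range f) x y)
    (e4 : Edge (Set.range f) y z) (e5 : Edge (Set.range f) w z)
    (hc : f c = arc n w y) (hd : f d = arc n w x) :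
    (f.flip d).flip c ≠ (f.flip c).flip d := by
  have hc1 : f.flip c c = arc n x z :=
    f.flip_apply_self (hc ▸ .left ⟨by omega, hxy, hyz, hz, f.edge_of_apply_eq hd, e3, e4, e5⟩)
  have hd1 : f.flip d d = arc n v y :=
    f.flip_apply_self (hd ▸ .left ⟨hwv, hvx, hxy, by omega, e1, e2, e3, f.edge_of_apply_eq hc⟩)
  have hc2 : (f.flip d).flip c c = arc n v z := by
    refine flip_apply_self _ ?_
    rw [f.flip_apply_of_ne hcd, hc]
    refine .left ⟨hwv, by omega, hyz, hz, f.edge_flip_of_ne e1 ?_, edge_of_apply_eq _ hd1,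
      f.edge_flip_of_ne e4 ?_, f.edge_flip_of_ne e5 ?_⟩
    · rw [hd]
      exact arc_ne_of_length (by omega)
    · rw [hd]
      exact arc_ne_of_start (by omega) (by omega) (by omega)
    · rw [hd]
      exact arc_ne_of_length (by omega)
  intro h
  have h1 : (f.flip c).flip d c = arc n v z := by rw [← h, hc2]
  rw [flip_apply_of_ne _ hcd, hc1] at h1
  exact arc_ne_of_start (by omega) (by omega) (by omega) h1

/-- The flip of the central diagonal does not commute with the flip of an adjacent diagonal. -/
theorem flip_central_not_comm (f : Labelling n) {m d : Option (Fin n)} (hmd : m ≠ d)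
    {a v x : ℤ} (hav : a < v) (hvx : v < x) (hx : x < a + ((n : ℤ) + 2))
    (e1 : Edge (Set.range f) a v) (e2 : Edge (Set.range f) v x)
    (e3 : Edge (Set.range f) x (a + ((n : ℤ) + 2)))
    (hm : f m = arc n a (a + ((n : ℤ) + 2))) (hd : f d = arc n a x) :
    (f.flip d).flip m ≠ (f.flip m).flip d := by
  have hm1 : f.flip m m = arc n x (x + ((n : ℤ) + 2)) :=
    f.flip_apply_self (hm ▸ .central ⟨by omega, hx, f.edge_of_apply_eq hd, e3⟩)
  have hd1 : f.flip d d = arc n v (a + ((n : ℤ) + 2)) :=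
    f.flip_apply_self (hd ▸ .left ⟨hav, hvx, hx, le_rfl, e1, e2, e3, f.edge_of_apply_eq hm⟩)
  have hm2 : (f.flip d).flip m m = arc n v (v + ((n : ℤ) + 2)) := by
    refine flip_apply_self _ ?_
    rw [f.flip_apply_of_ne hmd, hm]
    refine .central ⟨hav, by omega, f.edge_flip_of_ne e1 ?_, edge_of_apply_eq _ hd1⟩
    rw [hd]
    exact arc_ne_of_length (by omega)
  intro h
  have h1 : (f.flip m).flip d m = arc n v (v + ((n : ℤ) + 2)) := by rw [← h, hm2]
  rw [flip_apply_of_ne _ hmd, hm1] at h1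
  exact arc_ne_of_start (by omega) (by omega) (by omega) h1

end Labelling

end Cyclohedron

/-! ### Fans and the connectedness of the flip graph -/

namespace Cyclohedron

variable {n : ℕ}

namespace Labelling

/-- The length of the arc with a given label in a fan. -/
def fanLength : Option (Fin n) → ℤ
  | none => (n : ℤ) + 2
  | some i => (i : ℤ) + 2

theorem fanLength_none : fanLength (none : Option (Fin n)) = (n : ℤ) + 2 := rfl

theorem fanLength_some (i : Fin n) : fanLength (some i) = (i : ℤ) + 2 := rfl

theorem fanLength_bounds (l : Option (Fin n)) : 2 ≤ fanLength l ∧ fanLength l ≤ (n : ℤ) + 2 := by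
  cases l with
  | none => rw [fanLength_none]; omega
  | some i => rw [fanLength_some]; have := i.2; omega

theorem fanLength_injective : Function.Injective (fanLength : Option (Fin n) → ℤ) := by
  intro l k h
  cases l with
  | none =>
    cases k with
    | none => rfl
    | some i => rw [fanLength_none, fanLength_some] at h; have := i.2; omega
  | some j =>
    cases k with
    | none => rw [fanLength_none, fanLength_some] at h; have := j.2; omega
    | some i =>
      rw [fanLength_some, fanLength_some] at h
      congr 1
      ext
      omega

theorem exists_fanLength_eq {k : ℤ} (h1 : 2 ≤ k) (h2 : k ≤ (n : ℤ) + 2) :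
    ∃ l : Option (Fin n), fanLength l = k := by
  rcases h2.lt_or_eq with h | h
  · exact ⟨some ⟨(k - 2).toNat, by omega⟩, by rw [fanLength_some]; simp only; omega⟩
  · exact ⟨none, h.symm⟩

/-- The fan of all segments from `a` to `a + 2, …, a + (n + 2)`, labelled in this order. -/
def fan (n : ℕ) (a : ℤ) : Labelling n :=
  ⟨fun l => arc n a (a + fanLength l), by
    constructor
    · constructor
      · rintro _ ⟨l, rfl⟩
        rw [arc_snd]
        have := fanLength_bounds l
        omega
      · rintro i j p q ⟨l, hl⟩ ⟨k, hk⟩ h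
        have h1 := arc_eq_arc_iff.1 hl
        have h2 := arc_eq_arc_iff.1 hk
        have h3 := dvd_sub h2.1 h1.1
        have := fanLength_bounds l
        have := eq_zero_of_dvd_of_lt h3 (by omega) (by omega)
        omega
    · intro l k h
      have := (arc_eq_arc_iff.1 h).2
      exact fanLength_injective (by omega)⟩

theorem fan_apply (a : ℤ) (l : Option (Fin n)) : fan n a l = arc n a (a + fanLength l) := rfl

theorem edge_fan (a : ℤ) {x : ℤ} (h1 : a < x) (h2 : x ≤ a + ((n : ℤ) + 2)) :
    Edge (Set.range (fan n a)) a x := by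
  by_cases h : x = a + 1
  · exact Or.inl h
  · obtain ⟨l, hl⟩ := exists_fanLength_eq (n := n) (k := x - a) (by omega) (by omega)
    refine Or.inr ⟨l, ?_⟩
    rw [fan_apply, hl]
    congr 1
    omega

/-- The n + 1 arcs have distinct lengths in {2, …, n + 2}, so each length occurs exactly once. -/
theorem exists_relabel_fan (f : Labelling n) {a : ℤ} (h : ∀ l, (f l).1 = (a : ZMod (n + 2))) :
    ∃ π, f = relabel π (fan n a) ∧ ((f none).2 = (n : ℤ) + 2 → π none = none) := by
  have hf : ∀ l, f l = arc n a (a + (f l).2) := fun l =>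
    Prod.ext (h l) (by rw [arc_snd]; ring)
  have key : ∀ l, ∃ k, fanLength k = (f l).2 := fun l =>
    exists_fanLength_eq (f.2.noncrossing.len _ ⟨l, rfl⟩).1 (f.2.noncrossing.len _ ⟨l, rfl⟩).2
  choose e he using key
  have hinj : Function.Injective e := by
    intro l k hlk
    apply f.2.injective
    rw [hf l, hf k, ← he, ← he, hlk]
  let E := Equiv.ofBijective e (Finite.injective_iff_bijective.1 hinj)
  refine ⟨E.symm, ?_, ?_⟩
  · apply Subtype.ext
    funext l
    rw [hf]
    change arc n a _ = arc n a (a + fanLength (e l))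
    rw [he]
  · intro h0
    rw [Equiv.symm_apply_eq]
    apply fanLength_injective
    change _ = fanLength (e none)
    rw [he, h0]
    rfl

/-- Two labelled triangulations are joined by flips. -/
def Conn (f g : Labelling n) : Prop :=
  Relation.EqvGen (fun f g : Labelling n => ∃ c, g = f.flip c) f g

theorem Conn.flip (f : Labelling n) (c : Option (Fin n)) : Conn f (f.flip c) :=
  .rel _ _ ⟨c, rfl⟩

theorem Conn.refl (f : Labelling n) : Conn f f := Relation.EqvGen.refl _

theorem Conn.symm {f g : Labelling n} (h : Conn f g) : Conn g f := Relation.EqvGen.symm _ _ h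

theorem Conn.trans {f g k : Labelling n} (h : Conn f g) (h' : Conn g k) : Conn f k :=
  Relation.EqvGen.trans _ _ _ h h'

theorem Conn.iff_of_flip {P : Labelling n → Prop} (hP : ∀ f c, P f ↔ P (f.flip c))
    {f g : Labelling n} (h : Conn f g) : P f ↔ P g := by
  induction h with
  | rel a b h =>
    obtain ⟨c, rfl⟩ := h
    exact hP a c
  | refl => rfl
  | symm _ _ _ ih => exact ih.symm
  | trans _ _ _ _ _ ih1 ih2 => exact ih1.trans ih2

theorem Conn.relabel {f g : Labelling n} (h : Conn f g) (π : Equiv.Perm (Option (Fin n))) :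
    Conn (relabel π f) (relabel π g) := by
  induction h with
  | rel a b h =>
    obtain ⟨c, rfl⟩ := h
    rw [← flip_relabel]
    exact Conn.flip _ _
  | refl => exact Conn.refl _
  | symm _ _ _ ih => exact ih.symm
  | trans _ _ _ _ _ ih1 ih2 => exact ih1.trans ih2

theorem central_of_conn {f g : Labelling n} (h : Conn f g) (l : Option (Fin n)) :
    (f l).2 = (n : ℤ) + 2 ↔ (g l).2 = (n : ℤ) + 2 :=
  Conn.iff_of_flip (P := fun f : Labelling n => (f l).2 = (n : ℤ) + 2)
    (fun f c => (f.central_flip_iff c l).symm) h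

/-- Translate an arc that does not start at a to (p, q) inside [a, a + n + 2], and take the nearest
edges (a, x) and (a, y) with x ≤ p and q ≤ y. Then a, x, y is a triangle, and the flip of its side
(x, y) produces an arc that starts at a. -/
theorem exists_flip_start (f : Labelling n) {a : ℤ} (hm : f none = arc n a (a + ((n : ℤ) + 2)))
    {l : Option (Fin n)} (hl : (f l).1 ≠ (a : ZMod (n + 2))) :
    ∃ c, c ≠ none ∧ (f c).1 ≠ (a : ZMod (n + 2)) ∧ (f.flip c c).1 = (a : ZMod (n + 2)) := by
  obtain ⟨p0, hp0⟩ := exists_arc (f l)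
  obtain ⟨k, hk⟩ : ∃ k, k = ((n : ℤ) + 2) * (-((p0 - a) / ((n : ℤ) + 2))) := ⟨_, rfl⟩
  have h1 := Int.mul_ediv_self_le (x := p0 - a) (k := (n : ℤ) + 2) (by omega)
  have h2 := Int.lt_mul_ediv_self_add (x := p0 - a) (k := (n : ℤ) + 2) (by omega)
  rw [mul_neg] at hk
  have hd : ((n : ℤ) + 2) ∣ k := hk ▸ (dvd_mul_right _ _).neg_right
  have hpq := (f.edge_of_apply_eq hp0.symm).shift hd
  obtain ⟨p, hp⟩ : ∃ p, p = p0 + k := ⟨_, rfl⟩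
  obtain ⟨q, hq⟩ : ∃ q, q = p0 + (f l).2 + k := ⟨_, rfl⟩
  rw [← hp, ← hq] at hpq
  have hlen := f.2.noncrossing.len (f l) ⟨l, rfl⟩
  have hpa : p ≠ a := by
    rintro rfl
    apply hl
    rw [← hp0, arc_fst, intCast_zmod_eq_iff, hp]
    simpa using hd
  have hE := f.edge_of_apply_eq hm
  have hnc := f.2.noncrossing
  have hqa : q ≤ a + ((n : ℤ) + 2) := by
    have := hnc.edge hE hpq
    omega
  obtain ⟨x, ⟨hx, hxp⟩, hxmax⟩ := Int.exists_greatest_of_bdd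
    (P := fun x => Edge (Set.range f) a x ∧ x ≤ p) ⟨p, fun z hz => hz.2⟩
    ⟨a + 1, Edge.side _ a, by omega⟩
  obtain ⟨y, ⟨hy, hyq⟩, hymin⟩ := Int.exists_least_of_bdd
    (P := fun y => Edge (Set.range f) a y ∧ q ≤ y) ⟨q, fun z hz => hz.2⟩ ⟨_, hE, hqa⟩
  obtain ⟨z, haz, hzy, hz1, hz2⟩ := f.2.full.exists_apex hy (by omega)
  have hax := hnc.lt hx
  have hyle := hnc.le hy
  have hzx : z = x := by
    have t1 := hnc.edge hz1 hpq
    have t2 := fun h => hymin z ⟨hz1, h⟩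
    have t3 := fun h => hxmax z ⟨hz1, h⟩
    have t4 := hnc.edge hx hz2
    omega
  subst hzx
  obtain ⟨c, hc⟩ := hz2.mem (by omega)
  obtain ⟨v, hxv, hvy, hv1, hv2⟩ := f.2.full.exists_apex hz2 (by omega)
  refine ⟨c, ?_, ?_, ?_⟩
  · rintro rfl
    exact arc_ne_of_length (by omega) (hm.symm.trans hc)
  · rw [hc, arc_fst, Ne, intCast_zmod_eq_iff]
    intro h
    have := eq_zero_of_dvd_of_lt h (by omega) (by omega)
    omega
  · have : f.flip c c = arc n a v := by
      refine f.flip_apply_self ?_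
      rw [hc]
      exact .right ⟨hax, hxv, hvy, hyle, hx, hv1, hv2, hy⟩
    rw [this, arc_fst]

theorem conn_relabel_fan_of_central (f : Labelling n) {a : ℤ}
    (hm : f none = arc n a (a + ((n : ℤ) + 2))) :
    ∃ π : Equiv.Perm (Option (Fin n)), π none = none ∧ Conn f (relabel π (fan n a)) := by
  obtain ⟨k, hk⟩ : ∃ k, k = {l | (f l).1 ≠ (a : ZMod (n + 2))}.ncard := ⟨_, rfl⟩
  induction k using Nat.strong_induction_on generalizing f with
  | _ k ih =>
    by_cases h : ∃ l, (f l).1 ≠ (a : ZMod (n + 2))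
    · obtain ⟨l, hl⟩ := h
      obtain ⟨c, hc, hc1, hc2⟩ := f.exists_flip_start hm hl
      have hlt : {l | (f.flip c l).1 ≠ (a : ZMod (n + 2))}.ncard < k := by
        rw [hk]
        refine Set.ncard_lt_ncard ⟨?_, ?_⟩ (Set.toFinite _)
        · intro b hb
          have hbc : b ≠ c := by
            rintro rfl
            exact hb hc2
          rwa [Set.mem_ofPred_eq, f.flip_apply_of_ne hbc] at hb
        · intro hsub
          exact hsub hc1 hc2
      obtain ⟨π, hπ, hconn⟩ := ih _ hlt (f.flip c)
        (by rw [f.flip_apply_of_ne hc.symm, hm]) rfl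
      exact ⟨π, hπ, (Conn.flip f c).trans hconn⟩
    · push Not at h
      obtain ⟨π, hπ, hπ0⟩ := f.exists_relabel_fan h
      refine ⟨π, hπ0 ?_, hπ ▸ Conn.refl _⟩
      rw [hm, arc_snd]
      ring

theorem fan_shift {k : ℤ} (hk : ((n : ℤ) + 2) ∣ k) (a : ℤ) : fan n (a + k) = fan n a := by
  apply Subtype.ext
  funext l
  rw [fan_apply, fan_apply, ← arc_shift hk a]
  congr 1
  ring

/-- The central flip of the fan at a gives the central diagonal at a + n + 1, which is a − 1 modulo
n + 2; a fan can then be built there. -/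
theorem conn_fan_pred (a : ℤ) :
    ∃ π : Equiv.Perm (Option (Fin n)), π none = none ∧
      Conn (fan n a) (relabel π (fan n (a - 1))) := by
  have h : (fan n a).flip none none = arc n (a - 1) (a - 1 + ((n : ℤ) + 2)) := by
    rw [← arc_shift (dvd_refl _)]
    have h1 : (fan n a).flip none none = arc n (a + ((n : ℤ) + 1))
        (a + ((n : ℤ) + 1) + ((n : ℤ) + 2)) := by
      refine flip_apply_self _ (.central ⟨by omega, by omega,
        edge_fan a (by omega) (by omega), ?_⟩)
      left
      ring
    rw [h1]
    congr 1 <;> ring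
  obtain ⟨π, hπ, hconn⟩ := conn_relabel_fan_of_central _ h
  exact ⟨π, hπ, (Conn.flip _ _).trans hconn⟩

theorem conn_relabel_fan_zero (f : Labelling n) (hm : (f none).2 = (n : ℤ) + 2) :
    ∃ π : Equiv.Perm (Option (Fin n)), π none = none ∧ Conn f (relabel π (fan n 0)) := by
  have key : ∀ k : ℕ, ∃ π : Equiv.Perm (Option (Fin n)), π none = none ∧
      Conn (fan n k) (relabel π (fan n 0)) := by
    intro k
    induction k with
    | zero => exact ⟨1, rfl, Conn.refl _⟩
    | succ k ih =>
      obtain ⟨π, hπ, h⟩ := ih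
      obtain ⟨τ, hτ, h'⟩ := conn_fan_pred (n := n) ((k + 1 : ℕ) : ℤ)
      refine ⟨τ * π, by simp [hπ, hτ], h'.trans ?_⟩
      rw [← relabel_relabel]
      have : (((k + 1 : ℕ) : ℤ) - 1) = k := by push_cast; ring
      rw [this]
      exact h.relabel τ
  obtain ⟨a, ha⟩ := exists_arc (f none)
  rw [hm] at ha
  obtain ⟨π, hπ, h⟩ := f.conn_relabel_fan_of_central ha.symm
  have hmod : fan n (a.emod ((n : ℤ) + 2)) = fan n a := by
    have h1 := Int.emod_add_mul_ediv a ((n : ℤ) + 2)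
    rw [← fan_shift (dvd_mul_right ((n : ℤ) + 2) (a / ((n : ℤ) + 2))) (a.emod ((n : ℤ) + 2))]
    exact congrArg _ h1
  obtain ⟨k, hk⟩ := Int.eq_ofNat_of_zero_le (Int.emod_nonneg a (b := (n : ℤ) + 2) (by omega))
  obtain ⟨τ, hτ, h'⟩ := key k
  refine ⟨π * τ, by simp [hπ, hτ], h.trans ?_⟩
  rw [← relabel_relabel, ← hmod]
  change Conn (relabel π (fan n (a % ((n : ℤ) + 2)))) _
  rw [hk]
  exact h'.relabel π

/-- The permutation of labels induced by a permutation of colors. -/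
def labelPerm : Equiv.Perm (Fin n) →* Equiv.Perm (Option (Fin n)) :=
  MonoidHom.mk' (fun τ => Equiv.optionCongr τ) (by
    intro a b
    ext1 l
    cases l <;> rfl)

theorem labelPerm_none (τ : Equiv.Perm (Fin n)) : labelPerm τ none = none := rfl

theorem labelPerm_some (τ : Equiv.Perm (Fin n)) (i : Fin n) :
    labelPerm τ (some i) = some (τ i) := rfl

theorem exists_labelPerm {π : Equiv.Perm (Option (Fin n))} (h : π none = none) :
    ∃ τ, labelPerm τ = π := by
  refine ⟨Equiv.removeNone π, ?_⟩
  ext1 l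
  cases l with
  | none => rw [labelPerm_none, h]
  | some i =>
    rw [labelPerm_some]
    refine Equiv.removeNone_some π ?_
    rw [← Option.ne_none_iff_exists']
    intro h'
    exact absurd (π.injective (h'.trans h.symm)) (by simp)

/-- The arcs of lengths i + 2 and i + 3 are the diagonals of the pentagon 0, i + 1, i + 2, i + 3, i
+ 4. Thus flips realize the transposition of two consecutive colors. -/
theorem swap_fan_pentagon {i j : Fin n} (hij : (j : ℕ) = i + 1) :
    (((((fan n 0).flip (some i)).flip (some j)).flip (some i)).flip (some j)).flip (some i) =
      relabel (Equiv.swap (some i) (some j)) (fan n 0) := by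
  have hj := j.2
  have hc : fan n 0 (some i) = arc n 0 ((i : ℤ) + 2) := by
    rw [fan_apply, fanLength_some, zero_add]
  have hd : fan n 0 (some j) = arc n 0 ((i : ℤ) + 3) := by
    rw [fan_apply, fanLength_some, zero_add]
    congr 1
    omega
  have hne : (some i : Option (Fin n)) ≠ some j := by
    intro h
    have := congrArg Fin.val (Option.some_injective _ h)
    omega
  refine flip_pentagon _ hne (w := (i : ℤ) + 1) (z := (i : ℤ) + 4) (by omega) (by omega)
    (by omega) (by omega) (by omega) (.of_edge (edge_fan 0 (by omega) (by omega)) ?_ ?_)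
    (Or.inl (by ring)) (Or.inl (by ring)) (Or.inl (by ring))
    (.of_edge (edge_fan 0 (by omega) (by omega)) ?_ ?_) hc hd
  · rw [hc]
    exact arc_ne_of_length (by omega)
  · rw [hd]
    exact arc_ne_of_length (by omega)
  · rw [hc]
    exact arc_ne_of_length (by omega)
  · rw [hd]
    exact arc_ne_of_length (by omega)

theorem labelPerm_swap (i j : Fin n) :
    labelPerm (Equiv.swap i j) = Equiv.swap (some i) (some j) := by
  ext1 l
  cases l with
  | none => rw [labelPerm_none, Equiv.swap_apply_of_ne_of_ne (by simp) (by simp)]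
  | some k =>
    rw [labelPerm_some, Equiv.swap_apply_def, Equiv.swap_apply_def]
    simp only [Option.some_inj]
    split_ifs <;> rfl

theorem conn_labelPerm_fan (τ : Equiv.Perm (Fin n)) :
    Conn (relabel (labelPerm τ) (fan n 0)) (fan n 0) := by
  -- The adjacent transpositions are indexed by `castSucc` and `succ`, which needs at least one
  -- color.
  rcases n with - | n
  · rw [Subsingleton.elim τ 1, map_one]
    exact Conn.refl _
  have hτ : τ ∈ Submonoid.closure (Set.range fun i : Fin n => Equiv.swap i.castSucc i.succ) := by
    rw [Equiv.Perm.mclosure_swap_castSucc_succ]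
    trivial
  induction hτ using Submonoid.closure_induction with
  | mem x hx =>
    obtain ⟨i, rfl⟩ := hx
    rw [labelPerm_swap, ← swap_fan_pentagon (by simp)]
    refine Conn.symm ?_
    exact (((((Conn.flip _ _).trans (Conn.flip _ _)).trans (Conn.flip _ _)).trans
      (Conn.flip _ _)).trans (Conn.flip _ _))
  | one =>
    rw [map_one]
    exact Conn.refl _
  | mul x y _ _ hx hy =>
    rw [map_mul, ← relabel_relabel]
    exact (hy.relabel _).trans hx

/-- Any two triangulations whose central diagonal carries the label `none` are joined by flips. -/
theorem conn_fan (f : Labelling n) (hf : (f none).2 = (n : ℤ) + 2) : Conn f (fan n 0) := by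
  obtain ⟨π, hπ, h⟩ := f.conn_relabel_fan_zero hf
  obtain ⟨τ, rfl⟩ := exists_labelPerm hπ
  exact h.trans (conn_labelPerm_fan τ)

end Labelling

end Cyclohedron

/-! ### The dihedral action, and fans recognized by commuting flips -/

namespace Cyclohedron

variable {n : ℕ}

/-- The action of the dihedral group on the orbits of segments. -/
def arcAction (n : ℕ) : DihedralGroup (n + 2) →* Equiv.Perm (Arc n) where
  toFun
    | .r c => ⟨fun α => (α.1 + c, α.2), fun α => (α.1 - c, α.2),
        fun α => by simp, fun α => by simp⟩
    -- The reflection x ↦ −x − c reverses intervals, so the new start is the image of the old end.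
    | .sr c => ⟨fun α => (-α.1 - (α.2 : ZMod (n + 2)) - c, α.2),
        fun α => (-α.1 - (α.2 : ZMod (n + 2)) - c, α.2),
        fun α => by ext <;> simp; ring, fun α => by ext <;> simp; ring⟩
  map_one' := by
    rw [DihedralGroup.one_def]
    ext1 α
    simp
  map_mul' := by
    rintro (a | a) (b | b)
    · rw [DihedralGroup.r_mul_r]
      ext1 α
      simp only [Equiv.coe_fn_mk, Equiv.Perm.mul_apply, Prod.mk.injEq, and_true]
      ring
    · rw [DihedralGroup.r_mul_sr]
      ext1 α
      simp only [Equiv.coe_fn_mk, Equiv.Perm.mul_apply, Prod.mk.injEq, and_true]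
      ring
    · rw [DihedralGroup.sr_mul_r]
      ext1 α
      simp only [Equiv.coe_fn_mk, Equiv.Perm.mul_apply, Prod.mk.injEq, and_true]
      ring
    · rw [DihedralGroup.sr_mul_sr]
      ext1 α
      simp only [Equiv.coe_fn_mk, Equiv.Perm.mul_apply, Prod.mk.injEq, and_true]
      ring

theorem arcAction_snd (g : DihedralGroup (n + 2)) (α : Arc n) : (arcAction n g α).2 = α.2 := by
  cases g <;> rfl

theorem arcAction_r (k i j : ℤ) :
    arcAction n (.r (k : ZMod (n + 2))) (arc n i j) = arc n (i + k) (j + k) := by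
  change ((i : ZMod (n + 2)) + k, j - i) = (((i + k : ℤ) : ZMod (n + 2)), j + k - (i + k))
  ext
  · push_cast
    ring
  · ring

theorem arcAction_sr (k i j : ℤ) :
    arcAction n (.sr (k : ZMod (n + 2))) (arc n i j) = arc n (-j - k) (-i - k) := by
  change (-(i : ZMod (n + 2)) - ((j - i : ℤ) : ZMod (n + 2)) - k, j - i) =
    (((-j - k : ℤ) : ZMod (n + 2)), -i - k - (-j - k))
  ext
  · push_cast
    ring
  · ring

theorem Noncrossing.arcAction {S : Set (Arc n)} (hS : Noncrossing S) (g : DihedralGroup (n + 2)) :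
    Noncrossing (arcAction n g '' S) := by
  constructor
  · rintro _ ⟨α, hα, rfl⟩
    rw [arcAction_snd]
    exact hS.len α hα
  · have key : ∀ i j, arc n i j ∈ Cyclohedron.arcAction n g '' S →
        Cyclohedron.arcAction n g⁻¹ (arc n i j) ∈ S := by
      rintro i j ⟨α, hα, h⟩
      rw [← h, ← Equiv.Perm.mul_apply, ← map_mul, inv_mul_cancel, map_one]
      exact hα
    intro i j p q h1 h2 h
    have h1 := key _ _ h1
    have h2 := key _ _ h2
    generalize g⁻¹ = g at h1 h2
    rcases g with c | c
    · obtain ⟨k, rfl⟩ := ZMod.intCast_surjective c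
      rw [arcAction_r] at h1 h2
      exact hS.nc _ _ _ _ h1 h2 (by omega)
    · obtain ⟨k, rfl⟩ := ZMod.intCast_surjective c
      rw [arcAction_sr] at h1 h2
      -- A reflection reverses the order of ℤ, so the two arcs exchange their roles.
      exact hS.nc _ _ _ _ h2 h1 (by omega)

namespace Labelling

/-- The action of the dihedral group on labelled triangulations. -/
def move (g : DihedralGroup (n + 2)) (f : Labelling n) : Labelling n :=
  ⟨fun l => arcAction n g (f l), by
    constructor
    · refine (f.2.noncrossing.arcAction g).mono ?_
      rintro _ ⟨l, rfl⟩
      exact ⟨_, ⟨l, rfl⟩, rfl⟩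
    · exact (arcAction n g).injective.comp f.2.injective⟩

theorem move_apply (g : DihedralGroup (n + 2)) (f : Labelling n) (l : Option (Fin n)) :
    move g f l = arcAction n g (f l) := rfl

theorem flip_move (g : DihedralGroup (n + 2)) (f : Labelling n) (l : Option (Fin n)) :
    (move g f).flip l = move g (f.flip l) := by
  symm
  rw [flip_eq_iff]
  constructor
  · intro k hk
    rw [move_apply, move_apply, flip_apply_of_ne _ hk]
  · rw [move_apply, move_apply]
    exact fun h => f.flip_ne l ((arcAction n g).injective h)

theorem move_mul (g k : DihedralGroup (n + 2)) (f : Labelling n) :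
    move (g * k) f = move g (move k f) := by
  apply Subtype.ext
  funext l
  change arcAction n (g * k) (f l) = _
  rw [map_mul]
  rfl

theorem move_one (f : Labelling n) : move 1 f = f := by
  apply Subtype.ext
  funext l
  change arcAction n 1 (f l) = _
  rw [map_one]
  rfl

theorem fan_eq_move (a : ℤ) : fan n a = move (.r (a : ZMod (n + 2))) (fan n 0) := by
  apply Subtype.ext
  funext l
  change _ = arcAction n _ (arc n 0 (0 + fanLength l))
  rw [arcAction_r]
  change arc n a (a + fanLength l) = _
  congr 1 <;> ring

/-- The label of the arc of length `k` in a fan. -/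
def fanLabel (n : ℕ) (k : ℤ) : Option (Fin n) :=
  if h : 2 ≤ k ∧ k < (n : ℤ) + 2 then some ⟨(k - 2).toNat, by omega⟩ else none

theorem fanLength_fanLabel {k : ℤ} (h1 : 2 ≤ k) (h2 : k ≤ (n : ℤ) + 2) :
    fanLength (fanLabel n k) = k := by
  unfold fanLabel
  split_ifs with h
  · rw [fanLength_some]
    simp only
    omega
  · rw [fanLength_none]
    omega

theorem fanLabel_top : fanLabel n ((n : ℤ) + 2) = none := dif_neg (by omega)

theorem fanLabel_fanLength (l : Option (Fin n)) : fanLabel n (fanLength l) = l :=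
  fanLength_injective (fanLength_fanLabel (fanLength_bounds l).1 (fanLength_bounds l).2)

theorem fanLabel_ne {k m : ℤ} (h1 : 2 ≤ k) (h2 : k ≤ (n : ℤ) + 2) (h3 : 2 ≤ m)
    (h4 : m ≤ (n : ℤ) + 2) (h : k ≠ m) : fanLabel n k ≠ fanLabel n m := by
  intro h'
  have := congrArg fanLength h'
  rw [fanLength_fanLabel h1 h2, fanLength_fanLabel h3 h4] at this
  exact h this

theorem fan_zero_fanLabel {k : ℤ} (h1 : 2 ≤ k) (h2 : k ≤ (n : ℤ) + 2) :
    fan n 0 (fanLabel n k) = arc n 0 k := by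
  rw [fan_apply, fanLength_fanLabel h1 h2, zero_add]

/-- The flips with labels `c` and `d` commute at `f`. -/
def FlipsCommute (f : Labelling n) (c d : Option (Fin n)) : Prop :=
  (f.flip d).flip c = (f.flip c).flip d

/-- A local characterization of fans by means of commuting flips. -/
structure IsFanLike (f : Labelling n) : Prop where
  adj : ∀ k : ℤ, 3 ≤ k → k ≤ (n : ℤ) + 2 → ¬ FlipsCommute f (fanLabel n k) (fanLabel n (k - 1))
  flip_adj : ∀ k : ℤ, 3 ≤ k → k < (n : ℤ) + 2 →
    ¬ FlipsCommute (f.flip (fanLabel n k)) (fanLabel n (k + 1)) (fanLabel n (k - 1))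

/-- Arcs of consecutive lengths lie in a common triangle. After the flip at length k, the arcs of
lengths k − 1 and k + 1 are two sides of the triangle 0, k − 1, k + 1. When the longer arc is
central, the central non-commutation applies. -/
theorem fan_isFanLike : IsFanLike (fan n 0) := by
  constructor
  · intro k h1 h2
    have hd : fan n 0 (fanLabel n (k - 1)) = arc n 0 (k - 1) :=
      fan_zero_fanLabel (by omega) (by omega)
    have hne : fanLabel n k ≠ fanLabel n (k - 1) :=
      fanLabel_ne (by omega) (by omega) (by omega) (by omega) (by omega)
    have hc : fan n 0 (fanLabel n k) = arc n 0 k := fan_zero_fanLabel (by omega) (by omega)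
    rcases h2.lt_or_eq with h2 | h2
    · exact flip_not_comm _ hne (w := 0) (v := k - 2) (x := k - 1) (y := k) (z := k + 1)
        (by omega) (by omega) (by omega) (by omega) (by omega)
        (edge_fan 0 (by omega) (by omega)) (Or.inl (by ring)) (Or.inl (by ring)) (Or.inl rfl)
        (edge_fan 0 (by omega) (by omega)) hc hd
    · refine flip_central_not_comm _ hne (a := 0) (v := k - 2) (x := k - 1) (by omega) (by omega)
        (by omega) (edge_fan 0 (by omega) (by omega)) (Or.inl (by ring)) (Or.inl ?_) ?_ hd
      · rw [← h2]
        ring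
      · rw [hc, zero_add, ← h2]
  · intro k h1 h2
    have hk : fan n 0 (fanLabel n k) = arc n 0 k := fan_zero_fanLabel (by omega) (by omega)
    have hd : fan n 0 (fanLabel n (k - 1)) = arc n 0 (k - 1) :=
      fan_zero_fanLabel (by omega) (by omega)
    have hc : fan n 0 (fanLabel n (k + 1)) = arc n 0 (k + 1) :=
      fan_zero_fanLabel (by omega) (by omega)
    have n1 : fanLabel n (k + 1) ≠ fanLabel n (k - 1) :=
      fanLabel_ne (by omega) (by omega) (by omega) (by omega) (by omega)
    have n2 : fanLabel n (k + 1) ≠ fanLabel n k :=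
      fanLabel_ne (by omega) (by omega) (by omega) (by omega) (by omega)
    have n3 : fanLabel n (k - 1) ≠ fanLabel n k :=
      fanLabel_ne (by omega) (by omega) (by omega) (by omega) (by omega)
    set f := (fan n 0).flip (fanLabel n k) with hf
    have hk' : f (fanLabel n k) = arc n (k - 1) (k + 1) := by
      refine flip_apply_self _ ?_
      rw [hk]
      exact .left ⟨by omega, by omega, by omega, by omega, edge_fan 0 (by omega) (by omega),
        Or.inl (by ring), Or.inl rfl, edge_fan 0 (by omega) (by omega)⟩
    have hd' : f (fanLabel n (k - 1)) = arc n 0 (k - 1) := by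
      rw [hf, flip_apply_of_ne _ n3, hd]
    have hc' : f (fanLabel n (k + 1)) = arc n 0 (k + 1) := by
      rw [hf, flip_apply_of_ne _ n2, hc]
    have he : ∀ x, 0 < x → x ≤ (n : ℤ) + 2 → x ≠ k → Edge (Set.range f) 0 x := by
      intro x h3 h4 h5
      refine edge_flip_of_ne _ (edge_fan 0 h3 (by omega)) ?_
      rw [hk]
      exact arc_ne_of_length (by omega)
    rcases (Int.add_one_le_iff.2 h2).lt_or_eq with h3 | h3
    · exact flip_not_comm _ n1 (w := 0) (v := k - 2) (x := k - 1) (y := k + 1) (z := k + 2)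
        (by omega) (by omega) (by omega) (by omega) (by omega)
        (he _ (by omega) (by omega) (by omega)) (Or.inl (by ring)) (edge_of_apply_eq _ hk')
        (Or.inl (by ring)) (he _ (by omega) (by omega) (by omega)) hc' hd'
    · refine flip_central_not_comm _ n1 (a := 0) (v := k - 2) (x := k - 1) (by omega) (by omega)
        (by omega) (he _ (by omega) (by omega) (by omega)) (Or.inl (by ring)) ?_ ?_ hd'
      · rw [zero_add, ← h3]
        exact edge_of_apply_eq _ hk'
      · rw [hc', zero_add, ← h3]

theorem IsFanLike.move {f : Labelling n} (h : IsFanLike f) (g : DihedralGroup (n + 2)) :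
    IsFanLike (move g f) := by
  have hinj : Function.Injective (Labelling.move g) := by
    intro a b hab
    have := congrArg (Labelling.move g⁻¹) hab
    rwa [← move_mul, ← move_mul, inv_mul_cancel, move_one, move_one] at this
  constructor
  · intro k h1 h2 hc
    refine h.adj k h1 h2 (hinj ?_)
    simp only [← flip_move]
    exact hc
  · intro k h1 h2 hc
    refine h.flip_adj k h1 h2 (hinj ?_)
    simp only [← flip_move]
    exact hc

/-- Descending from the central diagonal, the two non-commutation conditions force each arc to start
at a and to end before the preceding one. There are n + 1 distinct ends between a + 2 and a + n + 2,
so all of them are known. -/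
theorem IsFanLike.eq_fan {f : Labelling n} (hf : IsFanLike f) {a x : ℤ} (hn : 1 ≤ n)
    (hm : f none = arc n a (a + ((n : ℤ) + 2)))
    (hx : f (fanLabel n ((n : ℤ) + 1)) = arc n a x) (hxe : Edge (Set.range f) x (a + ((n : ℤ) + 2))) :
    f = fan n a := by
  obtain ⟨B, hB⟩ : ∃ B : ℤ → ℤ, ∀ k, B k = a + (f (fanLabel n k)).2 := ⟨_, fun _ => rfl⟩
  have hBl : ∀ k, a + 2 ≤ B k ∧ B k ≤ a + ((n : ℤ) + 2) := by
    intro k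
    have := f.2.noncrossing.len (f (fanLabel n k)) ⟨_, rfl⟩
    have := hB k
    omega
  have hBtop : B ((n : ℤ) + 2) = a + ((n : ℤ) + 2) := by
    rw [hB, fanLabel_top, hm, arc_snd]
    ring
  -- Descending induction: stage k controls the labels of fan lengths n + 1 − k, …, n + 2 and the
  -- third sides of the triangles between consecutive arcs.
  have key : ∀ k : ℕ, k + 1 ≤ n →
      (∀ j : ℤ, (n : ℤ) + 1 - k ≤ j → j ≤ (n : ℤ) + 2 → f (fanLabel n j) = arc n a (B j)) ∧
      (∀ j : ℤ, (n : ℤ) + 1 - k ≤ j → j < (n : ℤ) + 2 → B j < B (j + 1) ∧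
        Edge (Set.range f) (B j) (B (j + 1))) := by
    intro k
    induction k with
    | zero =>
      intro _
      have hBx : B ((n : ℤ) + 1) = x := by
        rw [hB, hx, arc_snd]
        ring
      constructor
      · intro j h1 h2
        rcases h2.lt_or_eq with h | h
        · obtain rfl : j = (n : ℤ) + 1 := by omega
          rw [hBx, hx]
        · rw [h, hBtop, fanLabel_top, hm]
      · intro j h1 h2
        obtain rfl : j = (n : ℤ) + 1 := by omega
        rw [hBx, show (n : ℤ) + 1 + 1 = n + 2 by ring, hBtop]
        exact ⟨f.2.noncrossing.lt hxe, hxe⟩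
    | succ k ih =>
      intro hk
      obtain ⟨ih1, ih2⟩ := ih (by omega)
      obtain ⟨m, hmk⟩ : ∃ m : ℤ, m = (n : ℤ) + 1 - k := ⟨_, rfl⟩
      rw [← hmk] at ih1 ih2
      have hm3 : 3 ≤ m := by omega
      have e1 := ih1 m le_rfl (by omega)
      have e2 := ih1 (m + 1) (by omega) (by omega)
      have ⟨l1, g1⟩ := ih2 m le_rfl (by omega)
      have b1 := hBl m
      have b2 := hBl (m + 1)
      have hE := f.edge_of_apply_eq e1
      obtain ⟨y, hay, hyb, y1, y2⟩ := f.2.full.exists_apex hE (by omega)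
      have n1 : fanLabel n (m + 1) ≠ fanLabel n (m - 1) :=
        fanLabel_ne (by omega) (by omega) (by omega) (by omega) (by omega)
      have n2 : fanLabel n (m + 1) ≠ fanLabel n m :=
        fanLabel_ne (by omega) (by omega) (by omega) (by omega) (by omega)
      have n3 : fanLabel n (m - 1) ≠ fanLabel n m :=
        fanLabel_ne (by omega) (by omega) (by omega) (by omega) (by omega)
      have hmain : f (fanLabel n (m - 1)) = arc n a y := by
        -- By `adj`, the label m − 1 is on a side of the quadrilateral a, y, B m, B (m + 1) around
        -- label m; its fourth side carries m + 1.
        have s1 : arc n a y = f (fanLabel n (m - 1)) ∨ arc n y (B m) = f (fanLabel n (m - 1)) ∨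
            arc n (B m) (B (m + 1)) = f (fanLabel n (m - 1)) := by
          by_contra! hcon
          apply hf.adj m hm3 (by omega)
          refine flip_comm_of_exchange f n3.symm (β := arc n y (B (m + 1))) ?_
          rw [e1]
          exact .left ⟨hay, hyb, l1, b2.2, y1.diff hcon.1, y2.diff hcon.2.1, g1.diff hcon.2.2,
            (f.edge_of_apply_eq e2).diff fun h => n1 (f.2.injective (e2.trans h))⟩
        -- If label m − 1 were on one of the two sides away from a, the flip of m would separate it
        -- from the quadrilateral around label m + 1. The flips of m + 1 and m − 1 would then
        -- commute, against `flip_adj`.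
        by_contra hne
        set f' := f.flip (fanLabel n m) with hf'
        have c1 : f' (fanLabel n m) = arc n y (B (m + 1)) := by
          refine f.flip_apply_self ?_
          rw [e1]
          exact .left ⟨hay, hyb, l1, b2.2, y1, y2, g1, f.edge_of_apply_eq e2⟩
        have c2 : f' (fanLabel n (m + 1)) = arc n a (B (m + 1)) := by
          rw [hf', flip_apply_of_ne _ n2, e2]
        have c3 : f' (fanLabel n (m - 1)) = f (fanLabel n (m - 1)) := flip_apply_of_ne _ n3
        have y1' : Edge (Set.range f') a y := by
          refine f.edge_flip_of_ne y1 ?_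
          rw [e1]
          exact arc_ne_of_length (by omega)
        apply hf.flip_adj m hm3 (by omega)
        rcases (show m + 1 ≤ (n : ℤ) + 2 by omega).lt_or_eq with h | h
        · have e3 := ih1 (m + 1 + 1) (by omega) (by omega)
          have ⟨l2, g2⟩ := ih2 (m + 1) (by omega) h
          have b3 := hBl (m + 1 + 1)
          have g2' : Edge (Set.range f') (B (m + 1)) (B (m + 1 + 1)) := by
            refine f.edge_flip_of_ne g2 ?_
            rw [e1]
            exact arc_ne_of_start (by omega) (by omega) (by omega)
          have g3' : Edge (Set.range f') a (B (m + 1 + 1)) := by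
            refine f.edge_flip_of_ne (f.edge_of_apply_eq e3) ?_
            rw [e1]
            exact arc_ne_of_length (by omega)
          refine flip_comm_of_exchange f' n1 (β := arc n y (B (m + 1 + 1))) ?_
          rw [c2, c3]
          refine .left ⟨hay, by omega, l2, b3.2, y1'.diff (Ne.symm hne),
            (f'.edge_of_apply_eq c1).diff ?_, g2'.diff ?_, g3'.diff ?_⟩
          · rcases s1 with s | s | s
            · exact (hne s.symm).elim
            · rw [← s]
              exact arc_ne_of_length (by omega)
            · rw [← s]
              exact arc_ne_of_start (by omega) (by omega) (by omega)
          · rcases s1 with s | s | s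
            · exact (hne s.symm).elim
            · rw [← s]
              exact arc_ne_of_start (by omega) (by omega) (by omega)
            · rw [← s]
              exact arc_ne_of_start (by omega) (by omega) (by omega)
          · rcases s1 with s | s | s
            · exact (hne s.symm).elim
            · rw [← s]
              exact arc_ne_of_start (by omega) (by omega) (by omega)
            · rw [← s]
              exact arc_ne_of_start (by omega) (by omega) (by omega)
        · rw [h] at c1 c2 n1 s1 l1 ⊢
          rw [hBtop] at c1 c2 s1 l1
          refine flip_comm_of_exchange f' n1 (β := arc n y (y + ((n : ℤ) + 2))) ?_
          rw [c2, c3]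
          refine .central ⟨hay, by omega, y1'.diff (Ne.symm hne),
            (f'.edge_of_apply_eq c1).diff ?_⟩
          rcases s1 with s | s | s
          · exact (hne s.symm).elim
          · rw [← s]
            exact arc_ne_of_length (by omega)
          · rw [← s]
            exact arc_ne_of_start (by omega) (by omega) (by omega)
      have hBy : B (m - 1) = y := by
        rw [hB, hmain, arc_snd]
        ring
      constructor
      · intro j h1 h2
        by_cases hj : m ≤ j
        · exact ih1 j hj h2
        · obtain rfl : j = m - 1 := by omega
          rw [hBy, hmain]
      · intro j h1 h2
        by_cases hj : m ≤ j
        · exact ih2 j hj h2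
        · obtain rfl : j = m - 1 := by omega
          rw [hBy, sub_add_cancel]
          exact ⟨hyb, y2⟩
  obtain ⟨k1, k2⟩ := key (n - 1) (by omega)
  -- Strict monotonicity bounds the ends from below starting at length 2, and from above starting at
  -- length n + 2; the two bounds coincide.
  have hlow : ∀ i : ℕ, i ≤ n → a + (2 + i) ≤ B (2 + i) := by
    intro i
    induction i with
    | zero =>
      intro _
      have := hBl (2 + (0 : ℕ))
      push_cast at this ⊢
      omega
    | succ i ih =>
      intro hi
      have h1 := ih (by omega)
      have h2 := (k2 (2 + i) (by omega) (by omega)).1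
      push_cast
      rw [← add_assoc (2 : ℤ)]
      omega
  have hup : ∀ i : ℕ, i ≤ n → B ((n : ℤ) + 2 - i) ≤ a + ((n : ℤ) + 2 - i) := by
    intro i
    induction i with
    | zero =>
      intro _
      have := hBtop
      push_cast
      rw [sub_zero]
      omega
    | succ i ih =>
      intro hi
      have h1 := ih (by omega)
      have h2 := (k2 ((n : ℤ) + 2 - (i + 1 : ℕ)) (by omega) (by omega)).1
      have h3 : (n : ℤ) + 2 - (i + 1 : ℕ) + 1 = (n : ℤ) + 2 - i := by push_cast; ring
      rw [h3] at h2
      omega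
  apply Subtype.ext
  funext l
  have hl := fanLength_bounds l
  obtain ⟨i, hi⟩ : ∃ i : ℕ, fanLength l = 2 + i := ⟨(fanLength l - 2).toNat, by omega⟩
  obtain ⟨j, hj⟩ : ∃ j : ℕ, fanLength l = (n : ℤ) + 2 - j :=
    ⟨((n : ℤ) + 2 - fanLength l).toNat, by omega⟩
  have h1 := hlow i (by omega)
  have h2 := hup j (by omega)
  rw [← hi] at h1
  rw [← hj] at h2
  have h3 := k1 (fanLength l) (by omega) (by omega)
  rw [fanLabel_fanLength] at h3
  rw [h3, show B (fanLength l) = a + fanLength l by omega]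
  rfl

/-- Locally fan-like triangulations are fans. -/
theorem IsFanLike.exists_move {f : Labelling n} (hf : IsFanLike f) (hn : 1 ≤ n)
    (hm : (f none).2 = (n : ℤ) + 2) : ∃ g, f = Labelling.move g (fan n 0) := by
  obtain ⟨a, ha⟩ := exists_arc (f none)
  rw [hm] at ha
  obtain ⟨x, h1, h2, h3, h4⟩ := f.2.full.exists_apex (f.edge_of_apply_eq ha.symm) (by omega)
  have hne : none ≠ fanLabel n ((n : ℤ) + 1) := by
    rw [← fanLabel_top]
    exact fanLabel_ne (by omega) (by omega) (by omega) (by omega) (by omega)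
  have key : arc n a x = f (fanLabel n ((n : ℤ) + 1)) ∨
      arc n x (a + ((n : ℤ) + 2)) = f (fanLabel n ((n : ℤ) + 1)) := by
    by_contra! hcon
    have := hf.adj ((n : ℤ) + 2) (by omega) le_rfl
    rw [fanLabel_top, show (n : ℤ) + 2 - 1 = n + 1 by ring] at this
    apply this
    refine flip_comm_of_exchange f hne (β := arc n x (x + ((n : ℤ) + 2))) ?_
    rw [← ha]
    exact .central ⟨h1, h2, h3.diff hcon.1, h4.diff hcon.2⟩
  rcases key with key | key
  · rw [hf.eq_fan hn ha.symm key.symm h4]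
    exact ⟨_, fan_eq_move a⟩
  -- The label next to the central one sits at the far end of the central diagonal; a reflection
  -- reduces this to the previous case.
  · set f' := Labelling.move (.sr ((0 : ℤ) : ZMod (n + 2))) f with hf'
    have m1 : f' none = arc n (-a - ((n : ℤ) + 2)) (-a - ((n : ℤ) + 2) + ((n : ℤ) + 2)) := by
      rw [hf', move_apply, ← ha, arcAction_sr]
      congr 1 <;> ring
    have m2 : f' (fanLabel n ((n : ℤ) + 1)) = arc n (-a - ((n : ℤ) + 2)) (-x) := by
      rw [hf', move_apply, ← key, arcAction_sr]
      congr 1 <;> ring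
    have m3 : Edge (Set.range f') (-x) (-a - ((n : ℤ) + 2) + ((n : ℤ) + 2)) := by
      rcases h3 with h3 | ⟨l, hl⟩
      · left
        omega
      · refine f'.edge_of_apply_eq (l := l) ?_
        rw [hf', move_apply, hl, arcAction_sr]
        congr 1 <;> ring
    have h5 := (hf.move _).eq_fan hn m1 m2 m3
    rw [fan_eq_move] at h5
    refine ⟨(.sr ((0 : ℤ) : ZMod (n + 2)))⁻¹ * .r ((-a - ((n : ℤ) + 2) : ℤ) : ZMod (n + 2)), ?_⟩
    rw [move_mul, ← h5, ← move_mul, inv_mul_cancel, move_one]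

end Labelling

end Cyclohedron

/-! ### Colored triangulations as rooted labellings, and the pairs compatible with flips -/

namespace Cyclohedron

variable {n : ℕ}

open Labelling

/-- The labelled triangulations whose central diagonal has the label `none`. -/
abbrev Rooted (n : ℕ) : Type := {f : Labelling n // (f none).2 = (n : ℤ) + 2}

namespace Rooted

/-- The flip of a rooted labelled triangulation. -/
noncomputable def flip (l : Option (Fin n)) (f : Rooted n) : Rooted n :=
  ⟨f.1.flip l, (f.1.central_flip_iff l none).2 f.2⟩

theorem flip_val (l : Option (Fin n)) (f : Rooted n) : (flip l f).1 = f.1.flip l := rfl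

theorem flip_flip (l : Option (Fin n)) (f : Rooted n) : flip l (flip l f) = f :=
  Subtype.ext (f.1.flip_flip l)

/-- The flip relation of rooted labelled triangulations. -/
def Rel (c : Option (Fin n)) (f g : Rooted n) : Prop := g = flip c f

theorem rel_iff (c : Option (Fin n)) (f g : Rooted n) : Rel c f g ↔ g = flip c f := Iff.rfl

/-- The standard fan. -/
def fan (n : ℕ) : Rooted n := ⟨Labelling.fan n 0, by
  rw [Labelling.fan_apply, arc_snd, fanLength_none]
  ring⟩

/-- Flips with labels other than l leave the arc of l unchanged, whereas the flip of l changes it.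
-/
theorem mem_of_flip_mem (C : Set (Option (Fin n))) (f : Rooted n) (l : Option (Fin n))
    (h : flip l f ∈ flipClass Rel C f) : l ∈ C := by
  by_contra hl
  have := flipClass_induction rel_iff flip_flip (P := fun g : Rooted n => g.1 l = f.1 l) rfl
    (fun g hg c hc => by
      rw [flip_val, flip_apply_of_ne, hg]
      rintro rfl
      exact hl hc) h
  exact f.1.flip_ne l this

theorem mem_flipClass_univ (f g : Rooted n) : g ∈ flipClass Rel Set.univ f := by
  have key := (conn_fan f.1 f.2).trans (conn_fan g.1 g.2).symm
  have := Conn.iff_of_flip (P := fun h : Labelling n => ∃ hh : (h none).2 = (n : ℤ) + 2,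
    (⟨h, hh⟩ : Rooted n) ∈ flipClass Rel Set.univ f) ?_ key
  · exact (this.1 ⟨f.2, mem_flipClass_self _ _⟩).2
  · have step : ∀ (h : Labelling n) (c), (∃ hh : (h none).2 = (n : ℤ) + 2,
        (⟨h, hh⟩ : Rooted n) ∈ flipClass Rel Set.univ f) →
        ∃ hh : (h.flip c none).2 = (n : ℤ) + 2,
          (⟨h.flip c, hh⟩ : Rooted n) ∈ flipClass Rel Set.univ f := by
      rintro h c ⟨hh, hm⟩
      exact ⟨(flip c ⟨h, hh⟩).2, hm.trans _ _ _ (flip_mem_flipClass rel_iff (Set.mem_univ c) _)⟩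
    refine fun h c => ⟨step h c, fun h' => ?_⟩
    have := step _ c h'
    rwa [Labelling.flip_flip] at this

instance : MulAction (Equiv.Perm (Fin n) × DihedralGroup (n + 2)) (Rooted n) where
  smul p f := ⟨relabel (labelPerm p.1) (move p.2 f.1), by
    rw [relabel_apply, move_apply, arcAction_snd]
    have : (labelPerm p.1).symm none = none := by
      rw [Equiv.symm_apply_eq, labelPerm_none]
    rw [this, f.2]⟩
  one_smul f := by
    apply Subtype.ext
    change relabel (labelPerm 1) (move 1 f.1) = f.1
    rw [map_one, move_one, relabel_one]
  mul_smul p q f := by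
    apply Subtype.ext
    change relabel (labelPerm (p.1 * q.1)) (move (p.2 * q.2) f.1) =
      relabel (labelPerm p.1) (move p.2 (relabel (labelPerm q.1) (move q.2 f.1)))
    rw [map_mul, move_mul, ← relabel_relabel]
    rfl

theorem smul_val (p : Equiv.Perm (Fin n) × DihedralGroup (n + 2)) (f : Rooted n) :
    (p • f).1 = relabel (labelPerm p.1) (move p.2 f.1) := rfl

theorem smul_flip (p : Equiv.Perm (Fin n) × DihedralGroup (n + 2)) (l : Option (Fin n))
    (f : Rooted n) : p • flip l f = flip (labelPerm p.1 l) (p • f) := by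
  apply Subtype.ext
  rw [smul_val, flip_val, flip_val, smul_val, flip_relabel, flip_move]

theorem labelPerm_injective :
    Function.Injective (labelPerm : Equiv.Perm (Fin n) → Equiv.Perm (Option (Fin n))) := by
  intro a b h
  ext1 i
  have := congrArg (fun π : Equiv.Perm (Option (Fin n)) => π (some i)) h
  exact Option.some_injective _ this

/-- A rotation is determined by where it sends a start. A reflection sends the common start to
points that depend on the lengths 2 and 3, which would give 1 = 0 modulo n + 2. -/
theorem eq_one_of_arcAction {g : DihedralGroup (n + 2)}
    (h2 : arcAction n g (arc n 0 2) = arc n 0 2) (h3 : arcAction n g (arc n 0 3) = arc n 0 3) :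
    g = 1 := by
  rcases g with c | c
  · have := congrArg Prod.fst h2
    change ((0 : ℤ) : ZMod (n + 2)) + c = ((0 : ℤ) : ZMod (n + 2)) at this
    rw [Int.cast_zero, zero_add] at this
    rw [this, DihedralGroup.r_zero]
  · have e2 := congrArg Prod.fst h2
    have e3 := congrArg Prod.fst h3
    change -((0 : ℤ) : ZMod (n + 2)) - ((2 - 0 : ℤ) : ZMod (n + 2)) - c =
      ((0 : ℤ) : ZMod (n + 2)) at e2
    change -((0 : ℤ) : ZMod (n + 2)) - ((3 - 0 : ℤ) : ZMod (n + 2)) - c =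
      ((0 : ℤ) : ZMod (n + 2)) at e3
    have h := e2.trans e3.symm
    push_cast at h
    have : (1 : ZMod (n + 2)) = 0 := by linear_combination h
    have hn : Fact (1 < n + 2) := ⟨by omega⟩
    exact (one_ne_zero this).elim

theorem eq_one_of_move_fan (hn : 1 ≤ n) {g : DihedralGroup (n + 2)}
    (h : move g (Labelling.fan n 0) = Labelling.fan n 0) : g = 1 := by
  have key : ∀ k : ℤ, 2 ≤ k → k ≤ (n : ℤ) + 2 → arcAction n g (arc n 0 k) = arc n 0 k := by
    intro k h1 h2
    rw [← fan_zero_fanLabel h1 h2, ← move_apply, h]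
  exact eq_one_of_arcAction (key 2 le_rfl (by omega)) (key 3 (by omega) (by omega))

theorem eq_one_of_smul_fan (hn : 1 ≤ n) {p : Equiv.Perm (Fin n) × DihedralGroup (n + 2)}
    (h1 : labelPerm p.1 = 1) (h : p • fan n = fan n) : p = 1 := by
  have h2 : p.1 = 1 := labelPerm_injective (h1.trans (map_one _).symm)
  have h3 := congrArg Subtype.val h
  rw [smul_val, h1, relabel_one] at h3
  exact Prod.ext h2 (eq_one_of_move_fan hn h3)

/-- In a pentagon ten alternating flips are trivial, so the sixth iterate equals the first, which
moves the fan. A color permutation carries this pentagon to one that involves i. -/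
theorem exists_iterate_ne (hn : 2 ≤ n) (i : Fin n) :
    ∃ (f : Rooted n) (c : Option (Fin n)),
      (fun g : Rooted n => flip (some i) (flip c g))^[6] f ≠ f := by
  obtain ⟨c, hc⟩ : ∃ c : Fin n, (c : ℕ) = 0 := ⟨⟨0, by omega⟩, rfl⟩
  obtain ⟨d, hd⟩ : ∃ d : Fin n, (d : ℕ) = c + 1 := ⟨⟨1, by omega⟩, by simp [hc]⟩
  have h1 := swap_fan_pentagon hd
  -- Applying the swap to the five-flip relation continues it by five flips in the opposite roles;
  -- together these are ten alternating flips that fix the fan.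
  have h2 := congrArg (relabel (Equiv.swap (some c) (some d))) h1
  rw [relabel_relabel, Equiv.swap_mul_self, relabel_one, ← flip_relabel, ← flip_relabel,
    ← flip_relabel, ← flip_relabel, ← flip_relabel, Equiv.swap_apply_left,
    Equiv.swap_apply_right, ← h1] at h2
  have h5 : (fun g : Rooted n => flip (some d) (flip (some c) g))^[5] (fan n) = fan n :=
    Subtype.ext h2
  have hne : (fun g : Rooted n => flip (some d) (flip (some c) g))^[6] (fan n) ≠ fan n := by
    intro h6
    rw [show 6 = 1 + 5 from rfl, Function.iterate_add_apply, h5] at h6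
    have h7 := congrArg (flip (some d)) h6
    rw [Function.iterate_one, flip_flip] at h7
    have h8 := congrArg (fun g : Rooted n => g.1 (some c)) h7
    change (Labelling.fan n 0).flip (some c) (some c) =
      (Labelling.fan n 0).flip (some d) (some c) at h8
    have hcd : some c ≠ some d := by
      intro h
      have := congrArg Fin.val (Option.some_injective _ h)
      omega
    rw [flip_apply_of_ne _ hcd] at h8
    exact flip_ne _ _ h8
  set p : Equiv.Perm (Fin n) × DihedralGroup (n + 2) := (Equiv.swap d i, 1) with hp
  refine ⟨p • fan n, labelPerm p.1 (some c), fun h => hne ?_⟩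
  have hsc : Function.Semiconj (fun f : Rooted n => p • f)
      (fun g : Rooted n => flip (some d) (flip (some c) g))
      (fun g : Rooted n => flip (some i) (flip (labelPerm p.1 (some c)) g)) := by
    intro g
    change p • flip (some d) (flip (some c) g) =
      flip (some i) (flip (labelPerm p.1 (some c)) (p • g))
    rw [smul_flip, smul_flip, labelPerm_some, labelPerm_some]
    simp [hp]
  have h9 := hsc.iterate_right 6 (fan n)
  exact MulAction.injective p (h9.trans h)

theorem iterate_none (f : Rooted n) (c : Option (Fin n)) :
    (fun g : Rooted n => flip none (flip c g))^[6] f = f := by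
  have hsc : Function.Semiconj (fun f : Rooted n => f.1)
      (fun g : Rooted n => flip none (flip c g))
      (fun g : Labelling n => (g.flip c).flip none) := fun g => rfl
  apply Subtype.ext
  exact (hsc.iterate_right 6 f).trans (f.1.iterate_central f.2 c)

/-- The central label is the only one whose products with all other flips have trivial sixth power,
and equivariance transports this property. -/
theorem label_none_of_equivariant (hn : 2 ≤ n) {φ : Equiv.Perm (Rooted n)}
    {σ : Equiv.Perm (Option (Fin n))} (h : FlipEquivariant (flip (n := n)) φ σ) :
    σ none = none := by
  by_contra hne
  obtain ⟨i, hi⟩ := Option.ne_none_iff_exists'.1 hne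
  obtain ⟨f, c, hfc⟩ := exists_iterate_ne hn i
  apply hfc
  have hsc : Function.Semiconj φ (fun g : Rooted n => flip none (flip (σ.symm c) g))
      (fun g : Rooted n => flip (some i) (flip c g)) := by
    intro g
    change φ (flip none (flip (σ.symm c) g)) = _
    rw [h, h, hi, Equiv.apply_symm_apply]
  have h9 := hsc.iterate_right 6 (φ.symm f)
  rw [iterate_none, Equiv.apply_symm_apply] at h9
  exact h9.symm

/-- Being fan-like is expressed by labels and commuting flips only, and φ respects both when it
fixes the labels. -/
theorem isFanLike_of_equivariant {φ : Equiv.Perm (Rooted n)}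
    (h : FlipEquivariant (flip (n := n)) φ id) : IsFanLike (φ (fan n)).1 := by
  have hcomm : ∀ (f : Rooted n) c d, FlipsCommute (φ f).1 c d → FlipsCommute f.1 c d := by
    intro f c d hc
    have h1 : flip c (flip d (φ f)) = flip d (flip c (φ f)) := Subtype.ext hc
    have h2 : ∀ l f, flip l (φ f) = φ (flip l f) := fun l f => (h l f).symm
    rw [h2, h2, h2, h2] at h1
    exact congrArg Subtype.val (φ.injective h1)
  constructor
  · intro k h1 h2 hc
    exact fan_isFanLike.adj k h1 h2 (hcomm _ _ _ hc)
  · intro k h1 h2 hc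
    refine fan_isFanLike.flip_adj k h1 h2 (hcomm (flip (fanLabel n k) (fan n)) _ _ ?_)
    rw [h]
    exact hc

theorem exists_smul_fan (hn : 2 ≤ n) {φ : Equiv.Perm (Rooted n)}
    {σ : Equiv.Perm (Option (Fin n))} (h : FlipEquivariant (flip (n := n)) φ σ) :
    ∃ p : Equiv.Perm (Fin n) × DihedralGroup (n + 2),
      labelPerm p.1 = σ ∧ p • fan n = φ (fan n) := by
  obtain ⟨τ, rfl⟩ := exists_labelPerm (label_none_of_equivariant hn h)
  let q : Equiv.Perm (Fin n) × DihedralGroup (n + 2) := (τ, 1)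
  have h' : FlipEquivariant (flip (n := n)) (φ.trans (MulAction.toPerm q⁻¹)) id := by
    intro l f
    change q⁻¹ • φ (flip l f) = flip l (q⁻¹ • φ f)
    rw [h, smul_flip]
    congr 1
    change labelPerm τ⁻¹ (labelPerm τ l) = l
    rw [← Equiv.Perm.mul_apply, ← map_mul, inv_mul_cancel, map_one]
    rfl
  obtain ⟨g, hg⟩ := (isFanLike_of_equivariant h').exists_move (by omega)
    (φ.trans (MulAction.toPerm q⁻¹) (fan n)).2
  have hg' : q⁻¹ • φ (fan n) = ((1, g) : Equiv.Perm (Fin n) × DihedralGroup (n + 2)) • fan n := by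
    apply Subtype.ext
    rw [smul_val (1, g), map_one, relabel_one]
    exact hg
  refine ⟨(τ, g), rfl, ?_⟩
  have : ((τ, g) : Equiv.Perm (Fin n) × DihedralGroup (n + 2)) = q * (1, g) := by
    simp [q]
  rw [this, mul_smul, ← hg', smul_inv_smul]

/-! ### The case n = 1 -/

section Hexagon

theorem flip_none_fan_one : flip none (fan 1) =
    ((1, .sr 1) : Equiv.Perm (Fin 1) × DihedralGroup (1 + 2)) • fan 1 := by
  symm
  apply Subtype.ext
  rw [smul_val, map_one, relabel_one, flip_val, Labelling.flip_eq_iff]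
  constructor
  · intro k hk
    obtain ⟨i, rfl⟩ := Option.ne_none_iff_exists'.1 hk
    obtain rfl : i = 0 := Subsingleton.elim _ _
    change (_, _) = (_, _)
    ext
    · decide
    · rfl
  · intro h
    have := congrArg Prod.fst h
    revert this
    decide

theorem flip_some_fan_one (i : Fin 1) : flip (some i) (fan 1) =
    ((1, .sr 0) : Equiv.Perm (Fin 1) × DihedralGroup (1 + 2)) • fan 1 := by
  obtain rfl : i = 0 := Subsingleton.elim _ _
  symm
  apply Subtype.ext
  rw [smul_val, map_one, relabel_one, flip_val, Labelling.flip_eq_iff]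
  constructor
  · intro k hk
    cases k with
    | none =>
      change (_, _) = (_, _)
      ext
      · decide
      · rfl
    | some i => exact (hk (by rw [Subsingleton.elim i 0])).elim
  · intro h
    have := congrArg Prod.fst h
    revert this
    decide

/-- The reflection by which a flip of the standard fan of the hexagon acts. -/
def hexReflection : Option (Fin 1) → DihedralGroup 3
  | none => .sr 1
  | some _ => .sr 0

/-- Triangulations of the hexagon as elements of the dihedral group. -/
def hexTriangulation (g : DihedralGroup 3) : Rooted 1 :=
  ((1, g) : Equiv.Perm (Fin 1) × DihedralGroup (1 + 2)) • fan 1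

/-- At the standard fan each flip acts as a reflection. The dihedral action commutes with flips, so
elsewhere the flip is right multiplication by that reflection. -/
theorem flip_hexTriangulation (l : Option (Fin 1)) (g : DihedralGroup 3) :
    flip l (hexTriangulation g) = hexTriangulation (g * hexReflection l) := by
  have h := smul_flip ((1, g) : Equiv.Perm (Fin 1) × DihedralGroup (1 + 2)) l (fan 1)
  rw [map_one] at h
  refine h.symm.trans ?_
  cases l with
  | none =>
    rw [flip_none_fan_one, smul_smul]
    rfl
  | some i =>
    rw [flip_some_fan_one, smul_smul]
    rfl

theorem hexTriangulation_bijective : Function.Bijective hexTriangulation := by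
  constructor
  · intro g k h
    have h1 : ((1, k⁻¹ * g) : Equiv.Perm (Fin 1) × DihedralGroup (1 + 2)) • fan 1 = fan 1 := by
      have : ((1, k⁻¹ * g) : Equiv.Perm (Fin 1) × DihedralGroup (1 + 2)) = (1, k)⁻¹ * (1, g) := by
        ext1 <;> simp
      rw [this, mul_smul, inv_smul_eq_iff]
      exact h
    have h2 := congrArg Prod.snd (eq_one_of_smul_fan le_rfl (map_one _) h1)
    exact (inv_mul_eq_one.1 h2).symm
  · intro f
    refine flipClass_induction rel_iff flip_flip (P := fun f => ∃ g, hexTriangulation g = f)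
      ⟨1, one_smul _ (fan 1)⟩ ?_ (mem_flipClass_univ (fan 1) f)
    rintro _ ⟨g, rfl⟩ c _
    exact ⟨_, (flip_hexTriangulation c g).symm⟩

/-- The action of the symmetries of a hexagon on its vertices, which are identified with the
elements of the dihedral group of order six. -/
def hexAction : DihedralGroup 6 →* Equiv.Perm (DihedralGroup 3) where
  toFun
    -- Left multiplications preserve both flips. Conjugation by `sr 2` exchanges `sr 0` and `sr 1`,
    -- so right multiplication by it exchanges the labels; this happens for odd c.
    | .r c => ⟨fun x => .r c.cast * x * (.sr 2) ^ c.val, fun x => .r (-c.cast) * x * (.sr 2) ^ c.val,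
        by revert c; decide, by revert c; decide⟩
    | .sr c => ⟨fun x => .sr c.cast * x * (.sr 2) ^ c.val, fun x => .sr c.cast * x * (.sr 2) ^ c.val,
        by revert c; decide, by revert c; decide⟩
  map_one' := by
    ext1 x
    revert x
    decide
  map_mul' := by
    intro a b
    ext1 x
    revert a b x
    decide

/-- The action of the symmetries of a hexagon on the two classes of alternate edges. -/
def hexLabelAction : DihedralGroup 6 →* Equiv.Perm (Option (Fin 1)) where
  toFun
    | .r c => (Equiv.swap none (some 0)) ^ c.val
    | .sr c => (Equiv.swap none (some 0)) ^ c.val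
  map_one' := by decide
  map_mul' := by decide

theorem hexAction_mul (g : DihedralGroup 6) (l : Option (Fin 1)) (x : DihedralGroup 3) :
    hexAction g (x * hexReflection l) = hexAction g x * hexReflection (hexLabelAction g l) := by
  revert g l x
  decide

theorem hexAction_free (g : DihedralGroup 6) (h1 : hexLabelAction g = 1)
    (h2 : hexAction g 1 = 1) : g = 1 := by
  revert g
  decide

theorem hexAction_transitive (σ : Equiv.Perm (Option (Fin 1))) (x : DihedralGroup 3) :
    ∃ g, hexLabelAction g = σ ∧ hexAction g 1 = x := by
  revert σ x
  decide

end Hexagon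

end Rooted

end Cyclohedron

/-! ### Dictionary between diagonals of K and intervals in ℤ -/

namespace Cyclohedron

variable {n : ℕ}

theorem vertex_eq_iff {i p : ℤ} :
    (i : Vertex n) = (p : Vertex n) ↔ (2 * (n : ℤ) + 4) ∣ p - i := by
  have h := ZMod.intCast_eq_intCast_iff_dvd_sub i p (2 * n + 4)
  push_cast at h
  exact h

theorem vertex_sbtw_iff (a b c : Vertex n) : sbtw a b c ↔
    a.val < b.val ∧ b.val < c.val ∨ b.val < c.val ∧ c.val < a.val ∨
      c.val < a.val ∧ a.val < b.val :=
  Iff.rfl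

theorem dvd_sub_val (i : ℤ) : (2 * (n : ℤ) + 4) ∣ i - (i : Vertex n).val := by
  rw [← vertex_eq_iff (n := n)]
  simp

theorem vertex_val_lt (a : Vertex n) : a.val < 2 * n + 4 := ZMod.val_lt a

theorem eq_or_eq_of_dvd {N d : ℤ} (h : N ∣ d) (h1 : -N < d) (h2 : d < 2 * N) :
    d = 0 ∨ d = N := by
  obtain ⟨k, rfl⟩ := h
  have hN : 0 < N := by nlinarith
  have h3 : -1 < k := by nlinarith
  have h4 : k < 2 := by nlinarith
  have : k = 0 ∨ k = 1 := by omega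
  rcases this with rfl | rfl <;> simp

theorem sbtw_of_lt {i p j : ℤ} (h1 : i < p) (h2 : p < j) (h3 : j < i + (2 * (n : ℤ) + 4)) :
    sbtw (i : Vertex n) p j := by
  have b1 := vertex_val_lt (i : Vertex n)
  have b2 := vertex_val_lt (p : Vertex n)
  have b3 := vertex_val_lt (j : Vertex n)
  have e1 := eq_or_eq_of_dvd (dvd_sub (dvd_sub_val (n := n) p) (dvd_sub_val (n := n) i))
    (by omega) (by omega)
  have e2 := eq_or_eq_of_dvd (dvd_sub (dvd_sub_val (n := n) j) (dvd_sub_val (n := n) i))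
    (by omega) (by omega)
  rw [vertex_sbtw_iff]
  omega

theorem exists_lift_of_sbtw {i : ℤ} {x b : Vertex n} (h : sbtw (i : Vertex n) x b) :
    ∃ p j : ℤ, x = p ∧ b = j ∧ i < p ∧ p < j ∧ j < i + (2 * (n : ℤ) + 4) := by
  rw [vertex_sbtw_iff] at h
  have b1 := vertex_val_lt (i : Vertex n)
  have b2 := vertex_val_lt x
  have b3 := vertex_val_lt b
  obtain ⟨k, hk⟩ : ∃ k, k = i - (i : Vertex n).val := ⟨_, rfl⟩
  have hd : (2 * (n : ℤ) + 4) ∣ k := hk ▸ dvd_sub_val i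
  have hd' : (2 * (n : ℤ) + 4) ∣ k + (2 * (n : ℤ) + 4) := dvd_add hd (dvd_refl _)
  have key : ∀ (y : Vertex n) (m : ℤ), (2 * (n : ℤ) + 4) ∣ m → y = ((y.val + m : ℤ) : Vertex n) := by
    intro y m hm
    have : y = ((y.val : ℤ) : Vertex n) := by simp
    conv_lhs => rw [this]
    rw [vertex_eq_iff]
    simpa using hm
  rcases h with h | h | h
  · exact ⟨_, _, key x k hd, key b k hd, by omega, by omega, by omega⟩
  · exact ⟨_, _, key x _ hd', key b _ hd', by omega, by omega, by omega⟩
  · exact ⟨_, _, key x k hd, key b _ hd', by omega, by omega, by omega⟩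

/-- The segment between the vertices with labels `i` and `j`. -/
def diag (n : ℕ) (i j : ℤ) : Sym2 (Vertex n) := s((i : Vertex n), (j : Vertex n))

theorem diag_comm (i j : ℤ) : diag n i j = diag n j i := Sym2.eq_swap

theorem inversion_diag (i j : ℤ) :
    inversion n (diag n i j) = diag n (i + ((n : ℤ) + 2)) (j + ((n : ℤ) + 2)) := by
  simp [inversion, diag]

theorem diag_shift {k : ℤ} (hk : (2 * (n : ℤ) + 4) ∣ k) (i j : ℤ) :
    diag n (i + k) (j + k) = diag n i j := by
  have h : ∀ i : ℤ, ((i + k : ℤ) : Vertex n) = (i : Vertex n) := by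
    intro i
    symm
    rw [vertex_eq_iff]
    simpa using hk
  unfold diag
  rw [h, h]

theorem diag_shift_right {k : ℤ} (hk : (2 * (n : ℤ) + 4) ∣ k) (i j : ℤ) :
    diag n i (j + k) = diag n i j := by
  have h : ((j + k : ℤ) : Vertex n) = (j : Vertex n) := by
    symm
    rw [vertex_eq_iff]
    simpa using hk
  unfold diag
  rw [h]

/-- If the ends are matched in reverse, the two lengths add up to 2n + 4, so both segments are
central and the reversal is a translation by n + 2. -/
theorem arc_eq_of_diag_eq {i j p q : ℤ} (h1 : i < j) (h2 : j ≤ i + ((n : ℤ) + 2)) (h3 : p < q)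
    (h4 : q ≤ p + ((n : ℤ) + 2)) (h : diag n i j = diag n p q) : arc n i j = arc n p q := by
  have hN : ((n : ℤ) + 2) ∣ 2 * (n : ℤ) + 4 := ⟨2, by ring⟩
  unfold diag at h
  rw [Sym2.eq_iff, vertex_eq_iff, vertex_eq_iff, vertex_eq_iff, vertex_eq_iff] at h
  rw [arc_eq_arc_iff]
  rcases h with ⟨h5, h6⟩ | ⟨h5, h6⟩
  · refine ⟨hN.trans h5, ?_⟩
    have := eq_or_eq_of_dvd (dvd_sub h6 h5) (by omega) (by omega)
    omega
  · have := eq_or_eq_of_dvd (dvd_sub h5 h6) (by omega) (by omega)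
    have h7 : p - i = p - j + ((n : ℤ) + 2) := by omega
    rw [h7]
    exact ⟨dvd_add (hN.trans h6) (dvd_refl _), by omega⟩

/-- The lifts differ by m(n + 2): an even m gives the same diagonal, an odd m its inverted image. -/
theorem diag_eq_or_of_arc_eq {i j p q : ℤ} (h : arc n i j = arc n p q) :
    diag n p q = diag n i j ∨ diag n p q = inversion n (diag n i j) := by
  obtain ⟨⟨m, hm⟩, h2⟩ := arc_eq_arc_iff.1 h
  rw [inversion_diag]
  have hq : q = j + (p - i) := by omega
  have hp : p = i + (p - i) := by omega
  rw [hq, hp, add_sub_cancel_left, hm]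
  rcases Int.even_or_odd' m with ⟨k, rfl | rfl⟩
  · left
    exact diag_shift ⟨k, by ring⟩ _ _
  · right
    have : ∀ x : ℤ, x + ((n : ℤ) + 2) * (2 * k + 1) =
      x + ((n : ℤ) + 2) + (2 * (n : ℤ) + 4) * k := fun x => by ring
    rw [this, this]
    exact diag_shift ⟨k, rfl⟩ _ _

theorem exists_diag {d : Sym2 (Vertex n)} (hd : ¬ d.IsDiag) :
    ∃ i j : ℤ, d = diag n i j ∧ i < j ∧ j ≤ i + ((n : ℤ) + 2) := by
  induction d using Sym2.ind with
  | _ u v =>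
    have hne : u.val ≠ v.val := fun h => hd (ZMod.val_injective _ h)
    have hu : u = ((u.val : ℤ) : Vertex n) := by simp
    have hv : v = ((v.val : ℤ) : Vertex n) := by simp
    have b1 := vertex_val_lt u
    have b2 := vertex_val_lt v
    have huv : s(u, v) = diag n u.val v.val := by
      unfold diag
      rw [← hu, ← hv]
    rw [huv]
    generalize u.val = x at *
    generalize v.val = y at *
    rcases lt_or_gt_of_ne hne with h | h
    · by_cases h' : (y : ℤ) ≤ x + ((n : ℤ) + 2)
      · exact ⟨x, y, rfl, by omega, h'⟩
      · exact ⟨y, x + (2 * (n : ℤ) + 4), by rw [diag_shift_right (dvd_refl _), diag_comm],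
          by omega, by omega⟩
    · by_cases h' : (x : ℤ) ≤ y + ((n : ℤ) + 2)
      · exact ⟨y, x, diag_comm _ _, by omega, h'⟩
      · exact ⟨x, y + (2 * (n : ℤ) + 4), (diag_shift_right (dvd_refl _) _ _).symm,
          by omega, by omega⟩

theorem isSide_diag (i : ℤ) : IsSide n (diag n i (i + 1)) := ⟨i, by simp [diag]⟩

theorem isDiagonal_diag {i j : ℤ} (h1 : i + 2 ≤ j) (h2 : j ≤ i + ((n : ℤ) + 2)) :
    IsDiagonal n (diag n i j) := by
  constructor
  · intro h
    have h3 : (i : Vertex n) = (j : Vertex n) := h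
    rw [vertex_eq_iff] at h3
    have := eq_or_eq_of_dvd h3 (by omega) (by omega)
    omega
  · rintro ⟨a, ha⟩
    obtain ⟨p, rfl⟩ := ZMod.intCast_surjective a
    have ha' : diag n i j = diag n p (p + 1) := by
      rw [ha]
      simp [diag]
    have := (arc_eq_arc_iff.1 (arc_eq_of_diag_eq (by omega) h2 (by omega) (by omega) ha')).2
    omega

theorem exists_diag_of_isDiagonal {d : Sym2 (Vertex n)} (hd : IsDiagonal n d) :
    ∃ i j : ℤ, d = diag n i j ∧ i + 2 ≤ j ∧ j ≤ i + ((n : ℤ) + 2) := by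
  obtain ⟨i, j, rfl, h1, h2⟩ := exists_diag hd.1
  refine ⟨i, j, rfl, ?_, h2⟩
  by_contra h
  obtain rfl : j = i + 1 := by omega
  exact hd.2 (isSide_diag i)

theorem isCentral_diag_iff {i j : ℤ} (h1 : i < j) (h2 : j ≤ i + ((n : ℤ) + 2)) :
    IsCentral n (diag n i j) ↔ j - i = (n : ℤ) + 2 := by
  constructor
  · rintro ⟨a, ha⟩
    obtain ⟨p, rfl⟩ := ZMod.intCast_surjective a
    have ha' : diag n i j = diag n p (p + ((n : ℤ) + 2)) := by
      rw [ha]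
      simp [diag]
    have := (arc_eq_arc_iff.1 (arc_eq_of_diag_eq h1 h2 (by omega) (by omega) ha')).2
    omega
  · intro h
    obtain rfl : j = i + ((n : ℤ) + 2) := by omega
    exact ⟨i, by simp [diag]⟩

theorem cross_diag {i p j q : ℤ} (h1 : i < p) (h2 : p < j) (h3 : j < q)
    (h4 : q < i + (2 * (n : ℤ) + 4)) : Cross n (diag n i j) (diag n p q) := by
  refine ⟨i, j, p, q, rfl, rfl, sbtw_of_lt h1 h2 (by omega), ?_⟩
  have := sbtw_of_lt (n := n) h3 h4 (by omega)
  have h5 : ((i + (2 * (n : ℤ) + 4) : ℤ) : Vertex n) = i := by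
    rw [eq_comm, vertex_eq_iff]
    simp
  rwa [h5] at this

/-- Lift the four ends to one period, then replace each segment longer than n + 2 by the
complementary interval. The lifts still interleave, possibly with the two diagonals interchanged. -/
theorem exists_of_cross {d e : Sym2 (Vertex n)} (h : Cross n d e) :
    ∃ i j p q : ℤ, i < p ∧ p < j ∧ j < q ∧ j ≤ i + ((n : ℤ) + 2) ∧ q ≤ p + ((n : ℤ) + 2) ∧
      ((d = diag n i j ∧ e = diag n p q) ∨ (e = diag n i j ∧ d = diag n p q)) := by
  obtain ⟨a, b, x, y, rfl, rfl, h1, h2⟩ := h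
  obtain ⟨A, rfl⟩ := ZMod.intCast_surjective a
  obtain ⟨X, B, rfl, rfl, h3, h4, h5⟩ := exists_lift_of_sbtw h1
  obtain ⟨Y, A', rfl, h6, h7, h8, h9⟩ := exists_lift_of_sbtw h2
  have hA : A' = A + (2 * (n : ℤ) + 4) := by
    have := eq_or_eq_of_dvd (vertex_eq_iff.1 h6) (by omega) (by omega)
    omega
  subst hA
  change ∃ i j p q : ℤ, i < p ∧ p < j ∧ j < q ∧ j ≤ i + ((n : ℤ) + 2) ∧ q ≤ p + ((n : ℤ) + 2) ∧
      ((diag n A B = diag n i j ∧ diag n X Y = diag n p q) ∨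
        (diag n X Y = diag n i j ∧ diag n A B = diag n p q))
  have hAB : diag n A B = diag n B (A + (2 * (n : ℤ) + 4)) := by
    rw [diag_shift_right (dvd_refl _), diag_comm]
  have hXY : diag n X Y = diag n Y (X + (2 * (n : ℤ) + 4)) := by
    rw [diag_shift_right (dvd_refl _), diag_comm]
  have hXY' : diag n X Y = diag n (Y + -(2 * (n : ℤ) + 4)) X := by
    rw [diag_comm (Y + _), diag_shift_right (dvd_refl _).neg_right]
  by_cases c1 : B ≤ A + ((n : ℤ) + 2) <;> by_cases c2 : Y ≤ X + ((n : ℤ) + 2)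
  · exact ⟨A, B, X, Y, h3, h4, h7, c1, c2, Or.inl ⟨rfl, rfl⟩⟩
  · exact ⟨Y + -(2 * (n : ℤ) + 4), X, A, B, by omega, h3, h4, by omega, c1, Or.inr ⟨hXY', rfl⟩⟩
  · exact ⟨X, Y, B, A + (2 * (n : ℤ) + 4), h4, h7, h8, c2, by omega, Or.inr ⟨rfl, hAB⟩⟩
  · exact ⟨B, A + (2 * (n : ℤ) + 4), Y, X + (2 * (n : ℤ) + 4), h7, h8, by omega, by omega,
      by omega, Or.inl ⟨hAB, hXY⟩⟩

/-- The orbits of the segments in `D`. -/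
def arcsOf (D : Set (Sym2 (Vertex n))) : Set (Arc n) :=
  {α | ∃ i j : ℤ, α = arc n i j ∧ i < j ∧ j ≤ i + ((n : ℤ) + 2) ∧ diag n i j ∈ D}

/-- The segments whose orbits are in `S`. -/
def diagsOf (S : Set (Arc n)) : Set (Sym2 (Vertex n)) :=
  {d | ∃ i j : ℤ, d = diag n i j ∧ i < j ∧ j ≤ i + ((n : ℤ) + 2) ∧ arc n i j ∈ S}

theorem arc_mem_arcsOf {D : Set (Sym2 (Vertex n))} (hD : IsCentrallySymmetric n D) {i j : ℤ} :
    arc n i j ∈ arcsOf D ↔ i < j ∧ j ≤ i + ((n : ℤ) + 2) ∧ diag n i j ∈ D := by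
  constructor
  · rintro ⟨p, q, h, h1, h2, h3⟩
    have := (arc_eq_arc_iff.1 h).2
    refine ⟨by omega, by omega, ?_⟩
    rcases diag_eq_or_of_arc_eq h.symm with h4 | h4
    · rwa [h4]
    · rw [h4]
      exact hD _ h3
  · rintro ⟨h1, h2, h3⟩
    exact ⟨i, j, rfl, h1, h2, h3⟩

theorem diag_mem_diagsOf {S : Set (Arc n)} {i j : ℤ} (h1 : i < j) (h2 : j ≤ i + ((n : ℤ) + 2)) :
    diag n i j ∈ diagsOf S ↔ arc n i j ∈ S := by
  constructor
  · rintro ⟨p, q, h, h3, h4, h5⟩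
    rwa [arc_eq_of_diag_eq h1 h2 h3 h4 h]
  · intro h
    exact ⟨i, j, rfl, h1, h2, h⟩

theorem isCentrallySymmetric_diagsOf (S : Set (Arc n)) : IsCentrallySymmetric n (diagsOf S) := by
  rintro _ ⟨i, j, rfl, h1, h2, h3⟩
  refine ⟨_, _, inversion_diag i j, by omega, by omega, ?_⟩
  rwa [arc_shift (dvd_refl _)]

theorem diagsOf_arcsOf {D : Set (Sym2 (Vertex n))} (hD : IsCentrallySymmetric n D)
    (hd : ∀ d ∈ D, IsDiagonal n d) : diagsOf (arcsOf D) = D := by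
  ext d
  constructor
  · rintro ⟨i, j, rfl, h1, h2, h3⟩
    exact ((arc_mem_arcsOf hD).1 h3).2.2
  · intro h
    obtain ⟨i, j, rfl, h1, h2⟩ := exists_diag_of_isDiagonal (hd d h)
    exact ⟨i, j, rfl, by omega, h2, i, j, rfl, by omega, h2, h⟩

theorem arcsOf_diagsOf {S : Set (Arc n)} (hS : Noncrossing S) : arcsOf (diagsOf S) = S := by
  ext α
  obtain ⟨i, hi⟩ := exists_arc α
  rw [← hi]
  constructor
  · rw [arc_mem_arcsOf (isCentrallySymmetric_diagsOf S)]
    rintro ⟨h1, h2, h3⟩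
    exact (diag_mem_diagsOf h1 h2).1 h3
  · intro h
    have := hS.len _ h
    rw [arc_snd] at this
    exact ⟨i, _, rfl, by omega, by omega, i, _, rfl, by omega, by omega, h⟩

theorem noncrossing_arcsOf {D : Set (Sym2 (Vertex n))} (hD : IsCentrallySymmetric n D)
    (hdis : IsDissection n D) : Noncrossing (arcsOf D) := by
  constructor
  · rintro _ ⟨i, j, rfl, h1, h2, h3⟩
    rw [arc_snd]
    refine ⟨?_, by omega⟩
    by_contra h
    obtain rfl : j = i + 1 := by omega
    exact (hdis.1 _ h3).2 (isSide_diag i)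
  · intro i j p q h1 h2 h3
    have h1 := (arc_mem_arcsOf hD).1 h1
    have h2 := (arc_mem_arcsOf hD).1 h2
    exact hdis.2 _ h1.2.2 _ h2.2.2 (cross_diag h3.1 h3.2.1 h3.2.2 (by omega))

theorem isDissection_diagsOf {S : Set (Arc n)} (hS : Noncrossing S) :
    IsDissection n (diagsOf S) := by
  constructor
  · rintro _ ⟨i, j, rfl, h1, h2, h3⟩
    have := hS.len _ h3
    rw [arc_snd] at this
    exact isDiagonal_diag (by omega) h2
  · intro d hd e he h
    obtain ⟨i, j, p, q, h1, h2, h3, h4, h5, ⟨rfl, rfl⟩ | ⟨rfl, rfl⟩⟩ := exists_of_cross h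
    · rw [diag_mem_diagsOf (by omega) (by omega)] at hd he
      exact hS.nc _ _ _ _ hd he ⟨h1, h2, h3⟩
    · rw [diag_mem_diagsOf (by omega) (by omega)] at hd he
      exact hS.nc _ _ _ _ he hd ⟨h1, h2, h3⟩

theorem full_arcsOf {T : Set (Sym2 (Vertex n))} (hT : IsCentrallySymmetric n T)
    (h : IsTriangulation n T) : Full (arcsOf T) := by
  have hnc := noncrossing_arcsOf hT h.1
  refine ⟨hnc, fun i j h1 h2 h3 => ?_⟩
  have h4 := hnc.insert_arc h1 h2 h3
  have h5 : T ⊆ diagsOf (insert (arc n i j) (arcsOf T)) := by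
    rw [← diagsOf_arcsOf hT h.1.1]
    rintro _ ⟨p, q, rfl, h6, h7, h8⟩
    refine ⟨p, q, rfl, h6, h7, Or.inr ?_⟩
    rwa [diagsOf_arcsOf hT h.1.1]
  have h6 := h.2 (isDissection_diagsOf h4) h5
  refine (arc_mem_arcsOf hT).2 ⟨by omega, h2, h6 ?_⟩
  exact ⟨i, j, rfl, by omega, h2, Or.inl rfl⟩

/-- Maximality among symmetric sets gives maximality among all dissections: a diagonal that crosses
nothing in a symmetric set has a whole orbit that can be added. -/
theorem isTriangulation_diagsOf {S : Set (Arc n)} (hS : Full S) :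
    IsTriangulation n (diagsOf S) := by
  refine ⟨isDissection_diagsOf hS.toNoncrossing, fun D hD hsub d hd => ?_⟩
  obtain ⟨i, j, rfl, h1, h2⟩ := exists_diag_of_isDiagonal (hD.1 d hd)
  rw [diag_mem_diagsOf (by omega) h2]
  refine hS.full i j h1 h2 fun p q hpq => ?_
  have hlen := hS.len _ hpq
  rw [arc_snd] at hlen
  have h3 := hsub ((diag_mem_diagsOf (by omega) (by omega)).2 hpq)
  constructor
  · rintro ⟨h4, h5, h6⟩
    exact hD.2 _ h3 _ hd (cross_diag h4 h5 h6 (by omega))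
  · rintro ⟨h4, h5, h6⟩
    exact hD.2 _ hd _ h3 (cross_diag h4 h5 h6 (by omega))

theorem mem_or_isSide_of_edge {S : Set (Arc n)} (hS : Noncrossing S) {T : Set (Sym2 (Vertex n))}
    (hT : ∀ i j : ℤ, i < j → j ≤ i + ((n : ℤ) + 2) → arc n i j ∈ S → diag n i j ∈ T) {i j : ℤ}
    (h : Edge S i j) : diag n i j ∈ T ∨ IsSide n (diag n i j) := by
  have h1 := hS.lt h
  have h2 := hS.le h
  rcases h with rfl | h
  · exact Or.inr (isSide_diag i)
  · exact Or.inl (hT _ _ h1 h2 h)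

theorem Exchange.isDiagonalFlip {S : Set (Arc n)} {α β : Arc n} (h : Exchange S α β)
    (hα : α ∈ S) (hS : Noncrossing S) {T : Set (Sym2 (Vertex n))}
    (hT : ∀ i j : ℤ, i < j → j ≤ i + ((n : ℤ) + 2) → arc n i j ∈ S → diag n i j ∈ T) :
    ∃ i j p q : ℤ, i < j ∧ j ≤ i + ((n : ℤ) + 2) ∧ p < q ∧ q ≤ p + ((n : ℤ) + 2) ∧
      α = arc n i j ∧ β = arc n p q ∧ IsDiagonalFlip n T (diag n i j) (diag n p q) := by
  have key : ∀ {i j : ℤ}, Edge S i j → diag n i j ∈ T ∨ IsSide n (diag n i j) :=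
    fun h => mem_or_isSide_of_edge hS hT h
  have per : ∀ i : ℤ, ((i + (2 * (n : ℤ) + 4) : ℤ) : Vertex n) = i := by
    intro i
    rw [eq_comm, vertex_eq_iff]
    simp
  cases h with
  | @left w x y z h =>
    obtain ⟨h1, h2, h3, h4, e1, e2, e3, e4⟩ := h
    refine ⟨w, y, x, z, by omega, by omega, by omega, by omega, rfl, rfl,
      hT _ _ (by omega) (by omega) hα, w, x, y, z, sbtw_of_lt h1 h2 (by omega), ?_, rfl, rfl, ?_⟩
    · rw [← per w]
      exact sbtw_of_lt h3 (by omega) (by omega)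
    · rintro f (rfl | rfl | rfl | rfl)
      · exact key e1
      · exact key e2
      · exact key e3
      · have := key e4
        rwa [diag_comm] at this
  | @right w x y z h =>
    obtain ⟨h1, h2, h3, h4, e1, e2, e3, e4⟩ := h
    refine ⟨x, z, w, y, by omega, by omega, by omega, by omega, rfl, rfl,
      hT _ _ (by omega) (by omega) hα, x, y, z, w, sbtw_of_lt h2 h3 (by omega), ?_, rfl,
      diag_comm _ _, ?_⟩
    · rw [← per w, ← per x]
      exact sbtw_of_lt (by omega) (by omega) (by omega)
    · rintro f (rfl | rfl | rfl | rfl)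
      · exact key e2
      · exact key e3
      · have := key e4
        rwa [diag_comm] at this
      · exact key e1
  | @central a x h =>
    obtain ⟨h1, h2, e1, e2⟩ := h
    have e3 := key (e1.shift (dvd_refl _))
    have e4 := key (e2.shift (dvd_refl _))
    refine ⟨a, _, x, _, by omega, le_rfl, by omega, le_rfl, rfl, rfl,
      hT _ _ (by omega) le_rfl hα, a, x, (a + ((n : ℤ) + 2) : ℤ), (x + ((n : ℤ) + 2) : ℤ),
      sbtw_of_lt h1 h2 (by omega), ?_, rfl, rfl, ?_⟩
    · rw [← per a]
      exact sbtw_of_lt (by omega) (by omega) (by omega)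
    · rintro f (rfl | rfl | rfl | rfl)
      · exact key e1
      · exact key e2
      · exact e3
      · rw [show a + ((n : ℤ) + 2) + ((n : ℤ) + 2) = a + (2 * (n : ℤ) + 4) by ring,
          diag_shift_right (dvd_refl _)] at e4
        exact e4

namespace ColoredTriangulation

theorem color_inversion (t : ColoredTriangulation n) {d : Sym2 (Vertex n)} (hd : d ∈ t.supp) :
    t.color (inversion n d) = t.color d := by
  have hd' := t.isCentrallySymmetric d hd
  have hiff : IsCentral n (inversion n d) ↔ IsCentral n d := by
    obtain ⟨i, j, rfl, h1, h2⟩ := exists_diag_of_isDiagonal (t.isTriangulation.1.1 d hd)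
    rw [inversion_diag, isCentral_diag_iff (by omega) (by omega),
      isCentral_diag_iff (by omega) (by omega)]
    omega
  by_cases hc : IsCentral n d
  · rw [(t.color_eq_none_iff d hd).2 hc, (t.color_eq_none_iff _ hd').2 (hiff.2 hc)]
  · exact ((t.color_eq_color_iff d hd _ hd' hc (mt hiff.1 hc)).2 (Or.inr rfl)).symm

theorem full (t : ColoredTriangulation n) : Full (arcsOf t.supp) :=
  full_arcsOf t.isCentrallySymmetric t.isTriangulation

theorem arc_eq_of_color_eq (t : ColoredTriangulation n) {i j p q : ℤ} (h1 : i < j)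
    (h2 : j ≤ i + ((n : ℤ) + 2)) (h3 : p < q) (h4 : q ≤ p + ((n : ℤ) + 2))
    (h5 : diag n i j ∈ t.supp) (h6 : diag n p q ∈ t.supp)
    (h : t.color (diag n i j) = t.color (diag n p q)) : arc n i j = arc n p q := by
  have e1 := t.color_eq_none_iff _ h5
  have e2 := t.color_eq_none_iff _ h6
  by_cases hc : IsCentral n (diag n i j)
  · have hc' : IsCentral n (diag n p q) := e2.1 (h ▸ e1.2 hc)
    rw [isCentral_diag_iff h1 h2] at hc
    rw [isCentral_diag_iff h3 h4] at hc'
    obtain rfl : j = i + ((n : ℤ) + 2) := by omega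
    obtain rfl : q = p + ((n : ℤ) + 2) := by omega
    have := Full.central_unique t.full.toNoncrossing (a := p) (b := i)
      (Or.inr ⟨_, _, rfl, h3, h4, h6⟩) (Or.inr ⟨_, _, rfl, h1, h2, h5⟩)
    rw [arc_eq_arc_iff]
    exact ⟨this, by ring⟩
  · have hc' : ¬ IsCentral n (diag n p q) := fun h' => hc (e1.1 (h.trans (e2.2 h')))
    rcases (t.color_eq_color_iff _ h5 _ h6 hc hc').1 h with h7 | h7
    · rw [arc_eq_of_diag_eq h1 h2 h3 h4 h7.symm]
    · rw [inversion_diag] at h7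
      rw [arc_eq_of_diag_eq h3 h4 (by omega) (by omega) h7, arc_shift (dvd_refl _)]

/-- Labels separate the orbits of a triangulation, and there are n + 1 orbits as well as n + 1
labels, so every label is used. -/
theorem exists_diag_of_color (t : ColoredTriangulation n) (l : Option (Fin n)) :
    ∃ i j : ℤ, i < j ∧ j ≤ i + ((n : ℤ) + 2) ∧ diag n i j ∈ t.supp ∧
      t.color (diag n i j) = l := by
  have key : ∀ α ∈ arcsOf t.supp, ∃ l, ∃ i j : ℤ, α = arc n i j ∧ i < j ∧
      j ≤ i + ((n : ℤ) + 2) ∧ diag n i j ∈ t.supp ∧ t.color (diag n i j) = l := by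
    rintro α ⟨i, j, h1, h2, h3, h4⟩
    exact ⟨_, i, j, h1, h2, h3, h4, rfl⟩
  choose! c hc using key
  have hinj : Set.InjOn c (arcsOf t.supp) := by
    intro α hα β hβ hαβ
    obtain ⟨i, j, h1, h2, h3, h4, h5⟩ := hc α hα
    obtain ⟨p, q, h6, h7, h8, h9, h10⟩ := hc β hβ
    rw [h1, h6]
    exact t.arc_eq_of_color_eq h2 h3 h7 h8 h4 h9 (by rw [h5, h10, hαβ])
  have himg : c '' arcsOf t.supp = Set.univ := by
    refine Set.eq_of_subset_of_ncard_le (Set.subset_univ _) ?_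
    rw [hinj.ncard_image, t.full.ncard, Set.ncard_univ]
    simp
  have hl : l ∈ c '' arcsOf t.supp := himg ▸ Set.mem_univ l
  obtain ⟨α, hα, rfl⟩ := hl
  obtain ⟨i, j, h1, h2, h3, h4, h5⟩ := hc α hα
  exact ⟨i, j, h2, h3, h4, h5⟩

theorem exists_rooted (t : ColoredTriangulation n) :
    ∃ f : Rooted n, (∀ i j : ℤ, i < j → j ≤ i + ((n : ℤ) + 2) → diag n i j ∈ t.supp →
      f.1 (t.color (diag n i j)) = arc n i j) := by
  choose I J h1 h2 h3 h4 using t.exists_diag_of_color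
  refine ⟨⟨⟨fun l => arc n (I l) (J l), ?_, ?_⟩, ?_⟩, ?_⟩
  · refine t.full.toNoncrossing.mono ?_
    rintro _ ⟨l, rfl⟩
    exact ⟨_, _, rfl, h1 l, h2 l, h3 l⟩
  · intro l k h
    rw [← h4 l, ← h4 k]
    rcases diag_eq_or_of_arc_eq h with h5 | h5
    · rw [h5]
    · rw [h5, t.color_inversion (h3 l)]
  · exact (isCentral_diag_iff (h1 _) (h2 _)).1 ((t.color_eq_none_iff _ (h3 _)).1 (h4 none))
  · intro i j h5 h6 h7
    exact t.arc_eq_of_color_eq (h1 _) (h2 _) h5 h6 (h3 _) h7 (h4 _)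

/-- The labelled triangulation that corresponds to a colored triangulation. -/
noncomputable def toRooted (t : ColoredTriangulation n) : Rooted n := t.exists_rooted.choose

theorem toRooted_color (t : ColoredTriangulation n) {i j : ℤ} (h1 : i < j)
    (h2 : j ≤ i + ((n : ℤ) + 2)) (h : diag n i j ∈ t.supp) :
    t.toRooted.1 (t.color (diag n i j)) = arc n i j :=
  t.exists_rooted.choose_spec i j h1 h2 h

theorem color_of_toRooted (t : ColoredTriangulation n) {l : Option (Fin n)} {i j : ℤ}
    (h : t.toRooted.1 l = arc n i j) : diag n i j ∈ t.supp ∧ t.color (diag n i j) = l := by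
  obtain ⟨p, q, h1, h2, h3, h4⟩ := t.exists_diag_of_color l
  have h5 := t.toRooted_color h1 h2 h3
  rw [h4, h] at h5
  rcases diag_eq_or_of_arc_eq h5.symm with h6 | h6
  · rw [h6]
    exact ⟨h3, h4⟩
  · rw [h6, t.color_inversion h3]
    exact ⟨t.isCentrallySymmetric _ h3, h4⟩

theorem mem_supp_iff (t : ColoredTriangulation n) {i j : ℤ} (h1 : i < j)
    (h2 : j ≤ i + ((n : ℤ) + 2)) :
    diag n i j ∈ t.supp ↔ ∃ l, t.toRooted.1 l = arc n i j :=
  ⟨fun h => ⟨_, t.toRooted_color h1 h2 h⟩, fun ⟨_, hl⟩ => (t.color_of_toRooted hl).1⟩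

theorem exists_lift_apply (f : Labelling n) (l : Option (Fin n)) :
    ∃ i j : ℤ, f l = arc n i j ∧ i < j ∧ j ≤ i + ((n : ℤ) + 2) := by
  obtain ⟨i, hi⟩ := exists_arc (f l)
  have := f.2.noncrossing.len (f l) ⟨l, rfl⟩
  exact ⟨i, _, hi.symm, by omega, by omega⟩

theorem toRooted_injective : Function.Injective (toRooted : ColoredTriangulation n → Rooted n) := by
  intro t u h
  have hsub : ∀ t u : ColoredTriangulation n, t.toRooted = u.toRooted → ∀ d ∈ t.supp,
      d ∈ u.supp ∧ u.color d = t.color d := by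
    intro t u h d hd
    obtain ⟨i, j, rfl, h1, h2⟩ := exists_diag_of_isDiagonal (t.isTriangulation.1.1 d hd)
    have h3 := t.toRooted_color (by omega) h2 hd
    rw [h] at h3
    exact u.color_of_toRooted h3
  have hsupp : t.supp = u.supp :=
    Set.Subset.antisymm (fun d hd => (hsub t u h d hd).1) (fun d hd => (hsub u t h.symm d hd).1)
  ext1
  · exact hsupp
  · funext d
    by_cases hd : d ∈ t.supp
    · exact (hsub t u h d hd).2.symm
    · rw [t.color_of_notMem d hd, u.color_of_notMem d (hsupp ▸ hd)]

theorem toRooted_surjective :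
    Function.Surjective (toRooted : ColoredTriangulation n → Rooted n) := by
  classical
  intro f
  let P : Sym2 (Vertex n) → Option (Fin n) → Prop := fun d l =>
    ∃ i j : ℤ, d = diag n i j ∧ i < j ∧ j ≤ i + ((n : ℤ) + 2) ∧ f.1 l = arc n i j
  have hP : ∀ d l k, P d l → P d k → l = k := by
    rintro d l k ⟨i, j, rfl, h1, h2, h3⟩ ⟨p, q, h4, h5, h6, h7⟩
    apply f.1.2.injective
    rw [h3, h7, arc_eq_of_diag_eq h1 h2 h5 h6 h4]
  let col : Sym2 (Vertex n) → Option (Fin n) := fun d =>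
    if h : ∃ l, P d l then h.choose else none
  have hcol : ∀ d l, P d l → col d = l := by
    intro d l h
    have h' : ∃ l, P d l := ⟨l, h⟩
    have : col d = h'.choose := dif_pos h'
    rw [this]
    exact hP d _ _ h'.choose_spec h
  have hmem : ∀ d, d ∈ diagsOf (Set.range f.1.1) ↔ ∃ l, P d l := by
    intro d
    constructor
    · rintro ⟨i, j, h1, h2, h3, l, hl⟩
      exact ⟨l, i, j, h1, h2, h3, hl⟩
    · rintro ⟨l, i, j, h1, h2, h3, hl⟩
      exact ⟨i, j, h1, h2, h3, l, hl⟩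
  have hnone : ∀ d l, P d l → (l = none ↔ IsCentral n d) := by
    rintro d l ⟨i, j, rfl, h1, h2, h3⟩
    rw [isCentral_diag_iff h1 h2, ← arc_snd (n := n), ← h3]
    constructor
    · rintro rfl
      exact f.2
    · exact fun h => f.1.central_unique h f.2
  let t : ColoredTriangulation n :=
    { supp := diagsOf (Set.range f.1.1)
      color := col
      isTriangulation := isTriangulation_diagsOf f.1.2.full
      isCentrallySymmetric := isCentrallySymmetric_diagsOf _
      color_of_notMem := fun d hd => dif_neg (mt (hmem d).2 hd)
      color_eq_none_iff := by
        intro d hd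
        obtain ⟨l, hl⟩ := (hmem d).1 hd
        rw [hcol d l hl]
        exact hnone d l hl
      color_eq_color_iff := by
        intro d hd e he _ _
        obtain ⟨l, hl⟩ := (hmem d).1 hd
        obtain ⟨k, hk⟩ := (hmem e).1 he
        rw [hcol d l hl, hcol e k hk]
        obtain ⟨i, j, rfl, h1, h2, h3⟩ := hl
        obtain ⟨p, q, rfl, h4, h5, h6⟩ := hk
        constructor
        · rintro rfl
          exact diag_eq_or_of_arc_eq (h3.symm.trans h6)
        · rintro (h | h)
          · apply f.1.2.injective
            rw [h3, h6, arc_eq_of_diag_eq h4 h5 h1 h2 h]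
          · rw [inversion_diag] at h
            apply f.1.2.injective
            rw [h3, h6, arc_eq_of_diag_eq h4 h5 (by omega) (by omega) h, arc_shift (dvd_refl _)] }
  refine ⟨t, ?_⟩
  apply Subtype.ext
  apply Subtype.ext
  funext l
  obtain ⟨i, j, h1, h2, h3⟩ := exists_lift_apply f.1 l
  have hPl : P (diag n i j) l := ⟨i, j, rfl, h2, h3, h1⟩
  have h4 := t.toRooted_color h2 h3 ((hmem _).2 ⟨l, hPl⟩)
  have h5 : t.color (diag n i j) = l := hcol _ _ hPl
  rw [h5] at h4
  exact h4.trans h1.symm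

/-- Colored triangulations correspond to labelled triangulations. -/
noncomputable def equivRooted (n : ℕ) : ColoredTriangulation n ≃ Rooted n :=
  Equiv.ofBijective toRooted ⟨toRooted_injective, toRooted_surjective⟩

/-- Both sides are compared through `Labelling.flip_eq_iff`: a geometric flip keeps the other arcs
and changes that of c. Conversely, the exchange behind the labelled flip supplies the quadrilateral.
-/
theorem isFlip_iff (c : Option (Fin n)) (t u : ColoredTriangulation n) :
    IsFlip n c t u ↔ equivRooted n u = Rooted.flip c (equivRooted n t) := by
  change _ ↔ u.toRooted = Rooted.flip c t.toRooted
  rw [Subtype.ext_iff, Rooted.flip_val, Labelling.flip_eq_iff]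
  constructor
  · rintro ⟨d, d', ⟨hd, a, b, a', e, s1, s2, hda, hd', -⟩, hdc, hsupp, hc1, -, hcol⟩
    have hd'u : d' ∈ u.supp := hsupp ▸ Or.inr (Or.inl rfl)
    constructor
    · intro k hk
      obtain ⟨i, j, h1, h2, h3⟩ := exists_lift_apply t.toRooted.1 k
      obtain ⟨h4, h5⟩ := t.color_of_toRooted h1
      have h6 : diag n i j ∈ t.supp \ {d, inversion n d} := by
        refine ⟨h4, ?_⟩
        rintro (h | h)
        · exact hk (by rw [← h5, ← hdc, h])
        · rw [Set.mem_singleton_iff] at h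
          exact hk (by rw [← h5, ← hdc, h, t.color_inversion hd])
      have h7 := hcol _ h6
      rw [h5] at h7
      have h8 := u.toRooted_color h2 h3 (hsupp ▸ Or.inl h6)
      rw [h7] at h8
      rw [h8, h1]
    · intro h
      obtain ⟨i, j, hdij, h1, h2⟩ := exists_diag_of_isDiagonal (t.isTriangulation.1.1 d hd)
      obtain ⟨p, q, hdpq, h3, h4⟩ := exists_diag_of_isDiagonal (u.isTriangulation.1.1 d' hd'u)
      have e1 := t.toRooted_color (by omega) h2 (hdij ▸ hd)
      have e2 := u.toRooted_color (by omega) h4 (hdpq ▸ hd'u)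
      rw [← hdij, hdc] at e1
      rw [← hdpq, hc1] at e2
      have hmem : d' ∈ t.supp := by
        rcases diag_eq_or_of_arc_eq (e1.symm.trans (h.symm.trans e2)) with h5 | h5
        · rw [hdpq, h5, ← hdij]
          exact hd
        · rw [hdpq, h5, ← hdij]
          exact t.isCentrallySymmetric d hd
      -- An unchanged arc would put d' into the old triangulation, where it crosses d.
      exact t.isTriangulation.1.2 d hd d' hmem ⟨a, a', b, e, hda, hd', s1, s2⟩
  · intro hflip
    have hx := t.toRooted.1.exchange_flip c
    rw [← (Labelling.flip_eq_iff _ _ _).2 hflip] at hx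
    obtain ⟨i, j, p, q, h1, h2, h3, h4, h5, h6, h7⟩ :=
      hx.isDiagonalFlip ⟨c, rfl⟩ t.toRooted.1.2.noncrossing
        (T := t.supp) (fun i j h1 h2 h => (t.mem_supp_iff h1 h2).2 h)
    have hd := t.color_of_toRooted h5
    have hd' := u.color_of_toRooted h6
    have hne : ∀ e ∈ t.supp, e ∉ ({diag n i j, inversion n (diag n i j)} : Set _) →
        t.color e ≠ c := by
      intro e he hne hc
      obtain ⟨v, w, rfl, h8, h9⟩ := exists_diag_of_isDiagonal (t.isTriangulation.1.1 e he)
      have := t.arc_eq_of_color_eq h1 h2 (by omega) h9 hd.1 he (hd.2.trans hc.symm)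
      exact hne (diag_eq_or_of_arc_eq this)
    have hkeep : ∀ e ∈ t.supp, t.color e ≠ c → e ∈ u.supp ∧ u.color e = t.color e := by
      intro e he hc
      obtain ⟨v, w, rfl, h8, h9⟩ := exists_diag_of_isDiagonal (t.isTriangulation.1.1 e he)
      refine u.color_of_toRooted ?_
      rw [hflip.1 _ hc]
      exact t.toRooted_color (by omega) h9 he
    refine ⟨diag n i j, diag n p q, h7, hd.2, ?_, hd'.2, ?_, ?_⟩
    · ext e
      constructor
      · intro he
        obtain ⟨v, w, rfl, h8, h9⟩ := exists_diag_of_isDiagonal (u.isTriangulation.1.1 e he)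
        have h10 := u.toRooted_color (by omega) h9 he
        by_cases hc : u.color (diag n v w) = c
        · right
          rw [hc, h6] at h10
          exact diag_eq_or_of_arc_eq h10
        · left
          rw [hflip.1 _ hc] at h10
          obtain ⟨h11, h12⟩ := t.color_of_toRooted h10
          refine ⟨h11, ?_⟩
          rintro (h | h)
          · rw [h, hd.2] at h12
            rw [h] at hc
            exact hc h12.symm
          · rw [Set.mem_singleton_iff] at h
            rw [h, t.color_inversion hd.1, hd.2] at h12
            rw [h] at hc
            exact hc h12.symm
      · rintro (⟨he, he'⟩ | rfl | rfl)
        · exact (hkeep e he (hne e he he')).1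
        · exact hd'.1
        · exact u.isCentrallySymmetric _ hd'.1
    · rw [u.color_inversion hd'.1, hd'.2]
    · rintro e ⟨he, he'⟩
      exact (hkeep e he (hne e he he')).2

end ColoredTriangulation

end Cyclohedron

/-! ### Automorphism groups of the colorful cyclohedra -/

namespace Cyclohedron

open Labelling

section Transport

variable {X Y L : Type} {R : L → X → X → Prop} {R' : L → Y → Y → Prop} {r : L → Y → Y}

theorem nonempty_autGroup_mulEquiv_of_equiv (e : X ≃ Y)
    (hR : ∀ c x y, R c x y ↔ e y = r c (e x))
    (hR' : ∀ c x y, R' c x y ↔ y = r c x)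
    (hinv : ∀ c x, r c (r c x) = x)
    (hind : ∀ C x l, r l x ∈ flipClass R' C x → l ∈ C)
    (hconn : ∀ x y, y ∈ flipClass R' Set.univ x)
    {H : Type} [Group H] (ρ : H →* Equiv.Perm Y) (s : H →* Equiv.Perm L)
    (heq : ∀ g, FlipEquivariant r (ρ g) (s g)) (y0 : Y)
    (hfree : ∀ g, s g = 1 → ρ g y0 = y0 → g = 1)
    (hsurj : ∀ (φ : Equiv.Perm Y) (σ : Equiv.Perm L), FlipEquivariant r φ σ →
      ∃ g, s g = σ ∧ ρ g y0 = φ y0) :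
    Nonempty (AutGroup (FlipPoset R) ≃* H) := by
  obtain ⟨r', hr'⟩ : ∃ r' : L → X → X, ∀ c x, r' c x = e.symm (r c (e x)) := ⟨_, fun _ _ => rfl⟩
  have her : ∀ c x, e (r' c x) = r c (e x) := fun c x => by rw [hr', e.apply_symm_apply]
  have hrR : ∀ c x y, R c x y ↔ y = r' c x := fun c x y => by
    rw [hR, hr', Equiv.eq_symm_apply]
  have hinv' : ∀ c x, r' c (r' c x) = x := fun c x => by
    rw [hr', her, hinv, e.symm_apply_apply]
  refine nonempty_autGroup_mulEquiv hrR hinv' ?_ ?_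
    ((e.symm.permCongrHom).toMonoidHom.comp ρ) s ?_ (e.symm y0) ?_ ?_
  · intro C x l h
    refine hind C (e x) l ?_
    rw [← her]
    refine flipClass_induction hrR hinv' (P := fun y => e y ∈ flipClass R' C (e x))
      (mem_flipClass_self _ _) ?_ h
    intro y hy c hc
    rw [her]
    exact hy.trans _ _ _ (flip_mem_flipClass hR' hc _)
  · intro x y
    have := flipClass_induction hR' hinv (C := Set.univ)
      (P := fun z => e.symm z ∈ flipClass R Set.univ x) (x := e x) (y := e y) ?_ ?_
      (hconn _ _)
    · rwa [e.symm_apply_apply] at this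
    · rw [e.symm_apply_apply]
      exact mem_flipClass_self _ _
    · intro z hz c hc
      have h1 : e.symm (r c z) = r' c (e.symm z) := by rw [hr', e.apply_symm_apply]
      rw [h1]
      exact hz.trans _ _ _ (flip_mem_flipClass hrR hc _)
  · intro g l x
    change e.symm (ρ g (e (r' l x))) = r' (s g l) (e.symm (ρ g (e x)))
    rw [her, heq, hr', e.apply_symm_apply]
  · intro g h1 h2
    refine hfree g h1 ?_
    change e.symm (ρ g (e (e.symm y0))) = e.symm y0 at h2
    rw [e.apply_symm_apply] at h2
    exact e.symm.injective h2
  · intro φ σ h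
    obtain ⟨g, h1, h2⟩ := hsurj (e.permCongr φ) σ (fun l y => by
      rw [Equiv.permCongr_apply, Equiv.permCongr_apply]
      have h1 : e.symm (r l y) = r' l (e.symm y) := by rw [hr', e.apply_symm_apply]
      rw [h1, h, her])
    refine ⟨g, h1, ?_⟩
    change e.symm (ρ g (e (e.symm y0))) = _
    rw [e.apply_symm_apply, h2, Equiv.permCongr_apply, e.symm_apply_apply]

end Transport

theorem nonempty_autGroup_colorful {n : ℕ} (hn : 1 < n) :
    Nonempty (AutGroup (ColorfulCyclohedron n) ≃*
      Equiv.Perm (Fin n) × DihedralGroup (n + 2)) :=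
  -- `FlipPoset (IsFlip n)` and `ColorfulCyclohedron n` agree by unfolding.
  nonempty_autGroup_mulEquiv_of_equiv (R := IsFlip n) (ColoredTriangulation.equivRooted n)
    ColoredTriangulation.isFlip_iff Rooted.rel_iff Rooted.flip_flip Rooted.mem_of_flip_mem
    Rooted.mem_flipClass_univ
    (MulAction.toPermHom (Equiv.Perm (Fin n) × DihedralGroup (n + 2)) (Rooted n))
    (labelPerm.comp (MonoidHom.fst _ _)) (fun g l f => Rooted.smul_flip g l f) (Rooted.fan n)
    (fun _ h1 h2 => Rooted.eq_one_of_smul_fan hn.le h1 h2)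
    (fun _ _ h => Rooted.exists_smul_fan hn h)

theorem nonempty_autGroup_colorful_one :
    Nonempty (AutGroup (ColorfulCyclohedron 1) ≃* DihedralGroup 6) := by
  let e := Equiv.ofBijective _ Rooted.hexTriangulation_bijective
  have he : ∀ g, e g = Rooted.hexTriangulation g := fun _ => rfl
  refine nonempty_autGroup_mulEquiv_of_equiv (R := IsFlip 1) (ColoredTriangulation.equivRooted 1)
    ColoredTriangulation.isFlip_iff Rooted.rel_iff Rooted.flip_flip Rooted.mem_of_flip_mem
    Rooted.mem_flipClass_univ (e.permCongrHom.toMonoidHom.comp Rooted.hexAction)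
    Rooted.hexLabelAction ?_ (e 1) ?_ ?_
  · intro g l f
    obtain ⟨x, rfl⟩ := e.surjective f
    change e (Rooted.hexAction g (e.symm (Rooted.flip l (e x)))) =
      Rooted.flip (Rooted.hexLabelAction g l) (e (Rooted.hexAction g (e.symm (e x))))
    rw [he x, Rooted.flip_hexTriangulation, ← he, ← he, e.symm_apply_apply, e.symm_apply_apply,
      he (Rooted.hexAction g x), Rooted.flip_hexTriangulation, ← Rooted.hexAction_mul]
    rfl
  · intro g h1 h2
    refine Rooted.hexAction_free g h1 (e.injective ?_)
    change e (Rooted.hexAction g (e.symm (e 1))) = e 1 at h2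
    rwa [e.symm_apply_apply] at h2
  · intro φ σ _
    obtain ⟨g, h1, h2⟩ := Rooted.hexAction_transitive σ (e.symm (φ (e 1)))
    refine ⟨g, h1, ?_⟩
    change e (Rooted.hexAction g (e.symm (e 1))) = _
    rw [e.symm_apply_apply, h2, e.apply_symm_apply]

/-! ### Automorphisms of the ordinary cyclohedron -/

section Ordinary

variable {n : ℕ}

/-- The sets of pairwise non-crossing orbits of diagonals. -/
abbrev NoncrossingSet (n : ℕ) : Type := {S : Set (Arc n) // Noncrossing S}

/-- Centrally symmetric dissections as sets of orbits. -/
def dissectionEquiv (n : ℕ) : SymmetricDissection n ≃o NoncrossingSet n where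
  toFun D := ⟨arcsOf D.1, noncrossing_arcsOf D.2.2 D.2.1⟩
  invFun S := ⟨diagsOf S.1, isDissection_diagsOf S.2, isCentrallySymmetric_diagsOf S.1⟩
  left_inv D := Subtype.ext (diagsOf_arcsOf D.2.2 D.2.1.1)
  right_inv S := Subtype.ext (arcsOf_diagsOf S.2)
  map_rel_iff' := by
    intro D D'
    change arcsOf D.1 ⊆ arcsOf D'.1 ↔ D.1 ⊆ D'.1
    constructor
    · intro h
      rw [← diagsOf_arcsOf D.2.2 D.2.1.1, ← diagsOf_arcsOf D'.2.2 D'.2.1.1]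
      rintro _ ⟨i, j, rfl, h1, h2, h3⟩
      exact ⟨i, j, rfl, h1, h2, h h3⟩
    · rintro h _ ⟨i, j, rfl, h1, h2, h3⟩
      exact ⟨i, j, rfl, h1, h2, h h3⟩

theorem noncrossing_empty : Noncrossing (∅ : Set (Arc n)) :=
  ⟨fun _ h => h.elim, fun _ _ _ _ h => h.elim⟩

theorem noncrossing_singleton {α : Arc n} (h1 : 2 ≤ α.2) (h2 : α.2 ≤ (n : ℤ) + 2) :
    Noncrossing {α} := by
  obtain ⟨i, hi⟩ := exists_arc α
  have := noncrossing_empty.insert_arc (n := n) (i := i) (j := i + α.2) (by omega) (by omega)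
    (fun _ _ h => h.elim)
  rw [hi] at this
  simpa using this

/-- Singletons are the minimal elements above the empty set, which an automorphism fixes. -/
theorem exists_map_singleton (Φ : NoncrossingSet n ≃o NoncrossingSet n) {α : Arc n}
    (hα : Noncrossing {α}) : ∃ β, (Φ ⟨{α}, hα⟩).1 = {β} := by
  have hempty : ∀ (Ψ : NoncrossingSet n ≃o NoncrossingSet n) (S : NoncrossingSet n),
      (Ψ S).1 = ∅ → S.1 = ∅ := by
    intro Ψ S h
    have h1 : Ψ S ≤ Ψ ⟨∅, noncrossing_empty⟩ := by
      change (Ψ S).1 ⊆ _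
      rw [h]
      exact Set.empty_subset _
    rw [Ψ.le_iff_le] at h1
    exact Set.subset_empty_iff.1 h1
  have hne : (Φ ⟨{α}, hα⟩).1.Nonempty := by
    rw [Set.nonempty_iff_ne_empty]
    intro h
    exact Set.singleton_ne_empty α (hempty Φ _ h)
  obtain ⟨β, hβ⟩ := hne
  have hβn : Noncrossing {β} := (Φ ⟨{α}, hα⟩).2.mono (Set.singleton_subset_iff.2 hβ)
  have h1 : Φ.symm ⟨{β}, hβn⟩ ≤ ⟨{α}, hα⟩ := by
    rw [← Φ.le_iff_le, Φ.apply_symm_apply]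
    exact Set.singleton_subset_iff.2 hβ
  refine ⟨β, ?_⟩
  rcases Set.subset_singleton_iff_eq.1 h1 with h2 | h2
  · exact (Set.singleton_ne_empty β (hempty Φ.symm _ h2)).elim
  · have h3 : Φ.symm ⟨{β}, hβn⟩ = ⟨{α}, hα⟩ := Subtype.ext h2
    rw [← h3, Φ.apply_symm_apply]

/-- Every automorphism of the poset of non-crossing sets comes from a map of orbits. -/
theorem exists_arc_map (Φ : NoncrossingSet n ≃o NoncrossingSet n) :
    ∃ ψ : Arc n → Arc n, (∀ S : NoncrossingSet n, (Φ S).1 = ψ '' S.1) ∧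
      ∀ S : NoncrossingSet n, Set.InjOn ψ S.1 := by
  have key : ∀ α : Arc n, ∃ β, ∀ hα : Noncrossing {α}, (Φ ⟨{α}, hα⟩).1 = {β} := by
    intro α
    by_cases hα : Noncrossing {α}
    · obtain ⟨β, hβ⟩ := exists_map_singleton Φ hα
      exact ⟨β, fun _ => hβ⟩
    -- Arcs that are no orbits of diagonals occur in no non-crossing set; the value of ψ there is
    -- arbitrary.
    · exact ⟨α, fun h => (hα h).elim⟩
  choose ψ hψ using key
  have hmem : ∀ (S : NoncrossingSet n) {α : Arc n} (hα : Noncrossing {α}),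
      ψ α ∈ (Φ S).1 ↔ α ∈ S.1 := by
    intro S α hα
    have h1 : (⟨{α}, hα⟩ : NoncrossingSet n) ≤ S ↔ α ∈ S.1 := Set.singleton_subset_iff
    rw [← h1, ← Φ.le_iff_le]
    change _ ↔ (Φ ⟨{α}, hα⟩).1 ⊆ (Φ S).1
    rw [hψ α hα, Set.singleton_subset_iff]
  have hsing : ∀ (S : NoncrossingSet n) {α : Arc n}, α ∈ S.1 → Noncrossing {α} :=
    fun S α hα => S.2.mono (Set.singleton_subset_iff.2 hα)
  refine ⟨ψ, fun S => ?_, fun S α hα β hβ h => ?_⟩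
  · ext β
    constructor
    · intro hβ
      have hβn := hsing _ hβ
      obtain ⟨α, hα⟩ := exists_map_singleton Φ.symm hβn
      have hαn : Noncrossing {α} := hα ▸ (Φ.symm ⟨{β}, hβn⟩).2
      have h1 : Φ.symm ⟨{β}, hβn⟩ = ⟨{α}, hαn⟩ := Subtype.ext hα
      have h2 : ({β} : Set (Arc n)) = {ψ α} := by
        rw [← hψ α hαn, ← h1, Φ.apply_symm_apply]
      have h3 : β = ψ α := Set.singleton_injective h2
      rw [h3] at hβ ⊢
      exact ⟨α, (hmem S hαn).1 hβ, rfl⟩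
    · rintro ⟨α, hα, rfl⟩
      exact (hmem S (hsing S hα)).2 hα
  · have h1 := (hmem ⟨{β}, hsing S hβ⟩ (hsing S hα)).1
    rw [hψ β (hsing S hβ), h] at h1
    exact h1 rfl

/-- A map that preserves non-crossing sets acts on labelled triangulations. -/
def Labelling.map (ψ : Arc n → Arc n) (h1 : ∀ S, Noncrossing S → Noncrossing (ψ '' S))
    (h2 : ∀ S, Noncrossing S → Set.InjOn ψ S) (f : Labelling n) : Labelling n :=
  ⟨ψ ∘ f, by
    constructor
    · rw [Set.range_comp]
      exact h1 _ f.2.noncrossing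
    · intro a b h
      exact f.2.injective (h2 _ f.2.noncrossing ⟨a, rfl⟩ ⟨b, rfl⟩ h)⟩

/-- An automorphism of the poset of non-crossing sets that acts on labelled triangulations. -/
theorem exists_labelling_map (Φ : NoncrossingSet n ≃o NoncrossingSet n) :
    ∃ (ψ : Arc n → Arc n) (F : Equiv.Perm (Labelling n)),
      (∀ S : NoncrossingSet n, (Φ S).1 = ψ '' S.1) ∧ (∀ f l, F f l = ψ (f l)) ∧
      ∀ l f, F (f.flip l) = (F f).flip l := by
  obtain ⟨ψ, h1, h2⟩ := exists_arc_map Φ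
  obtain ⟨χ, h3, h4⟩ := exists_arc_map Φ.symm
  have hχψ : ∀ α, Noncrossing {α} → χ (ψ α) = α := by
    intro α hα
    have e1 := h1 ⟨{α}, hα⟩
    have e2 := h3 (Φ ⟨{α}, hα⟩)
    rw [Φ.symm_apply_apply, e1] at e2
    simpa using e2.symm
  have hψχ : ∀ α, Noncrossing {α} → ψ (χ α) = α := by
    intro α hα
    have e1 := h3 ⟨{α}, hα⟩
    have e2 := h1 (Φ.symm ⟨{α}, hα⟩)
    rw [Φ.apply_symm_apply, e1] at e2
    simpa using e2.symm
  have hsing : ∀ (f : Labelling n) l, Noncrossing {f l} := fun f l =>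
    f.2.noncrossing.mono (Set.singleton_subset_iff.2 ⟨l, rfl⟩)
  let F : Equiv.Perm (Labelling n) :=
    ⟨Labelling.map ψ (fun S hS => h1 ⟨S, hS⟩ ▸ (Φ ⟨S, hS⟩).2) (fun S hS => h2 ⟨S, hS⟩),
     Labelling.map χ (fun S hS => h3 ⟨S, hS⟩ ▸ (Φ.symm ⟨S, hS⟩).2) (fun S hS => h4 ⟨S, hS⟩),
     fun f => Subtype.ext (funext fun l => hχψ _ (hsing f l)),
     fun f => Subtype.ext (funext fun l => hψχ _ (hsing f l))⟩
  have hF : ∀ f l, F f l = ψ (f l) := fun _ _ => rfl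
  refine ⟨ψ, F, h1, hF, fun l f => ?_⟩
  rw [Labelling.flip_eq_iff]
  constructor
  · intro k hk
    rw [hF, hF, flip_apply_of_ne _ hk]
  · rw [hF, hF]
    intro h
    have h5 := congrArg χ h
    rw [hχψ _ (hsing _ _), hχψ _ (hsing _ _)] at h5
    exact f.flip_ne l h5

theorem Labelling.Conn.map {F : Labelling n → Labelling n}
    (hF : ∀ l f, F (f.flip l) = (F f).flip l) {f g : Labelling n} (h : Conn f g) :
    Conn (F f) (F g) := by
  induction h with
  | rel a b h =>
    obtain ⟨c, rfl⟩ := h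
    rw [hF]
    exact Conn.flip _ _
  | refl => exact Conn.refl _
  | symm _ _ _ ih => exact ih.symm
  | trans _ _ _ _ _ ih1 ih2 => exact ih1.trans ih2

/-- Every automorphism of the poset of non-crossing sets comes from the dihedral group. -/
theorem exists_arcAction (hn : 2 ≤ n) (Φ : NoncrossingSet n ≃o NoncrossingSet n) :
    ∃ g, ∀ S : NoncrossingSet n, (Φ S).1 = arcAction n g '' S.1 := by
  obtain ⟨ψ, F, h1, h2, h3⟩ := exists_labelling_map Φ
  have h3' : ∀ l f, F.symm (f.flip l) = (F.symm f).flip l := by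
    intro l f
    rw [Equiv.symm_apply_eq, h3, F.apply_symm_apply]
  -- F commutes with flips but may give the central diagonal another label m. As flips never change
  -- the central label, m is the same for all rooted triangulations.
  obtain ⟨m, hm⟩ := (F (Labelling.fan n 0)).exists_central
  have hFm : ∀ f : Rooted n, (F f.1 m).2 = (n : ℤ) + 2 := fun f =>
    (central_of_conn ((conn_fan f.1 f.2).map h3) m).2 hm
  set s : Equiv.Perm (Option (Fin n)) := Equiv.swap none m with hs
  have hss : ∀ f : Labelling n, relabel s (relabel s f) = f := by
    intro f
    rw [relabel_relabel, Equiv.swap_mul_self, relabel_one]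
  have hsn : ∀ f : Labelling n, relabel s f none = f m := by
    intro f
    rw [relabel_apply, hs, Equiv.symm_swap, Equiv.swap_apply_left]
  have hfan : (F.symm (relabel s (relabel s (F (Labelling.fan n 0)))) none).2 = (n : ℤ) + 2 := by
    rw [hss, F.symm_apply_apply]
    exact (Rooted.fan n).2
  have hinv : ∀ f : Rooted n, (F.symm (relabel s f.1) none).2 = (n : ℤ) + 2 := by
    intro f
    have hr : (relabel s (F (Labelling.fan n 0)) none).2 = (n : ℤ) + 2 := by rw [hsn, hm]
    have hc := (conn_fan f.1 f.2).trans (conn_fan _ hr).symm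
    exact (central_of_conn ((hc.relabel s).map h3') none).2 hfan
  let φ : Equiv.Perm (Rooted n) :=
    ⟨fun f => ⟨relabel s (F f.1), by rw [hsn, hFm]⟩, fun f => ⟨F.symm (relabel s f.1), hinv f⟩,
      fun f => Subtype.ext (by
        change F.symm (relabel s (relabel s (F f.1))) = f.1
        rw [hss, F.symm_apply_apply]),
      fun f => Subtype.ext (by
        change relabel s (F (F.symm (relabel s f.1))) = f.1
        rw [F.apply_symm_apply, hss])⟩
  have hφ : FlipEquivariant (Rooted.flip (n := n)) φ s := by
    intro l f
    apply Subtype.ext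
    change relabel s (F (f.1.flip l)) = (relabel s (F f.1)).flip (s l)
    rw [h3, flip_relabel]
  -- Swapping m back gives an equivariant pair of the colorful kind, whose label permutation must
  -- fix the central label.
  have hm0 : m = none := by
    have := Rooted.label_none_of_equivariant hn hφ
    rwa [hs, Equiv.swap_apply_left] at this
  subst hm0
  obtain ⟨p, hp1, hp2⟩ := Rooted.exists_smul_fan hn hφ
  have hp : (fun f : Rooted n => p • f) = φ := by
    refine FlipEquivariant.eq_of_eq (R := Rooted.Rel) Rooted.rel_iff Rooted.flip_flip
      Rooted.mem_flipClass_univ (σ := s) (r := Rooted.flip) ?_ hφ hp2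
    intro l f
    rw [← hp1]
    exact Rooted.smul_flip p l f
  have hs1 : s = 1 := Equiv.swap_self _
  -- Every orbit of diagonals belongs to the fan at its start, so ψ is known once F is known on
  -- fans.
  have hψ : ∀ α : Arc n, 2 ≤ α.2 → α.2 ≤ (n : ℤ) + 2 → ψ α = arcAction n p.2 α := by
    intro α a1 a2
    obtain ⟨a, ha⟩ := exists_arc α
    have hroot : (Labelling.fan n a none).2 = (n : ℤ) + 2 := by
      rw [fan_apply, arc_snd, fanLength_none]
      ring
    have h4 : (p • (⟨_, hroot⟩ : Rooted n)).1 = relabel s (F (Labelling.fan n a)) :=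
      congrArg Subtype.val (congrFun hp ⟨_, hroot⟩)
    rw [Rooted.smul_val, hp1, hs1, relabel_one, relabel_one] at h4
    have h5 := h2 (Labelling.fan n a) (fanLabel n α.2)
    rw [← h4, move_apply, fan_apply, fanLength_fanLabel a1 a2, ha] at h5
    exact h5.symm
  refine ⟨p.2, fun S => ?_⟩
  rw [h1]
  exact Set.image_congr fun α hα => hψ α (S.2.len α hα).1 (S.2.len α hα).2

/-- The dihedral group acts on the poset of non-crossing sets. -/
def noncrossingAction (n : ℕ) : DihedralGroup (n + 2) →* (NoncrossingSet n ≃o NoncrossingSet n) where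
  toFun g :=
    { toFun := fun S => ⟨arcAction n g '' S.1, S.2.arcAction g⟩
      invFun := fun S => ⟨arcAction n g⁻¹ '' S.1, S.2.arcAction g⁻¹⟩
      left_inv := fun S => Subtype.ext (by simp [Set.image_image])
      right_inv := fun S => Subtype.ext (by simp [Set.image_image])
      map_rel_iff' := Set.image_subset_image_iff (arcAction n g).injective }
  map_one' := by
    apply OrderIso.ext
    funext S
    apply Subtype.ext
    change arcAction n 1 '' S.1 = S.1
    rw [map_one]
    exact Set.image_id _
  map_mul' g k := by
    apply OrderIso.ext
    funext S
    apply Subtype.ext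
    change arcAction n (g * k) '' S.1 = arcAction n g '' (arcAction n k '' S.1)
    rw [map_mul, Set.image_image]
    rfl

theorem noncrossingAction_bijective (hn : 2 ≤ n) : Function.Bijective (noncrossingAction n) := by
  constructor
  · rw [injective_iff_map_eq_one]
    intro g hg
    have key : ∀ k : ℤ, 2 ≤ k → k ≤ (n : ℤ) + 2 → arcAction n g (arc n 0 k) = arc n 0 k := by
      intro k h1 h2
      have hk : Noncrossing {arc n 0 k} :=
        noncrossing_singleton (by rw [arc_snd]; omega) (by rw [arc_snd]; omega)
      have h3 : noncrossingAction n g ⟨_, hk⟩ = ⟨_, hk⟩ := by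
        rw [hg]
        rfl
      have h4 : arcAction n g '' {arc n 0 k} = {arc n 0 k} := congrArg Subtype.val h3
      simpa using h4
    exact Rooted.eq_one_of_arcAction (key 2 le_rfl (by omega)) (key 3 (by omega) (by omega))
  · intro Φ
    obtain ⟨g, hg⟩ := exists_arcAction hn Φ
    refine ⟨g, ?_⟩
    apply OrderIso.ext
    funext S
    exact Subtype.ext (hg S).symm

end Ordinary

/-! ### Order reversal and the added empty face do not change the automorphism group -/

section WithBot

/-- Conjugation by an order isomorphism. -/
def autCongr {P Q : Type} [PartialOrder P] [PartialOrder Q] (e : P ≃o Q) :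
    (P ≃o P) ≃* (Q ≃o Q) where
  toFun φ := e.symm.trans (φ.trans e)
  invFun φ := e.trans (φ.trans e.symm)
  left_inv φ := by ext x; simp
  right_inv φ := by ext x; simp
  map_mul' φ χ := by ext x; simp [RelIso.mul_apply]

/-- The automorphisms of an order with an added least element, for the reversed order. -/
noncomputable def autWithBotDual (Q : Type) [PartialOrder Q] :
    (Q ≃o Q) ≃* (WithBot Qᵒᵈ ≃o WithBot Qᵒᵈ) := by
  refine MulEquiv.ofBijective (MonoidHom.mk' (fun φ => φ.dual.withBotCongr) ?_) ⟨?_, ?_⟩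
  · intro φ χ
    apply OrderIso.ext
    funext x
    cases x <;> rfl
  · intro φ χ h
    ext x
    have := congrArg (fun Φ : WithBot Qᵒᵈ ≃o WithBot Qᵒᵈ => Φ ((OrderDual.toDual x : Qᵒᵈ) : WithBot Qᵒᵈ)) h
    exact WithBot.coe_injective this
  · intro Φ
    have key : ∀ (Ψ : WithBot Qᵒᵈ ≃o WithBot Qᵒᵈ) (x : Q),
        ∃ y : Q, Ψ ((OrderDual.toDual x : Qᵒᵈ) : WithBot Qᵒᵈ) = (OrderDual.toDual y : Qᵒᵈ) := by
      intro Ψ x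
      have : Ψ ((OrderDual.toDual x : Qᵒᵈ) : WithBot Qᵒᵈ) ≠ ⊥ := by
        rw [← Ψ.map_bot, Ne, Ψ.apply_eq_iff_eq]
        exact WithBot.coe_ne_bot
      obtain ⟨y, hy⟩ := WithBot.ne_bot_iff_exists.1 this
      exact ⟨OrderDual.ofDual y, hy.symm⟩
    choose f hf using key Φ
    choose g hg using key Φ.symm
    have hinj : ∀ x y : Q, ((OrderDual.toDual x : Qᵒᵈ) : WithBot Qᵒᵈ) =
        (OrderDual.toDual y : Qᵒᵈ) → x = y := fun x y h => WithBot.coe_injective h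
    refine ⟨⟨⟨f, g, fun x => hinj _ _ ?_, fun x => hinj _ _ ?_⟩, ?_⟩, ?_⟩
    · rw [← hg, ← hf, Φ.symm_apply_apply]
    · rw [← hf, ← hg, Φ.apply_symm_apply]
    · intro a b
      change f a ≤ f b ↔ a ≤ b
      rw [← OrderDual.toDual_le_toDual, ← WithBot.coe_le_coe, ← hf, ← hf, Φ.le_iff_le,
        WithBot.coe_le_coe, OrderDual.toDual_le_toDual]
    · apply OrderIso.ext
      funext x
      cases x with
      | bot => exact Φ.map_bot.symm
      | coe x => exact (hf x).symm

end WithBot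

theorem nonempty_autGroup_ordinary {n : ℕ} (hn : 1 < n) :
    Nonempty (AutGroup (OrdinaryCyclohedron n) ≃* DihedralGroup (n + 2)) :=
  ⟨((MulEquiv.ofBijective (noncrossingAction n) (noncrossingAction_bijective hn)).trans
    ((autCongr (dissectionEquiv n).symm).trans (autWithBotDual (SymmetricDissection n)))).symm⟩

end Cyclohedron

theorem theorem6p4 :
    (∀ n : ℕ, 1 < n →
      Nonempty (Cyclohedron.AutGroup (Cyclohedron.ColorfulCyclohedron n) ≃*
        Equiv.Perm (Fin n) × DihedralGroup (n + 2))) ∧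
    Nonempty (Cyclohedron.AutGroup (Cyclohedron.ColorfulCyclohedron 1) ≃* DihedralGroup 6) ∧
    (∀ n : ℕ, 1 < n →
      Nonempty (Cyclohedron.AutGroup (Cyclohedron.OrdinaryCyclohedron n) ≃*
        DihedralGroup (n + 2))) :=
  ⟨fun _ hn => Cyclohedron.nonempty_autGroup_colorful hn,
    Cyclohedron.nonempty_autGroup_colorful_one,
    fun _ hn => Cyclohedron.nonempty_autGroup_ordinary hn⟩
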